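/- Let $(X,g)$ be a closed (compact, without boundary) smooth Riemannian surface with Gaussian curvature $K\le 0$. Let $\mathcal O_1,\dots,\mathcal O_r\subset X$ be domains with smooth boundary whose closures are pairwise disjoint and which are geodesically convex in the (weak) sense that the geodesic curvature of $\partial\mathcal O_j$, taken with respect to the normal pointing into $\mathcal O_j$, is nonnegative at every point. Put $M=X\setminus\bigcup_{j=1}^r\mathcal O_j$ (a non-positively curved surface with concave boundary). Billiard trajectories in $M$ are unit speed curves in $M$ that consist of geodesic segments of $(X,g)$, with elastic reflection at the impacts on $\partial M$; a trajectory that hits $\partial M$ tangentially simply continues along the same geodesic of $X$. For $q\in\partial M$ let $\mathcal L_q$ be the set of unit tangent vectors $\xi\in T_qX$ pointing into $M$ (the two vectors tangent to $\partial M$ included) such that the billiard trajectory starting at $q$ with velocity $\xi$ is again at $q$ at some time $T>0$. The point $q$ is called a boundary self-focal point if $\mathcal L_q$ has positive arc length measure in the unit circle of $(T_qX,g_q)$. Then for every $q\in\partial M$ the set $\mathcal L_q$ is at most countable; in particular it has measure zero, so that $M$ has no boundary self-focal points. -/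

import Mathlib

open Set Filter MeasureTheory Bundle
open scoped Manifold ContDiff Topology

noncomputable section

namespace Billiard

/-- The model of a surface: the Euclidean plane. -/
abbrev Plane : Type := EuclideanSpace ℝ (Fin 2)

/-- The `i`-th vector of the standard basis of the plane. -/
def stdVec (i : Fin 2) : Plane := EuclideanSpace.single i 1

/-- The partial derivative `∂f/∂uⁱ` of a function on the plane. -/
def partialDeriv (i : Fin 2) (f : Plane → ℝ) (u : Plane) : ℝ := fderiv ℝ f u (stdVec i)

/-- A smooth (`C^∞`) Riemannian metric on the surface `X`. -/
abbrev SurfaceMetric (X : Type*) [TopologicalSpace X] [ChartedSpace Plane X]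
    [IsManifold (𝓡 2) ∞ X] : Type _ :=
  ContMDiffRiemannianMetric (𝓡 2) ∞ Plane (fun x : X => TangentSpace (𝓡 2) x)

section Surface

variable {X : Type*} [TopologicalSpace X] [ChartedSpace Plane X] [IsManifold (𝓡 2) ∞ X]

/-! ### Riemannian geometry in charts -/

/-- The matrix `(g_ij)` of the metric in the preferred chart at `x₀`, as a function of the
coordinates `u`. -/
def metricMatrix (g : SurfaceMetric X) (x₀ : X) (u : Plane) : Matrix (Fin 2) (Fin 2) ℝ :=
  Matrix.of fun i j =>
    g.inner ((chartAt Plane x₀).symm u)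
      (mfderiv (𝓡 2) (𝓡 2) (chartAt Plane x₀).symm u (stdVec i))
      (mfderiv (𝓡 2) (𝓡 2) (chartAt Plane x₀).symm u (stdVec j))

/-- The Christoffel symbol `Γ^k_ij` of the Levi-Civita connection in the preferred chart at `x₀`:
`Γ^k_ij = (1/2) ∑_l g^kl (∂_i g_jl + ∂_j g_il - ∂_l g_ij)`. -/
def christoffel (g : SurfaceMetric X) (x₀ : X) (k i j : Fin 2) (u : Plane) : ℝ :=
  (1 / 2 : ℝ) * ∑ l : Fin 2, (metricMatrix g x₀ u)⁻¹ k l *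
    (partialDeriv i (fun w => metricMatrix g x₀ w j l) u
      + partialDeriv j (fun w => metricMatrix g x₀ w i l) u
      - partialDeriv l (fun w => metricMatrix g x₀ w i j) u)

/-- The component `R^l_ijk` of the curvature tensor in the preferred chart at `x₀`, with the
convention `R(∂_i, ∂_j) ∂_k = ∑_l R^l_ijk ∂_l`, `R(U, V) = ∇_U ∇_V - ∇_V ∇_U - ∇_[U,V]`. -/
def riemannTensor (g : SurfaceMetric X) (x₀ : X) (l i j k : Fin 2) (u : Plane) : ℝ :=
  partialDeriv i (christoffel g x₀ l j k) u - partialDeriv j (christoffel g x₀ l i k) u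
    + ∑ m : Fin 2, (christoffel g x₀ l i m u * christoffel g x₀ m j k u
        - christoffel g x₀ l j m u * christoffel g x₀ m i k u)

/-- The Gaussian curvature `K = ⟨R(∂_0, ∂_1) ∂_1, ∂_0⟩ / det (g_ij)` at the point `x`, computed in
the preferred chart at `x`. -/
def gaussCurvature (g : SurfaceMetric X) (x : X) : ℝ :=
  (∑ l : Fin 2, metricMatrix g x (chartAt Plane x x) 0 l *
      riemannTensor g x l 0 1 1 (chartAt Plane x x))
    / (metricMatrix g x (chartAt Plane x x)).det

/-- The Hessian (second covariant derivative) `Hess f (v, v)` of a function `f` at `x`: in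
coordinates, `∑_ij (∂_i ∂_j f - ∑_k Γ^k_ij ∂_k f) vⁱ vʲ`. -/
def hessian (g : SurfaceMetric X) (f : X → ℝ) (x : X) (v : TangentSpace (𝓡 2) x) : ℝ :=
  let F : Plane → ℝ := fun u => f ((chartAt Plane x).symm u)
  let u : Plane := chartAt Plane x x
  let w : Plane := mfderiv (𝓡 2) (𝓡 2) (chartAt Plane x) x v
  ∑ i : Fin 2, ∑ j : Fin 2,
    (partialDeriv i (partialDeriv j F) u
      - ∑ k : Fin 2, christoffel g x k i j u * partialDeriv k F u) * w i * w j

/-- `γ` is a (complete, affinely parametrized) geodesic: a smooth curve satisfying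
`c''ᵏ + ∑_ij Γ^k_ij(c) c'ⁱ c'ʲ = 0` at each time, where `c` is the curve read in the preferred
chart at the current point. -/
def IsGeodesic (g : SurfaceMetric X) (γ : ℝ → X) : Prop :=
  ContMDiff 𝓘(ℝ, ℝ) (𝓡 2) ∞ γ ∧
    ∀ t : ℝ, ∀ k : Fin 2,
      let c : ℝ → Plane := fun s => chartAt Plane (γ t) (γ s)
      deriv (deriv c) t k
        + ∑ i : Fin 2, ∑ j : Fin 2,
            christoffel g (γ t) k i j (c t) * deriv c t i * deriv c t j = 0

/-- The point `(γ(t), γ'(t))` of the tangent bundle. -/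
def velocity (γ : ℝ → X) (t : ℝ) : TangentBundle (𝓡 2) X :=
  ⟨γ t, mfderiv 𝓘(ℝ, ℝ) (𝓡 2) γ t (1 : ℝ)⟩

/-! ### Obstacles and the billiard table -/

/-- `ρ` is a smooth function with non-vanishing differential at `p` and `ρ p = 0`, such that near
`p` the set `O` is `{ρ < 0}`. -/
structure IsDefiningFunctionAt (ρ : X → ℝ) (O : Set X) (p : X) : Prop where
  smooth : ContMDiff (𝓡 2) 𝓘(ℝ, ℝ) ∞ ρ
  eq_zero : ρ p = 0
  mfderiv_ne_zero : mfderiv (𝓡 2) 𝓘(ℝ, ℝ) ρ p ≠ 0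
  mem_iff : ∀ᶠ x in 𝓝 p, (x ∈ O ↔ ρ x < 0)

/-- A convex obstacle: a domain with smooth boundary which is geodesically convex along its
boundary. If `O = {ρ < 0}` near `p`, and `v` is a unit vector tangent to the boundary at `p`, then
`Hess ρ (v, v) / |dρ|` is the geodesic curvature of the boundary at `p` with respect to the normal
pointing into `O`; it is required to be nonnegative. -/
structure IsConvexObstacle (g : SurfaceMetric X) (O : Set X) : Prop where
  isOpen : IsOpen O
  isConnected : IsConnected O
  convex_boundary : ∀ p ∈ frontier O, ∃ ρ : X → ℝ, IsDefiningFunctionAt ρ O p ∧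
    ∀ v : TangentSpace (𝓡 2) p, mfderiv (𝓡 2) 𝓘(ℝ, ℝ) ρ p v = 0 → 0 ≤ hessian g ρ p v

/-- The billiard table `M = X \ ⋃ O_j`. -/
def table {r : ℕ} (O : Fin r → Set X) : Set X := (⋃ j, O j)ᶜ

/-- `ν` is the unit normal to the boundary of `M` at `p` pointing into `M`: it is a positive
multiple of the gradient of a function `ρ` such that `M = {0 ≤ ρ}` near `p`. -/
def IsInwardUnitNormal (g : SurfaceMetric X) (M : Set X) (p : X) (ν : TangentSpace (𝓡 2) p) :
    Prop :=
  g.inner p ν ν = 1 ∧ ∃ ρ : X → ℝ, IsDefiningFunctionAt ρ Mᶜ p ∧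
    ∃ c : ℝ, 0 < c ∧ ∀ v : TangentSpace (𝓡 2) p,
      mfderiv (𝓡 2) 𝓘(ℝ, ℝ) ρ p v = c * g.inner p ν v

/-- The reflection `v ↦ v - 2 ⟨v, ν⟩ ν` in the line orthogonal to the unit vector `ν`. -/
def reflect (g : SurfaceMetric X) (p : X) (ν v : TangentSpace (𝓡 2) p) : TangentSpace (𝓡 2) p :=
  v - (2 * g.inner p v ν) • ν

/-! ### The billiard flow and its loops -/

/-- The billiard (broken geodesic) flow on `M`, as a relation: `BilliardFlow g M (x, v) t (y, w)`
says that the billiard trajectory that starts at `x` with velocity `v` reaches `y` at time `t > 0`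
with velocity `w` (if `y` lies on the boundary, `w` is the velocity before reflection). The
trajectory is made of finitely many geodesic segments of the ambient surface that lie in `M`, with
elastic reflection at the boundary points between them. A trajectory that touches the boundary
tangentially is not affected and goes on along the same geodesic. -/
inductive BilliardFlow (g : SurfaceMetric X) (M : Set X) :
    TangentBundle (𝓡 2) X → ℝ → TangentBundle (𝓡 2) X → Prop
  | segment (γ : ℝ → X) (hγ : IsGeodesic g γ) (t : ℝ) (ht : 0 < t)
      (hM : ∀ s ∈ Icc 0 t, γ s ∈ M) :
      BilliardFlow g M (velocity γ 0) t (velocity γ t)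
  | bounce (a c : TangentBundle (𝓡 2) X) (s t : ℝ) (p : X) (v ν : TangentSpace (𝓡 2) p)
      (h₁ : BilliardFlow g M a s ⟨p, v⟩) (hp : p ∈ frontier M) (hν : IsInwardUnitNormal g M p ν)
      (h₂ : BilliardFlow g M ⟨p, reflect g p ν v⟩ t c) :
      BilliardFlow g M a (s + t) c

/-- The unit tangent vectors at the boundary point `q` that point into `M`, including the two
vectors tangent to the boundary. -/
def inwardUnitVectors (g : SurfaceMetric X) (M : Set X) (q : X) : Set (TangentSpace (𝓡 2) q) :=
  {ξ | g.inner q ξ ξ = 1 ∧ ∃ ν, IsInwardUnitNormal g M q ν ∧ 0 ≤ g.inner q ξ ν}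

/-- The set `L_q` of loop directions at the boundary point `q`: the inward unit directions whose
billiard trajectory returns to `q` at some time `T > 0`. -/
def loopDirections (g : SurfaceMetric X) (M : Set X) (q : X) : Set (TangentSpace (𝓡 2) q) :=
  {ξ | ξ ∈ inwardUnitVectors g M q ∧
    ∃ T : ℝ, 0 < T ∧ ∃ η : TangentSpace (𝓡 2) q, BilliardFlow g M ⟨q, ξ⟩ T ⟨q, η⟩}

/-- The arc length measure of a set of unit tangent vectors at `q`, that is, its one-dimensional
Hausdorff measure with respect to the norm of the inner product `g_q` on the tangent plane. -/
def arcLength (g : SurfaceMetric X) (q : X) (S : Set (TangentSpace (𝓡 2) q)) : ENNReal :=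
  letI : RiemannianBundle (fun x : X => TangentSpace (𝓡 2) x) := ⟨g.toRiemannianMetric⟩
  letI : MeasurableSpace (TangentSpace (𝓡 2) q) := borel (TangentSpace (𝓡 2) q)
  haveI : BorelSpace (TangentSpace (𝓡 2) q) := ⟨rfl⟩
  (Measure.hausdorffMeasure 1 : Measure (TangentSpace (𝓡 2) q)) S

/-- `q` is a boundary self-focal point if the set of its loop directions has positive measure. -/
def IsBoundarySelfFocal (g : SurfaceMetric X) (M : Set X) (q : X) : Prop :=
  0 < arcLength g q (loopDirections g M q)

end Surface

end Billiard

end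

/-!
A loop at `q` with `n` reflections is isolated among the loops at `q` with `n` reflections, if the
loops are compared by their initial directions and by the durations of their geodesic segments.
Hence for every `n` there are only countably many of them (`countable_brokenGeodesic_loops`), and a
countable set of directions has measure zero.

The reason for the isolation is that wave fronts emanating from `q` diverge. Consider a trajectory
and an infinitesimal displacement of it. Let `Q` be the square of the component of the displacement
normal to the velocity `v`, let `P` be the product of this component with that of the covariant
derivative, and let `R` be the square of the latter (`jacQ`, `jacP`, `jacR`; all are multiplied by
`|v|²`, which makes them polynomial). Along a geodesic `Q' = 2 P`, and the Jacobi equation gives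
`P' = R - K |v|² Q ≥ R ≥ 0`. So the conditions `P ≥ 0` and `Q + R > 0`, which hold at the start for
a rotation of the initial direction, imply `P ≥ 0` and `Q > 0` at all later times
(`isJet_propagate`). A transversal reflection preserves `Q`, and it does not decrease `P`, because
the Hessian of a defining function of the obstacle is nonnegative on the tangents of the boundary
(`jacQ_jacP_reflCoord`, `IsJet.reflect`). Therefore `Q > 0` at the end, whereas trajectories all of
which end at `q` could only be displaced along the limit trajectory, with `Q = 0`
(`not_eventually_eq_of_jacQ_pos`, `IsDiverging.not_forall_eq`).

The displacements are not obtained by differentiating the flow with respect to the initial data. If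
a loop were not isolated, there would be an ultrafilter on the loops, without the loop itself, that
converges to it. Along an ultrafilter bounded difference quotients have limits (`IsJet`), the bound
comes from Gronwall's inequality (`eventually_bound`), and the limits solve the linearized equation
(`hasDerivWithinAt_of_tendsto_quotient`). The times of the impacts vary along the family; passing
from a fixed time to the times of the impacts changes a displacement by a multiple of the geodesic
spray, which affects neither `Q` nor `P` (`IsJet.exists_at_hitting_times`).

A tangential impact does not change the velocity. By the uniqueness of geodesics the segments before
and after it form one geodesic segment, so only transversal reflections have to be counted
(`BilliardFlow.exists_brokenGeodesic`).
-/

noncomputable section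

namespace Billiard

/-! ### Linear algebra of the plane -/

theorem plane_eq (a : Plane) : a = a 0 • stdVec 0 + a 1 • stdVec 1 := by
  ext i; fin_cases i <;> simp [stdVec]

theorem linear_apply_plane {E : Type*} [AddCommGroup E] [Module ℝ E] (f : Plane →ₗ[ℝ] E)
    (a : Plane) : f a = a 0 • f (stdVec 0) + a 1 • f (stdVec 1) := by
  conv_lhs => rw [plane_eq a]
  simp only [map_add, map_smul]

theorem fderiv_eq_partialDeriv (f : Plane → ℝ) (u a : Plane) :
    fderiv ℝ f u a = a 0 * partialDeriv 0 f u + a 1 * partialDeriv 1 f u :=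
  linear_apply_plane (fderiv ℝ f u : Plane →ₗ[ℝ] ℝ) a

/-- The oriented area of the parallelogram spanned by two vectors of the plane. -/
def cross (a b : Plane) : ℝ := a 0 * b 1 - a 1 * b 0

section Surface

variable {X : Type*} [TopologicalSpace X] [ChartedSpace Plane X] [IsManifold (𝓡 2) ∞ X]

theorem contMDiffOn_chart_symm_plane (x₀ : X) :
    ContMDiffOn (𝓡 2) (𝓡 2) ∞ (chartAt Plane x₀).symm (chartAt Plane x₀).target :=
  contMDiffOn_chart_symm

theorem mdifferentiableAt_chart_symm (x₀ : X) {u : Plane} (hu : u ∈ (chartAt Plane x₀).target) :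
    MDifferentiableAt (𝓡 2) (𝓡 2) (chartAt Plane x₀).symm u :=
  (contMDiffOn_chart_symm_plane x₀).mdifferentiableOn (by simp) u hu |>.mdifferentiableAt
    ((chartAt Plane x₀).open_target.mem_nhds hu)

theorem mdifferentiableAt_chart (x₀ : X) {x : X} (hx : x ∈ (chartAt Plane x₀).source) :
    MDifferentiableAt (𝓡 2) (𝓡 2) (chartAt Plane x₀) x :=
  (contMDiffOn_chart (I := 𝓡 2) (n := ∞)).mdifferentiableOn (by simp) x hx |>.mdifferentiableAt
    ((chartAt Plane x₀).open_source.mem_nhds hx)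

/-- The coordinate vector fields are smooth. -/
theorem contMDiffOn_coordField (x₀ : X) (a : Plane) :
    ContMDiffOn (𝓡 2) (𝓡 2).tangent ∞
      (fun u : Plane => (TotalSpace.mk' Plane ((chartAt Plane x₀).symm u)
        (mfderiv (𝓡 2) (𝓡 2) (chartAt Plane x₀).symm u a) : TangentBundle (𝓡 2) X))
      (chartAt Plane x₀).target := by
  have h1 := (contMDiffOn_chart_symm_plane x₀).contMDiffOn_tangentMapWithin (m := ∞) (n := ∞)
    (by simp) (chartAt Plane x₀).open_target.uniqueMDiffOn
  have h2 : ContMDiff (𝓡 2) (𝓡 2).tangent ∞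
      (fun u : Plane => (TotalSpace.mk' Plane u a : TangentBundle (𝓡 2) Plane)) := by
    intro u
    rw [contMDiffAt_totalSpace]
    refine ⟨contMDiffAt_id, ?_⟩
    simp only [trivializationAt_model_space_apply]
    exact contMDiffAt_const
  have h3 := h1.comp (h2.contMDiffOn (s := (chartAt Plane x₀).target)) (fun u hu => hu)
  refine h3.congr fun u hu => ?_
  simp only [Function.comp, tangentMapWithin]
  rw [mfderivWithin_of_isOpen (chartAt Plane x₀).open_target hu]

variable (g : SurfaceMetric X)

theorem contDiffOn_metricMatrix (x₀ : X) (i j : Fin 2) :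
    ContDiffOn ℝ ∞ (fun u => metricMatrix g x₀ u i j) (chartAt Plane x₀).target := by
  rw [← contMDiffOn_iff_contDiffOn]
  let _ : RiemannianBundle (fun x : X => TangentSpace (𝓡 2) x) := ⟨g.toRiemannianMetric⟩
  exact ContMDiffOn.inner_bundle (F := Plane) (contMDiffOn_coordField x₀ (stdVec i))
    (contMDiffOn_coordField x₀ (stdVec j))

end Surface

/-! ### Partial derivatives -/

theorem partialDeriv_mul_add_mul (i : Fin 2) {f₁ h₁ f₂ h₂ : Plane → ℝ} {u : Plane}
    (hf₁ : DifferentiableAt ℝ f₁ u) (hh₁ : DifferentiableAt ℝ h₁ u)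
    (hf₂ : DifferentiableAt ℝ f₂ u) (hh₂ : DifferentiableAt ℝ h₂ u) :
    partialDeriv i (fun w => f₁ w * h₁ w + f₂ w * h₂ w) u
      = partialDeriv i f₁ u * h₁ u + f₁ u * partialDeriv i h₁ u
        + (partialDeriv i f₂ u * h₂ u + f₂ u * partialDeriv i h₂ u) := by
  have h := (hf₁.hasFDerivAt.mul hh₁.hasFDerivAt).add (hf₂.hasFDerivAt.mul hh₂.hasFDerivAt)
  unfold partialDeriv
  rw [show (fun w => f₁ w * h₁ w + f₂ w * h₂ w) = f₁ * h₁ + f₂ * h₂ from rfl, h.fderiv]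
  simp
  ring

theorem partialDeriv_add (i : Fin 2) {f h : Plane → ℝ} {u : Plane}
    (hf : DifferentiableAt ℝ f u) (hh : DifferentiableAt ℝ h u) :
    partialDeriv i (fun w => f w + h w) u = partialDeriv i f u + partialDeriv i h u := by
  unfold partialDeriv
  rw [show (fun w => f w + h w) = f + h from rfl, (hf.hasFDerivAt.add hh.hasFDerivAt).fderiv]
  simp

theorem contDiffOn_partialDeriv {s : Set Plane} (hs : IsOpen s) {f : Plane → ℝ}
    (hf : ContDiffOn ℝ ∞ f s) (i : Fin 2) : ContDiffOn ℝ ∞ (partialDeriv i f) s :=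
  ContDiffOn.clm_apply (hf.fderiv_of_isOpen hs (by simp)) contDiffOn_const

theorem fderiv_partialDeriv {f : Plane → ℝ} {u : Plane} (hf : ContDiffAt ℝ ∞ f u)
    (i : Fin 2) (a : Plane) :
    fderiv ℝ (partialDeriv i f) u a = fderiv ℝ (fderiv ℝ f) u a (stdVec i) := by
  have h1 : DifferentiableAt ℝ (fderiv ℝ f) u :=
    (hf.fderiv_right (m := 1) (by norm_cast)).differentiableAt (by simp)
  have h2 : HasFDerivAt (partialDeriv i f) _ u := h1.hasFDerivAt.clm_apply (hasFDerivAt_const _ _)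
  rw [h2.fderiv]
  simp

theorem partialDeriv_comm {f : Plane → ℝ} {u : Plane} (hf : ContDiffAt ℝ ∞ f u) (i j : Fin 2) :
    partialDeriv i (partialDeriv j f) u = partialDeriv j (partialDeriv i f) u := by
  have h1 := fderiv_partialDeriv hf j (stdVec i)
  have h2 := fderiv_partialDeriv hf i (stdVec j)
  have h3 : IsSymmSndFDerivAt ℝ f u := hf.isSymmSndFDerivAt (by
    simp; exact WithTop.coe_le_coe.2 le_top)
  rw [show partialDeriv i (partialDeriv j f) u = _ from h1,
    show partialDeriv j (partialDeriv i f) u = _ from h2]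
  exact h3 _ _

section Surface

variable {X : Type*} [TopologicalSpace X] [ChartedSpace Plane X] [IsManifold (𝓡 2) ∞ X]

/-! ### The metric in a chart -/

/-- The differential of the chart at `x₀` at the point `x`. -/
def chartD (x₀ x : X) : TangentSpace (𝓡 2) x →L[ℝ] Plane :=
  mfderiv (𝓡 2) (𝓡 2) (chartAt Plane x₀) x

/-- The differential of the inverse of the chart at `x₀` at the point with coordinates `u`. -/
def chartSymmD (x₀ : X) (u : Plane) :
    Plane →L[ℝ] TangentSpace (𝓡 2) ((chartAt Plane x₀).symm u) :=
  mfderiv (𝓡 2) (𝓡 2) (chartAt Plane x₀).symm u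

theorem chartD_chartSymmD (x₀ : X) {u : Plane} (hu : u ∈ (chartAt Plane x₀).target) (a : Plane) :
    chartD x₀ ((chartAt Plane x₀).symm u) (chartSymmD x₀ u a) = a := by
  have h := (mdifferentiable_chart (I := 𝓡 2) x₀).comp_symm_deriv hu
  exact DFunLike.congr_fun h a

theorem chartSymmD_chartD (x₀ : X) {x : X} (hx : x ∈ (chartAt Plane x₀).source)
    (v : TangentSpace (𝓡 2) x) :
    (chartSymmD x₀ (chartAt Plane x₀ x) (chartD x₀ x v) : Plane) = (v : Plane) := by
  have h := (mdifferentiable_chart (I := 𝓡 2) x₀).symm_comp_deriv hx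
  exact DFunLike.congr_fun h v

theorem chartD_injective (x₀ : X) {x : X} (hx : x ∈ (chartAt Plane x₀).source) :
    Function.Injective (chartD x₀ x) :=
  (mdifferentiable_chart (I := 𝓡 2) x₀).mfderiv_injective hx

theorem chartD_surjective (x₀ : X) {x : X} (hx : x ∈ (chartAt Plane x₀).source) :
    Function.Surjective (chartD x₀ x) :=
  (mdifferentiable_chart (I := 𝓡 2) x₀).mfderiv_surjective hx

variable (g : SurfaceMetric X)

/-- The inner product `∑ g_ij aⁱ bʲ` at `u` in the chart at `x₀`. -/
def gForm (x₀ : X) (u a b : Plane) : ℝ :=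
  ∑ i, ∑ j, metricMatrix g x₀ u i j * a i * b j

theorem metricMatrix_eq_inner (x₀ : X) (u : Plane) (i j : Fin 2) :
    metricMatrix g x₀ u i j = g.inner ((chartAt Plane x₀).symm u)
      (chartSymmD x₀ u (stdVec i)) (chartSymmD x₀ u (stdVec j)) := rfl

theorem gForm_eq_inner (x₀ : X) (u a b : Plane) :
    gForm g x₀ u a b = g.inner ((chartAt Plane x₀).symm u)
      (chartSymmD x₀ u a) (chartSymmD x₀ u b) := by
  have h : ∀ a : Plane, chartSymmD x₀ u a
      = a 0 • chartSymmD x₀ u (stdVec 0) + a 1 • chartSymmD x₀ u (stdVec 1) := fun a => by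
    conv_lhs => rw [plane_eq a]
    simp only [map_add, map_smul]
  rw [h a, h b]
  simp only [map_add, map_smul, add_apply, smul_apply,
    gForm, Fin.sum_univ_two, metricMatrix_eq_inner, smul_eq_mul]
  ring

theorem inner_eq_gForm (x₀ : X) {x : X} (hx : x ∈ (chartAt Plane x₀).source)
    (v w : TangentSpace (𝓡 2) x) :
    g.inner x v w = gForm g x₀ (chartAt Plane x₀ x) (chartD x₀ x v) (chartD x₀ x w) := by
  have key : ∀ (y : X) (v' w' : TangentSpace (𝓡 2) y), y = x → (v' : Plane) = (v : Plane) →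
      (w' : Plane) = (w : Plane) → g.inner x v w = g.inner y v' w' := by
    rintro y v' w' rfl hv hw
    rw [show v' = v from hv, show w' = w from hw]
  rw [gForm_eq_inner]
  exact key _ _ _ ((chartAt Plane x₀).left_inv hx) (chartSymmD_chartD x₀ hx v)
    (chartSymmD_chartD x₀ hx w)

theorem metricMatrix_symm (x₀ : X) (u : Plane) (i j : Fin 2) :
    metricMatrix g x₀ u i j = metricMatrix g x₀ u j i := by
  simp only [metricMatrix, Matrix.of_apply]
  exact g.symm _ _ _

theorem gForm_self_pos (x₀ : X) {u : Plane} (hu : u ∈ (chartAt Plane x₀).target) {a : Plane}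
    (ha : a ≠ 0) : 0 < gForm g x₀ u a a := by
  rw [gForm_eq_inner]
  apply g.pos
  intro h
  apply ha
  rw [← chartD_chartSymmD x₀ hu a, h, map_zero]

theorem gForm_self_nonneg (x₀ : X) {u : Plane} (hu : u ∈ (chartAt Plane x₀).target) (a : Plane) :
    0 ≤ gForm g x₀ u a a := by
  by_cases ha : a = 0
  · subst ha; simp [gForm]
  · exact (gForm_self_pos g x₀ hu ha).le

theorem gForm_comm (x₀ : X) (u a b : Plane) : gForm g x₀ u a b = gForm g x₀ u b a := by
  simp only [gForm, Fin.sum_univ_two, metricMatrix_symm g x₀ u 1 0]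
  ring

/-- The determinant of the metric in the chart at `x₀`. -/
def gDet (x₀ : X) (u : Plane) : ℝ := (metricMatrix g x₀ u).det

theorem gDet_eq (x₀ : X) (u : Plane) :
    gDet g x₀ u = metricMatrix g x₀ u 0 0 * metricMatrix g x₀ u 1 1
      - metricMatrix g x₀ u 0 1 * metricMatrix g x₀ u 0 1 := by
  rw [gDet, Matrix.det_fin_two, metricMatrix_symm g x₀ u 1 0]

theorem metricMatrix_zero_zero_pos (x₀ : X) {u : Plane} (hu : u ∈ (chartAt Plane x₀).target) :
    0 < metricMatrix g x₀ u 0 0 := by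
  have h := gForm_self_pos g x₀ hu (a := stdVec 0) (by
    intro h; simpa [stdVec] using congrArg (fun a : Plane => a 0) h)
  simpa [gForm, stdVec, Fin.sum_univ_two] using h

/-- Lagrange's identity for the inner product `g`. -/
theorem gDet_mul_cross (x₀ : X) (u a b c d : Plane) :
    gDet g x₀ u * (cross a b * cross c d) = gForm g x₀ u a c * gForm g x₀ u b d
      - gForm g x₀ u a d * gForm g x₀ u b c := by
  rw [gDet_eq]
  simp only [gForm, Fin.sum_univ_two, cross, metricMatrix_symm g x₀ u 1 0]
  ring

theorem gDet_pos (x₀ : X) {u : Plane} (hu : u ∈ (chartAt Plane x₀).target) :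
    0 < gDet g x₀ u := by
  have h0 := metricMatrix_zero_zero_pos g x₀ hu
  have h := gForm_self_pos g x₀ hu
    (a := metricMatrix g x₀ u 0 1 • stdVec 0 - metricMatrix g x₀ u 0 0 • stdVec 1) (by
      intro h; have := congrArg (fun a : Plane => a 1) h
      simp [stdVec] at this; exact h0.ne' this)
  have e : gForm g x₀ u
      (metricMatrix g x₀ u 0 1 • stdVec 0 - metricMatrix g x₀ u 0 0 • stdVec 1)
      (metricMatrix g x₀ u 0 1 • stdVec 0 - metricMatrix g x₀ u 0 0 • stdVec 1)
      = metricMatrix g x₀ u 0 0 * gDet g x₀ u := by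
    rw [gDet_eq]
    simp [gForm, Fin.sum_univ_two, stdVec, metricMatrix_symm g x₀ u 1 0]
    ring
  rw [e] at h
  exact pos_of_mul_pos_right h h0.le

theorem differentiableAt_metricMatrix (x₀ : X) {u : Plane} (hu : u ∈ (chartAt Plane x₀).target)
    (i j : Fin 2) : DifferentiableAt ℝ (fun u => metricMatrix g x₀ u i j) u :=
  ((contDiffOn_metricMatrix g x₀ i j).contDiffAt
    ((chartAt Plane x₀).open_target.mem_nhds hu)).differentiableAt (by simp)

theorem contDiffOn_gDet (x₀ : X) : ContDiffOn ℝ ∞ (gDet g x₀) (chartAt Plane x₀).target := by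
  have h := contDiffOn_metricMatrix g x₀
  refine (((h 0 0).mul (h 1 1)).sub ((h 0 1).mul (h 0 1))).congr fun u _ => gDet_eq g x₀ u

theorem inv_metricMatrix (x₀ : X) (u : Plane) (k l : Fin 2) :
    (metricMatrix g x₀ u)⁻¹ k l
      = (gDet g x₀ u)⁻¹ * (Matrix.adjugate (metricMatrix g x₀ u)) k l := by
  rw [Matrix.inv_def, Ring.inverse_eq_inv', Matrix.smul_apply, smul_eq_mul, gDet]

theorem contDiffOn_christoffel (x₀ : X) (k i j : Fin 2) :
    ContDiffOn ℝ ∞ (christoffel g x₀ k i j) (chartAt Plane x₀).target := by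
  have hm := contDiffOn_metricMatrix g x₀
  have hp := fun i j k =>
    contDiffOn_partialDeriv (chartAt Plane x₀).open_target (contDiffOn_metricMatrix g x₀ i j) k
  have hd : ContDiffOn ℝ ∞ (fun u => (gDet g x₀ u)⁻¹) (chartAt Plane x₀).target :=
    (contDiffOn_gDet g x₀).inv fun u hu => (gDet_pos g x₀ hu).ne'
  have hadj : ∀ k l, ContDiffOn ℝ ∞ (fun u => (Matrix.adjugate (metricMatrix g x₀ u)) k l)
      (chartAt Plane x₀).target := by
    intro k l
    simp only [Matrix.adjugate_fin_two]
    fin_cases k <;> fin_cases l <;> simp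
    · exact hm 1 1
    · exact (hm 0 1).neg
    · exact (hm 1 0).neg
    · exact hm 0 0
  unfold christoffel
  refine contDiffOn_const.mul (ContDiffOn.sum fun l _ => ContDiffOn.mul ?_ ?_)
  · simp only [inv_metricMatrix]
    exact hd.mul (hadj k l)
  · exact ((hp j l i).add (hp i l j)).sub (hp i j l)

theorem christoffel_symm (x₀ : X) (k i j : Fin 2) (u : Plane) :
    christoffel g x₀ k i j u = christoffel g x₀ k j i u := by
  unfold christoffel
  congr 1
  refine Finset.sum_congr rfl fun l _ => ?_
  rw [show (fun w => metricMatrix g x₀ w i j) = fun w => metricMatrix g x₀ w j i from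
    funext fun w => metricMatrix_symm g x₀ w i j]
  ring

theorem sum_christoffel_mul_metricMatrix (x₀ : X) {u : Plane}
    (hu : u ∈ (chartAt Plane x₀).target) (i a b : Fin 2) :
    christoffel g x₀ 0 i a u * metricMatrix g x₀ u 0 b
        + christoffel g x₀ 1 i a u * metricMatrix g x₀ u 1 b
      = 1 / 2 * (partialDeriv i (fun w => metricMatrix g x₀ w a b) u
        + partialDeriv a (fun w => metricMatrix g x₀ w i b) u
        - partialDeriv b (fun w => metricMatrix g x₀ w i a) u) := by
  have hd := (gDet_pos g x₀ hu).ne'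
  have hdet := gDet_eq g x₀ u
  unfold christoffel
  simp only [inv_metricMatrix, Fin.sum_univ_two, Matrix.adjugate_fin_two, Matrix.of_apply,
    Matrix.cons_val', Matrix.cons_val_zero, Matrix.cons_val_one,
    metricMatrix_symm g x₀ u 1 0]
  generalize gDet g x₀ u = D at *
  fin_cases b <;> simp only [Fin.zero_eta, Fin.mk_one, metricMatrix_symm g x₀ u 1 0] <;>
    field_simp <;> rw [hdet] <;> ring

/-- The Levi-Civita connection is metric. -/
theorem partialDeriv_metricMatrix (x₀ : X) {u : Plane}
    (hu : u ∈ (chartAt Plane x₀).target) (i a b : Fin 2) :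
    partialDeriv i (fun w => metricMatrix g x₀ w a b) u
      = (christoffel g x₀ 0 i a u * metricMatrix g x₀ u 0 b
          + christoffel g x₀ 1 i a u * metricMatrix g x₀ u 1 b)
        + (christoffel g x₀ 0 i b u * metricMatrix g x₀ u 0 a
          + christoffel g x₀ 1 i b u * metricMatrix g x₀ u 1 a) := by
  rw [sum_christoffel_mul_metricMatrix g x₀ hu, sum_christoffel_mul_metricMatrix g x₀ hu]
  rw [show (fun w => metricMatrix g x₀ w b a) = fun w => metricMatrix g x₀ w a b from
    funext fun w => metricMatrix_symm g x₀ w b a]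
  ring

/-! ### The sign of the curvature -/

theorem differentiableAt_christoffel (x₀ : X) {u : Plane} (hu : u ∈ (chartAt Plane x₀).target)
    (k i j : Fin 2) : DifferentiableAt ℝ (christoffel g x₀ k i j) u :=
  ((contDiffOn_christoffel g x₀ k i j).contDiffAt
    ((chartAt Plane x₀).open_target.mem_nhds hu)).differentiableAt (by simp)

theorem partialDeriv_partialDeriv_metricMatrix (x₀ : X) {u : Plane}
    (hu : u ∈ (chartAt Plane x₀).target) (j i a b : Fin 2) :
    partialDeriv j (partialDeriv i (fun w => metricMatrix g x₀ w a b)) u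
      = (partialDeriv j (christoffel g x₀ 0 i a) u * metricMatrix g x₀ u 0 b
          + christoffel g x₀ 0 i a u * partialDeriv j (fun w => metricMatrix g x₀ w 0 b) u
          + (partialDeriv j (christoffel g x₀ 1 i a) u * metricMatrix g x₀ u 1 b
          + christoffel g x₀ 1 i a u * partialDeriv j (fun w => metricMatrix g x₀ w 1 b) u))
        + (partialDeriv j (christoffel g x₀ 0 i b) u * metricMatrix g x₀ u 0 a
          + christoffel g x₀ 0 i b u * partialDeriv j (fun w => metricMatrix g x₀ w 0 a) u
          + (partialDeriv j (christoffel g x₀ 1 i b) u * metricMatrix g x₀ u 1 a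
          + christoffel g x₀ 1 i b u * partialDeriv j (fun w => metricMatrix g x₀ w 1 a) u)) := by
  have hev : partialDeriv i (fun w => metricMatrix g x₀ w a b) =ᶠ[𝓝 u] fun u =>
      (christoffel g x₀ 0 i a u * metricMatrix g x₀ u 0 b
          + christoffel g x₀ 1 i a u * metricMatrix g x₀ u 1 b)
        + (christoffel g x₀ 0 i b u * metricMatrix g x₀ u 0 a
          + christoffel g x₀ 1 i b u * metricMatrix g x₀ u 1 a) := by
    filter_upwards [(chartAt Plane x₀).open_target.mem_nhds hu] with w hw
    exact partialDeriv_metricMatrix g x₀ hw i a b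
  have hΓ := differentiableAt_christoffel g x₀ hu
  have hm := differentiableAt_metricMatrix g x₀ hu
  conv_lhs => rw [partialDeriv, hev.fderiv_eq]
  refine (partialDeriv_add j
    (((hΓ 0 i a).mul (hm 0 b)).add ((hΓ 1 i a).mul (hm 1 b)))
    (((hΓ 0 i b).mul (hm 0 a)).add ((hΓ 1 i b).mul (hm 1 a)))).trans ?_
  exact congrArg₂ (· + ·)
    (partialDeriv_mul_add_mul j (hΓ 0 i a) (hm 0 b) (hΓ 1 i a) (hm 1 b))
    (partialDeriv_mul_add_mul j (hΓ 0 i b) (hm 0 a) (hΓ 1 i b) (hm 1 a))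

/-- The curvature endomorphism `R(∂_0, ∂_1)` is skew-symmetric with respect to the metric: this is
the commutation of the second derivatives of the metric, written out with the connection. -/
theorem riemannTensor_skew (x₀ : X) {u : Plane} (hu : u ∈ (chartAt Plane x₀).target)
    (a b : Fin 2) :
    (riemannTensor g x₀ 0 0 1 a u * metricMatrix g x₀ u 0 b
      + riemannTensor g x₀ 1 0 1 a u * metricMatrix g x₀ u 1 b)
    + (riemannTensor g x₀ 0 0 1 b u * metricMatrix g x₀ u 0 a
      + riemannTensor g x₀ 1 0 1 b u * metricMatrix g x₀ u 1 a) = 0 := by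
  have hs := partialDeriv_comm ((contDiffOn_metricMatrix g x₀ a b).contDiffAt
    ((chartAt Plane x₀).open_target.mem_nhds hu)) 0 1
  rw [partialDeriv_partialDeriv_metricMatrix g x₀ hu,
    partialDeriv_partialDeriv_metricMatrix g x₀ hu] at hs
  simp only [partialDeriv_metricMatrix g x₀ hu] at hs
  simp only [riemannTensor, Fin.sum_univ_two]
  have e := metricMatrix_symm g x₀ u 1 0
  fin_cases a <;> fin_cases b <;>
    simp only [Fin.zero_eta, Fin.mk_one, e] at hs ⊢ <;> linear_combination hs

/-- In nonpositive curvature, `v × R(∂_0, ∂_1) v ≥ 0` for every vector `v`. -/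
theorem cross_riemannTensor_nonneg {x : X} (hK : gaussCurvature g x ≤ 0) (v : Plane) :
    0 ≤ v 0 * (riemannTensor g x 1 0 1 0 (chartAt Plane x x) * v 0
          + riemannTensor g x 1 0 1 1 (chartAt Plane x x) * v 1)
        - v 1 * (riemannTensor g x 0 0 1 0 (chartAt Plane x x) * v 0
          + riemannTensor g x 0 0 1 1 (chartAt Plane x x) * v 1) := by
  set u := chartAt Plane x x with hu'
  have hu : u ∈ (chartAt Plane x).target := mem_chart_target Plane x
  have hD := gDet_pos g x hu
  have h00 := riemannTensor_skew g x hu 0 0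
  have h01 := riemannTensor_skew g x hu 0 1
  have h11 := riemannTensor_skew g x hu 1 1
  have hq := gForm_self_nonneg g x hu v
  have hK' : metricMatrix g x u 0 0 * riemannTensor g x 0 0 1 1 u
      + metricMatrix g x u 0 1 * riemannTensor g x 1 0 1 1 u ≤ 0 := by
    have : gaussCurvature g x = (metricMatrix g x u 0 0 * riemannTensor g x 0 0 1 1 u
      + metricMatrix g x u 0 1 * riemannTensor g x 1 0 1 1 u) / gDet g x u := by
      rw [gaussCurvature, Fin.sum_univ_two, gDet]
    rw [this, div_le_iff₀ hD, zero_mul] at hK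
    exact hK
  refine (mul_nonneg_iff_of_pos_left hD).1 ?_
  have e := metricMatrix_symm g x u 1 0
  have hmul := mul_nonneg_of_nonpos_of_nonpos hK' (neg_nonpos.2 hq)
  refine hmul.trans_eq ?_
  simp only [gDet_eq, gForm, Fin.sum_univ_two, e] at *
  generalize metricMatrix g x u 0 0 = a, metricMatrix g x u 0 1 = b, metricMatrix g x u 1 1 = c,
    riemannTensor g x 0 0 1 0 u = p, riemannTensor g x 0 0 1 1 u = q,
    riemannTensor g x 1 0 1 0 u = r, riemannTensor g x 1 0 1 1 u = s,
    v 0 = y, v 1 = z at *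
  linear_combination (y ^ 2 * b / 2 + y * z * c / 2) * h00 - (a * y ^ 2 + b * y * z) * h01
    - (z ^ 2 * b / 2 + y * z * a / 2) * h11

/-! ### The Levi-Civita connection in a chart and its change under transition maps -/

/-- The vector `Γ(a, b)` with components `∑ Γ^k_ij aⁱ bʲ` at `u` in the chart at `x₀`. -/
def chrVec (x₀ : X) (u a b : Plane) : Plane :=
  WithLp.toLp 2 fun k => ∑ i, ∑ j, christoffel g x₀ k i j u * a i * b j

theorem chrVec_apply (x₀ : X) (u a b : Plane) (k : Fin 2) :
    chrVec g x₀ u a b k = ∑ i, ∑ j, christoffel g x₀ k i j u * a i * b j := rfl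

theorem chrVec_comm (x₀ : X) (u a b : Plane) : chrVec g x₀ u a b = chrVec g x₀ u b a := by
  ext k
  simp only [chrVec_apply, Fin.sum_univ_two, christoffel_symm g x₀ k 1 0]
  ring

theorem chrVec_smul_left (x₀ : X) (u a b : Plane) (s : ℝ) :
    chrVec g x₀ u (s • a) b = s • chrVec g x₀ u a b := by
  ext k
  simp only [chrVec_apply, Fin.sum_univ_two, PiLp.smul_apply, smul_eq_mul]
  ring

theorem chrVec_add_left (x₀ : X) (u a a' b : Plane) :
    chrVec g x₀ u (a + a') b = chrVec g x₀ u a b + chrVec g x₀ u a' b := by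
  ext k
  simp only [chrVec_apply, Fin.sum_univ_two, PiLp.add_apply]
  ring

theorem gForm_add_left (x₀ : X) (u a a' b : Plane) :
    gForm g x₀ u (a + a') b = gForm g x₀ u a b + gForm g x₀ u a' b := by
  simp only [gForm, Fin.sum_univ_two, PiLp.add_apply]
  ring

theorem gForm_add_right (x₀ : X) (u a b b' : Plane) :
    gForm g x₀ u a (b + b') = gForm g x₀ u a b + gForm g x₀ u a b' := by
  simp only [gForm, Fin.sum_univ_two, PiLp.add_apply]
  ring

theorem gForm_sub_left (x₀ : X) (u a a' b : Plane) :
    gForm g x₀ u (a - a') b = gForm g x₀ u a b - gForm g x₀ u a' b := by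
  simp only [gForm, Fin.sum_univ_two, PiLp.sub_apply]
  ring

theorem gForm_smul_left (x₀ : X) (u a b : Plane) (s : ℝ) :
    gForm g x₀ u (s • a) b = s * gForm g x₀ u a b := by
  simp only [gForm, Fin.sum_univ_two, PiLp.smul_apply, smul_eq_mul]
  ring

theorem hasDerivWithinAt_plane_apply {c : ℝ → Plane} {c' : Plane} {S : Set ℝ} {t : ℝ}
    (h : HasDerivWithinAt c c' S t) (i : Fin 2) : HasDerivWithinAt (fun s => c s i) (c' i) S t :=
  (EuclideanSpace.proj (𝕜 := ℝ) i).hasFDerivAt.comp_hasDerivWithinAt t h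

theorem hasDerivWithinAt_comp_plane {f : Plane → ℝ} {c : ℝ → Plane} {c' : Plane} {S : Set ℝ}
    {t : ℝ} (hf : DifferentiableAt ℝ f (c t)) (h : HasDerivWithinAt c c' S t) :
    HasDerivWithinAt (fun s => f (c s))
      (c' 0 * partialDeriv 0 f (c t) + c' 1 * partialDeriv 1 f (c t)) S t := by
  rw [← fderiv_eq_partialDeriv]
  exact hf.hasFDerivAt.comp_hasDerivWithinAt t h

/-- The product rule for the inner product of two vector fields along a curve, in terms of their
covariant derivatives. -/
theorem hasDerivWithinAt_gForm (x₀ : X) {c a b : ℝ → Plane} {c' a' b' : Plane} {S : Set ℝ} {t : ℝ}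
    (hu : c t ∈ (chartAt Plane x₀).target) (hc : HasDerivWithinAt c c' S t)
    (ha : HasDerivWithinAt a a' S t) (hb : HasDerivWithinAt b b' S t) :
    HasDerivWithinAt (fun s => gForm g x₀ (c s) (a s) (b s))
      (gForm g x₀ (c t) (a' + chrVec g x₀ (c t) c' (a t)) (b t)
        + gForm g x₀ (c t) (a t) (b' + chrVec g x₀ (c t) c' (b t))) S t := by
  have hm := fun i j =>
    hasDerivWithinAt_comp_plane (differentiableAt_metricMatrix g x₀ hu i j) hc
  have hai := fun i => hasDerivWithinAt_plane_apply ha i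
  have hbi := fun i => hasDerivWithinAt_plane_apply hb i
  have H := ((((hm 0 0).mul (hai 0)).mul (hbi 0)).add (((hm 0 1).mul (hai 0)).mul (hbi 1))).add
    ((((hm 1 0).mul (hai 1)).mul (hbi 0)).add (((hm 1 1).mul (hai 1)).mul (hbi 1)))
  refine (H.congr_deriv ?_).congr (fun s _ => ?_) ?_
  · simp only [partialDeriv_metricMatrix g x₀ hu, gForm, chrVec_apply, Fin.sum_univ_two,
      PiLp.add_apply, metricMatrix_symm g x₀ (c t) 1 0, Pi.mul_apply]
    ring
  all_goals
    simp only [gForm, Fin.sum_univ_two, Pi.mul_apply, Pi.add_apply]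

/-- The transition map from the chart at `x₀` to the chart at `x₁`. -/
def transition (x₀ x₁ : X) (u : Plane) : Plane := chartAt Plane x₁ ((chartAt Plane x₀).symm u)

/-- The domain of the transition map from the chart at `x₀` to the chart at `x₁`. -/
def overlap (x₀ x₁ : X) : Set Plane := ((chartAt Plane x₀).symm ≫ₕ chartAt Plane x₁).source

omit [IsManifold (𝓡 2) ∞ X] in
theorem mem_overlap {x₀ x₁ : X} {u : Plane} : u ∈ overlap x₀ x₁ ↔
    u ∈ (chartAt Plane x₀).target ∧ (chartAt Plane x₀).symm u ∈ (chartAt Plane x₁).source := by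
  simp [overlap]

omit [IsManifold (𝓡 2) ∞ X] in
theorem isOpen_overlap (x₀ x₁ : X) : IsOpen (overlap x₀ x₁) :=
  ((chartAt Plane x₀).symm ≫ₕ chartAt Plane x₁).open_source

omit [IsManifold (𝓡 2) ∞ X] in
theorem chart_mem_overlap {x₀ x₁ x : X} (h₀ : x ∈ (chartAt Plane x₀).source)
    (h₁ : x ∈ (chartAt Plane x₁).source) : chartAt Plane x₀ x ∈ overlap x₀ x₁ := by
  rw [mem_overlap, (chartAt Plane x₀).left_inv h₀]
  exact ⟨(chartAt Plane x₀).map_source h₀, h₁⟩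

omit [IsManifold (𝓡 2) ∞ X] in
theorem transition_chart {x₀ : X} (x₁ : X) {x : X} (h₀ : x ∈ (chartAt Plane x₀).source) :
    transition x₀ x₁ (chartAt Plane x₀ x) = chartAt Plane x₁ x := by
  rw [transition, (chartAt Plane x₀).left_inv h₀]

theorem contDiffOn_transition (x₀ x₁ : X) :
    ContDiffOn ℝ ∞ (transition x₀ x₁) (overlap x₀ x₁) := by
  rw [← contMDiffOn_iff_contDiffOn]
  refine (contMDiffOn_chart (I := 𝓡 2) (n := ∞) (x := x₁)).comp
    ((contMDiffOn_chart_symm_plane x₀).mono fun u hu => (mem_overlap.1 hu).1) ?_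
  exact fun u hu => (mem_overlap.1 hu).2

theorem contDiffAt_transition {x₀ x₁ : X} {u : Plane} (hu : u ∈ overlap x₀ x₁) :
    ContDiffAt ℝ ∞ (transition x₀ x₁) u :=
  (contDiffOn_transition x₀ x₁).contDiffAt ((isOpen_overlap x₀ x₁).mem_nhds hu)

theorem fderiv_transition {x₀ x₁ : X} {u : Plane} (hu : u ∈ overlap x₀ x₁) (a : Plane) :
    fderiv ℝ (transition x₀ x₁) u a
      = chartD x₁ ((chartAt Plane x₀).symm u) (chartSymmD x₀ u a) := by
  obtain ⟨h0, h1⟩ := mem_overlap.1 hu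
  have h := mfderiv_comp u (mdifferentiableAt_chart x₁ h1) (mdifferentiableAt_chart_symm x₀ h0)
  rw [← mfderiv_eq_fderiv]
  exact DFunLike.congr_fun h a

theorem fderiv_transition_chartD {x₀ x₁ x : X} (h₀ : x ∈ (chartAt Plane x₀).source)
    (h₁ : x ∈ (chartAt Plane x₁).source) (v : TangentSpace (𝓡 2) x) :
    fderiv ℝ (transition x₀ x₁) (chartAt Plane x₀ x) (chartD x₀ x v) = chartD x₁ x v := by
  rw [fderiv_transition (chart_mem_overlap h₀ h₁)]
  have key : ∀ (y : X) (v' : TangentSpace (𝓡 2) y), y = x → (v' : Plane) = (v : Plane) →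
      chartD x₁ y v' = chartD x₁ x v := by
    rintro y v' rfl hv
    rw [show v' = v from hv]
  exact key _ _ ((chartAt Plane x₀).left_inv h₀) (chartSymmD_chartD x₀ h₀ v)

theorem gForm_transition {x₀ x₁ : X} {u : Plane} (hu : u ∈ overlap x₀ x₁) (a b : Plane) :
    gForm g x₁ (transition x₀ x₁ u) (fderiv ℝ (transition x₀ x₁) u a)
      (fderiv ℝ (transition x₀ x₁) u b) = gForm g x₀ u a b := by
  rw [fderiv_transition hu, fderiv_transition hu, gForm_eq_inner g x₀,
    inner_eq_gForm g x₁ (mem_overlap.1 hu).2, transition]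

/-- The differential of a transition map preserves the metric, hence it is injective. -/
theorem surjective_fderiv_transition (g : SurfaceMetric X) {x₀ x₁ : X} {u : Plane}
    (hu : u ∈ overlap x₀ x₁) :
    Function.Surjective (fderiv ℝ (transition x₀ x₁) u) := by
  have hinj : Function.Injective (fderiv ℝ (transition x₀ x₁) u) := by
    rw [injective_iff_map_eq_zero]
    intro a ha
    by_contra hne
    have h := gForm_self_pos g x₀ (mem_overlap.1 hu).1 hne
    rw [← gForm_transition g hu, ha] at h
    simp [gForm] at h
  exact (LinearMap.injective_iff_surjective
    (f := (fderiv ℝ (transition x₀ x₁) u : Plane →ₗ[ℝ] Plane))).1 hinj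

/-- The derivative of the differential of a transition map, applied to a vector, along a curve. -/
theorem hasDerivWithinAt_fderiv_transition {x₀ x₁ : X} {c a : ℝ → Plane} {c' a' : Plane}
    {S : Set ℝ} {t : ℝ} (hu : c t ∈ overlap x₀ x₁) (hc : HasDerivWithinAt c c' S t)
    (ha : HasDerivWithinAt a a' S t) :
    HasDerivWithinAt (fun s => fderiv ℝ (transition x₀ x₁) (c s) (a s))
      (fderiv ℝ (fderiv ℝ (transition x₀ x₁)) (c t) c' (a t)
        + fderiv ℝ (transition x₀ x₁) (c t) a') S t := by
  have h1 : DifferentiableAt ℝ (fderiv ℝ (transition x₀ x₁)) (c t) :=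
    ((contDiffAt_transition hu).fderiv_right (m := 1) (by norm_cast)).differentiableAt (by simp)
  exact (h1.hasFDerivAt.comp_hasDerivWithinAt t hc).clm_apply ha

/-- The transformation law of the Christoffel symbols, from the uniqueness of the torsion-free
metric connection: a trilinear form which is symmetric in two of its arguments and skew-symmetric in
another two vanishes. -/
theorem chrVec_transition {x₀ x₁ : X} {u : Plane} (hu : u ∈ overlap x₀ x₁) (a b : Plane) :
    fderiv ℝ (fderiv ℝ (transition x₀ x₁)) u a b
      + chrVec g x₁ (transition x₀ x₁ u) (fderiv ℝ (transition x₀ x₁) u a)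
          (fderiv ℝ (transition x₀ x₁) u b)
      = fderiv ℝ (transition x₀ x₁) u (chrVec g x₀ u a b) := by
  set ψ := transition x₀ x₁
  have hψ := contDiffAt_transition hu
  have hmem : ψ u ∈ (chartAt Plane x₁).target :=
    (chartAt Plane x₁).map_source (mem_overlap.1 hu).2
  let S : Plane → Plane → Plane := fun a b => fderiv ℝ (fderiv ℝ ψ) u a b
      + chrVec g x₁ (ψ u) (fderiv ℝ ψ u a) (fderiv ℝ ψ u b) - fderiv ℝ ψ u (chrVec g x₀ u a b)
  let T : Plane → Plane → Plane → ℝ := fun c a b => gForm g x₁ (ψ u) (S c a) (fderiv ℝ ψ u b)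
  have hsymm : ∀ a c b, T c a b = T a c b := by
    intro a c b
    have h : IsSymmSndFDerivAt ℝ ψ u := hψ.isSymmSndFDerivAt (by
      simp; exact WithTop.coe_le_coe.2 le_top)
    simp only [T, S]
    rw [h c a, chrVec_comm g x₁, chrVec_comm g x₀]
  have hskew : ∀ a c b, T c a b = - T c b a := by
    intro a c b
    have hc : HasDerivWithinAt (fun s : ℝ => u + s • c) c univ 0 := by
      have := ((hasDerivAt_id (0 : ℝ)).smul_const c).const_add u
      simpa using this
    have hconst : ∀ a : Plane, HasDerivWithinAt (fun _ : ℝ => a) 0 univ 0 := fun a =>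
      hasDerivWithinAt_const _ _ _
    have e0 : u + (0 : ℝ) • c = u := by simp
    have h0 := hasDerivWithinAt_gForm g x₀ (by rw [e0]; exact (mem_overlap.1 hu).1) hc
      (hconst a) (hconst b)
    have hu' : u + (0 : ℝ) • c ∈ overlap x₀ x₁ := by rwa [e0]
    have hψc : HasDerivWithinAt (fun s : ℝ => ψ (u + s • c)) (fderiv ℝ ψ u c) univ 0 := by
      have h := (contDiffAt_transition hu').differentiableAt (by simp)
      have h' := h.hasFDerivAt.comp_hasDerivWithinAt (0 : ℝ) hc
      rw [e0] at h'
      exact h'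
    have h1 := hasDerivWithinAt_gForm g x₁ (by rw [e0]; exact hmem) hψc
      (hasDerivWithinAt_fderiv_transition hu' hc (hconst a))
      (hasDerivWithinAt_fderiv_transition hu' hc (hconst b))
    have hev : (fun s : ℝ => gForm g x₁ (ψ (u + s • c)) (fderiv ℝ ψ (u + s • c) a)
        (fderiv ℝ ψ (u + s • c) b)) =ᶠ[𝓝[univ] 0] fun s => gForm g x₀ (u + s • c) a b := by
      rw [nhdsWithin_univ]
      have hcont : ContinuousAt (fun s : ℝ => u + s • c) 0 := by fun_prop
      filter_upwards [hcont.preimage_mem_nhds ((isOpen_overlap x₀ x₁).mem_nhds hu')] with s hs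
      exact gForm_transition g hs a b
    have h2 := h1.congr_of_eventuallyEq hev.symm (gForm_transition g hu' a b).symm
    have h3 := uniqueDiffWithinAt_univ.eq_deriv _ h0 h2
    simp only [e0, map_zero, add_zero, zero_add] at h3
    rw [← gForm_transition g hu, ← gForm_transition g hu (a := a)] at h3
    simp only [T, S, gForm_sub_left]
    rw [gForm_comm g x₁ _ (fderiv ℝ ψ u a)] at h3
    rw [gForm_comm g x₁ _ (fderiv ℝ ψ u a)] at h3
    linarith
  have hT : ∀ c a b, T c a b = 0 := by
    intro c a b
    have h1 := hskew a c b
    have h2 := hsymm b c a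
    have h3 := hskew c b a
    have h4 := hsymm a b c
    have h5 := hskew b a c
    have h6 := hsymm c a b
    linarith
  obtain ⟨d, hd⟩ := surjective_fderiv_transition g hu (S a b)
  by_contra hne
  have hS : S a b ≠ 0 := fun h => hne (sub_eq_zero.1 h)
  have hpos := gForm_self_pos g x₁ hmem hS
  have := hT a b d
  simp only [T] at this
  rw [hd] at this
  exact hpos.ne' this

/-! ### The tangent bundle in charts -/

/-- The coordinates of a tangent vector induced by the chart at `x₀`. -/
def coord (x₀ : X) (V : TangentBundle (𝓡 2) X) : Plane × Plane :=
  (chartAt Plane x₀ V.1, chartD x₀ V.1 V.2)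

/-- The change of the coordinates of tangent vectors from the chart at `x₀` to that at `x₁`. -/
def coordChange (x₀ x₁ : X) (z : Plane × Plane) : Plane × Plane :=
  (transition x₀ x₁ z.1, fderiv ℝ (transition x₀ x₁) z.1 z.2)

theorem coordChange_coord {x₀ x₁ : X} {V : TangentBundle (𝓡 2) X}
    (h₀ : V.1 ∈ (chartAt Plane x₀).source) (h₁ : V.1 ∈ (chartAt Plane x₁).source) :
    coordChange x₀ x₁ (coord x₀ V) = coord x₁ V := by
  rw [coordChange, coord, coord]
  exact Prod.ext (transition_chart x₁ h₀) (fderiv_transition_chartD h₀ h₁ V.2)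

theorem coord_injOn (x₀ : X) {V W : TangentBundle (𝓡 2) X}
    (hV : V.1 ∈ (chartAt Plane x₀).source) (hW : W.1 ∈ (chartAt Plane x₀).source)
    (h : coord x₀ V = coord x₀ W) : V = W := by
  obtain ⟨x, v⟩ := V
  obtain ⟨y, w⟩ := W
  obtain rfl : x = y := (chartAt Plane x₀).injOn hV hW (congrArg Prod.fst h)
  have : v = w := chartD_injective x₀ hV (congrArg Prod.snd h)
  rw [this]

theorem hasFDerivAt_coordChange {x₀ x₁ : X} {z : Plane × Plane} (hz : z.1 ∈ overlap x₀ x₁) :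
    ∃ L : Plane × Plane →L[ℝ] Plane × Plane, HasFDerivAt (coordChange x₀ x₁) L z ∧
      ∀ ζ, L ζ = (fderiv ℝ (transition x₀ x₁) z.1 ζ.1,
        fderiv ℝ (fderiv ℝ (transition x₀ x₁)) z.1 ζ.1 z.2
          + fderiv ℝ (transition x₀ x₁) z.1 ζ.2) := by
  have h0 : DifferentiableAt ℝ (transition x₀ x₁) z.1 :=
    (contDiffAt_transition hz).differentiableAt (by simp)
  have h1 : DifferentiableAt ℝ (fderiv ℝ (transition x₀ x₁)) z.1 :=
    ((contDiffAt_transition hz).fderiv_right (m := 1) (by norm_cast)).differentiableAt (by simp)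
  have h0' := h0.hasFDerivAt.comp z (hasFDerivAt_fst (𝕜 := ℝ) (E := Plane) (F := Plane))
  have h1' := h1.hasFDerivAt.comp z (hasFDerivAt_fst (𝕜 := ℝ) (E := Plane) (F := Plane))
  have h2 := h1'.clm_apply (hasFDerivAt_snd (𝕜 := ℝ) (E := Plane) (F := Plane))
  refine ⟨_, h0'.prodMk h2, fun ζ => ?_⟩
  simp [add_comm]

/-! ### Jacobi fields: the invariants of an infinitesimal displacement -/

/-- A displacement `(ξ, η)` of the coordinates `(u, v)` of a tangent vector has the covariant
part `η + Γ(ξ, v)`. -/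
def covPart (x₀ : X) (z ζ : Plane × Plane) : Plane := ζ.2 + chrVec g x₀ z.1 ζ.1 z.2

/-- `⟨v, v⟩⟨a, b⟩ - ⟨v, a⟩⟨v, b⟩`, the product of the signed areas of the parallelograms `(v, a)`
and `(v, b)`. -/
def gram (x₀ : X) (u v a b : Plane) : ℝ :=
  gForm g x₀ u v v * gForm g x₀ u a b - gForm g x₀ u v a * gForm g x₀ u v b

theorem gram_eq_cross (x₀ : X) (u v a b : Plane) :
    gram g x₀ u v a b = gDet g x₀ u * (cross v a * cross v b) := by
  rw [gDet_mul_cross, gram, gForm_comm g x₀ u a v]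
  ring

/-- The square of the component of the displacement `ζ` normal to `v`, times `|v|²`. -/
def jacQ (x₀ : X) (z ζ : Plane × Plane) : ℝ := gram g x₀ z.1 z.2 ζ.1 ζ.1

/-- The product of the normal component of the displacement `ζ` and of its covariant derivative,
times `|v|²`. -/
def jacP (x₀ : X) (z ζ : Plane × Plane) : ℝ := gram g x₀ z.1 z.2 ζ.1 (covPart g x₀ z ζ)

/-- The square of the normal component of the covariant derivative, times `|v|²`. -/
def jacR (x₀ : X) (z ζ : Plane × Plane) : ℝ :=
  gram g x₀ z.1 z.2 (covPart g x₀ z ζ) (covPart g x₀ z ζ)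

theorem gram_self_nonneg (x₀ : X) {u : Plane} (hu : u ∈ (chartAt Plane x₀).target)
    (v a : Plane) : 0 ≤ gram g x₀ u v a a := by
  rw [gram_eq_cross]
  exact mul_nonneg (gDet_pos g x₀ hu).le (mul_self_nonneg _)

/-- The covariant part of a displacement transforms like a tangent vector. -/
theorem covPart_coordChange {x₀ x₁ : X} {z : Plane × Plane} (hz : z.1 ∈ overlap x₀ x₁)
    (ξ η : Plane) :
    covPart g x₁ (coordChange x₀ x₁ z) (fderiv ℝ (transition x₀ x₁) z.1 ξ,
        fderiv ℝ (fderiv ℝ (transition x₀ x₁)) z.1 ξ z.2 + fderiv ℝ (transition x₀ x₁) z.1 η)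
      = fderiv ℝ (transition x₀ x₁) z.1 (covPart g x₀ z (ξ, η)) := by
  simp only [covPart, coordChange, map_add]
  rw [← chrVec_transition g hz]
  abel

theorem gram_coordChange {x₀ x₁ : X} {u : Plane} (hu : u ∈ overlap x₀ x₁) (v a b : Plane) :
    gram g x₁ (transition x₀ x₁ u) (fderiv ℝ (transition x₀ x₁) u v)
      (fderiv ℝ (transition x₀ x₁) u a) (fderiv ℝ (transition x₀ x₁) u b) = gram g x₀ u v a b := by
  simp only [gram, gForm_transition g hu]

/-! ### The geodesic equation in an arbitrary chart -/

/-- The derivative `∂_c Γ(a, b)` of the connection in the direction `c`. -/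
def dChrVec (x₀ : X) (u c a b : Plane) : Plane :=
  WithLp.toLp 2 fun k => ∑ i, ∑ j, (c 0 * partialDeriv 0 (christoffel g x₀ k i j) u
    + c 1 * partialDeriv 1 (christoffel g x₀ k i j) u) * a i * b j

theorem hasDerivWithinAt_chrVec (x₀ : X) {c a b : ℝ → Plane} {c' a' b' : Plane} {S : Set ℝ}
    {t : ℝ} (hu : c t ∈ (chartAt Plane x₀).target) (hc : HasDerivWithinAt c c' S t)
    (ha : HasDerivWithinAt a a' S t) (hb : HasDerivWithinAt b b' S t) :
    HasDerivWithinAt (fun s => chrVec g x₀ (c s) (a s) (b s))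
      (dChrVec g x₀ (c t) c' (a t) (b t) + chrVec g x₀ (c t) a' (b t)
        + chrVec g x₀ (c t) (a t) b') S t := by
  rw [hasDerivWithinAt_iff_hasFDerivWithinAt, hasFDerivWithinAt_euclidean]
  intro k
  have hm := fun i j =>
    hasDerivWithinAt_comp_plane (differentiableAt_christoffel g x₀ hu k i j) hc
  have hai := fun i => hasDerivWithinAt_plane_apply ha i
  have hbi := fun i => hasDerivWithinAt_plane_apply hb i
  have H := ((((hm 0 0).mul (hai 0)).mul (hbi 0)).add (((hm 0 1).mul (hai 0)).mul (hbi 1))).add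
    ((((hm 1 0).mul (hai 1)).mul (hbi 0)).add (((hm 1 1).mul (hai 1)).mul (hbi 1)))
  refine HasFDerivWithinAt.congr (HasFDerivWithinAt.congr_fderiv H.hasFDerivWithinAt ?_)
    (fun s _ => ?_) ?_
  · ext
    simp [chrVec, dChrVec, Fin.sum_univ_two]
    ring
  all_goals
    simp [chrVec, Fin.sum_univ_two]

/-- The vector field of the geodesic flow in the coordinates of the chart at `x₀`. -/
def spray (x₀ : X) (z : Plane × Plane) : Plane × Plane := (z.2, - chrVec g x₀ z.1 z.2 z.2)

theorem contDiffAt_spray (x₀ : X) {z : Plane × Plane} (hz : z.1 ∈ (chartAt Plane x₀).target) :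
    ContDiffAt ℝ ∞ (spray g x₀) z := by
  refine contDiffAt_snd.prodMk (ContDiffAt.neg ?_)
  rw [contDiffAt_euclidean]
  intro k
  simp only [chrVec_apply]
  refine ContDiffAt.sum fun i _ => ContDiffAt.sum fun j _ =>
    ContDiffAt.mul (ContDiffAt.mul ?_ ?_) ?_
  · exact ((contDiffOn_christoffel g x₀ k i j).contDiffAt
      ((chartAt Plane x₀).open_target.mem_nhds hz)).comp z contDiffAt_fst
  · exact (EuclideanSpace.proj (𝕜 := ℝ) i).contDiff.contDiffAt.comp z contDiffAt_snd
  · exact (EuclideanSpace.proj (𝕜 := ℝ) j).contDiff.contDiffAt.comp z contDiffAt_snd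

/-- The linearization of the geodesic equation. -/
theorem fderiv_spray (x₀ : X) {z : Plane × Plane} (hz : z.1 ∈ (chartAt Plane x₀).target)
    (ζ : Plane × Plane) :
    fderiv ℝ (spray g x₀) z ζ
      = (ζ.2, - (dChrVec g x₀ z.1 ζ.1 z.2 z.2 + chrVec g x₀ z.1 ζ.2 z.2
          + chrVec g x₀ z.1 z.2 ζ.2)) := by
  have hline : ∀ a b : Plane, HasDerivWithinAt (fun s : ℝ => a + s • b) b univ 0 := fun a b => by
    simpa using (((hasDerivAt_id (0 : ℝ)).smul_const b).const_add a).hasDerivWithinAt (s := univ)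
  have e0 : ∀ a b : Plane, a + (0 : ℝ) • b = a := fun a b => by simp
  have h1 := hasDerivWithinAt_chrVec g x₀ (by rw [e0]; exact hz) (hline z.1 ζ.1) (hline z.2 ζ.2)
    (hline z.2 ζ.2)
  have h2 := (hline z.2 ζ.2).prodMk h1.neg
  have hd := ((contDiffAt_spray g x₀ hz).differentiableAt (by simp)).hasFDerivAt
  have h3 := HasFDerivAt.comp_hasDerivWithinAt (x := (0 : ℝ)) (s := univ)
    (f := fun s : ℝ => (z.1 + s • ζ.1, z.2 + s • ζ.2)) (f' := ζ) (l := spray g x₀)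
    (l' := fderiv ℝ (spray g x₀) z)
    (by simpa [e0] using hd) ((hline z.1 ζ.1).prodMk (hline z.2 ζ.2))
  have h4 := uniqueDiffWithinAt_univ.eq_deriv _ h3 h2
  simpa [e0] using h4

theorem coord_velocity_and_contDiffAt_chart (x₀ : X) {γ : ℝ → X}
    (hγ : ContMDiff 𝓘(ℝ, ℝ) (𝓡 2) ∞ γ) {t : ℝ} (ht : γ t ∈ (chartAt Plane x₀).source) :
    coord x₀ (velocity γ t) = (chartAt Plane x₀ (γ t), deriv (fun s => chartAt Plane x₀ (γ s)) t)
      ∧ ContDiffAt ℝ ∞ (fun s => chartAt Plane x₀ (γ s)) t := by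
  have hc : ContDiffAt ℝ ∞ (fun s => chartAt Plane x₀ (γ s)) t := by
    rw [← contMDiffAt_iff_contDiffAt]
    exact ((contMDiffOn_chart (I := 𝓡 2) (n := ∞)).contMDiffAt
      ((chartAt Plane x₀).open_source.mem_nhds ht)).comp t hγ.contMDiffAt
  refine ⟨?_, hc⟩
  have h := mfderiv_comp t (mdifferentiableAt_chart x₀ ht)
    (hγ.mdifferentiableAt (x := t) (by simp))
  refine Prod.ext rfl ?_
  rw [← fderiv_apply_one_eq_deriv, ← mfderiv_eq_fderiv]
  exact (DFunLike.congr_fun h (1 : ℝ)).symm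

/-- The geodesic sprays of two charts correspond to each other under the change of coordinates. -/
theorem spray_coordChange {x₀ x₁ : X} {z : Plane × Plane} (hz : z.1 ∈ overlap x₀ x₁) :
    (fderiv ℝ (transition x₀ x₁) z.1 (spray g x₀ z).1,
        fderiv ℝ (fderiv ℝ (transition x₀ x₁)) z.1 (spray g x₀ z).1 z.2
          + fderiv ℝ (transition x₀ x₁) z.1 (spray g x₀ z).2)
      = spray g x₁ (coordChange x₀ x₁ z) := by
  simp only [spray, coordChange, map_neg]
  rw [← chrVec_transition g hz]
  simp

variable {g}

theorem IsGeodesic.eventually_mem_source {γ : ℝ → X} (hγ : IsGeodesic g γ) {x₀ : X} {t : ℝ}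
    (ht : γ t ∈ (chartAt Plane x₀).source) : ∀ᶠ s in 𝓝 t, γ s ∈ (chartAt Plane x₀).source :=
  hγ.1.continuous.continuousAt.preimage_mem_nhds ((chartAt Plane x₀).open_source.mem_nhds ht)

/-- In every chart, the velocity of a geodesic is an integral curve of the geodesic spray. -/
theorem IsGeodesic.hasDerivAt_coord {γ : ℝ → X} (hγ : IsGeodesic g γ) {x₀ : X} {t : ℝ}
    (ht : γ t ∈ (chartAt Plane x₀).source) :
    HasDerivAt (fun s => coord x₀ (velocity γ s)) (spray g x₀ (coord x₀ (velocity γ t))) t := by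
  -- first in the preferred chart at `γ t`, where the equation is given
  have hself : HasDerivAt (fun s => coord (γ t) (velocity γ s))
      (spray g (γ t) (coord (γ t) (velocity γ t))) t := by
    have ht1 : γ t ∈ (chartAt Plane (γ t)).source := mem_chart_source Plane (γ t)
    obtain ⟨h1, h2⟩ := coord_velocity_and_contDiffAt_chart (γ t) hγ.1 ht1
    set c : ℝ → Plane := fun s => chartAt Plane (γ t) (γ s) with hc
    have hev : (fun s => coord (γ t) (velocity γ s)) =ᶠ[𝓝 t] fun s => (c s, deriv c s) := by
      filter_upwards [hγ.eventually_mem_source ht1] with s hs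
      exact (coord_velocity_and_contDiffAt_chart (γ t) hγ.1 hs).1
    have hd1 : HasDerivAt c (deriv c t) t := (h2.differentiableAt (by simp)).hasDerivAt
    have hd2 : HasDerivAt (deriv c) (deriv (deriv c) t) t := by
      have h3 : ContDiffAt ℝ 1 (fderiv ℝ c) t := h2.fderiv_right (by norm_cast)
      have h4 : DifferentiableAt ℝ (fun s => fderiv ℝ c s 1) t :=
        (h3.differentiableAt (by simp)).clm_apply (differentiableAt_const _)
      simp only [fderiv_apply_one_eq_deriv] at h4
      exact h4.hasDerivAt
    have h5 : deriv (deriv c) t = - chrVec g (γ t) (c t) (deriv c t) (deriv c t) := by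
      ext k
      have := hγ.2 t k
      simp only [← hc] at this
      rw [PiLp.neg_apply, chrVec_apply]
      linarith
    rw [h1]
    refine HasDerivAt.congr_of_eventuallyEq ?_ hev
    have h6 := hd1.prodMk hd2
    rwa [h5] at h6
  have ht1 : γ t ∈ (chartAt Plane (γ t)).source := mem_chart_source Plane (γ t)
  have hz : (coord (γ t) (velocity γ t)).1 ∈ overlap (γ t) x₀ := chart_mem_overlap ht1 ht
  obtain ⟨L, hL, hL'⟩ := hasFDerivAt_coordChange hz
  have h := hL.comp_hasDerivAt t hself
  rw [hL', spray_coordChange g hz, coordChange_coord (V := velocity γ t) ht1 ht] at h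
  refine h.congr_of_eventuallyEq ?_
  filter_upwards [hγ.eventually_mem_source ht1, hγ.eventually_mem_source ht] with s h1 h2
  exact (coordChange_coord (V := velocity γ s) h1 h2).symm

theorem IsGeodesic.comp_add {γ : ℝ → X} (hγ : IsGeodesic g γ) (τ : ℝ) :
    IsGeodesic g (fun t => γ (t + τ)) := by
  refine ⟨hγ.1.comp (contMDiff_iff_contDiff.2 (by fun_prop)), fun t k => ?_⟩
  have h := hγ.2 (t + τ) k
  have e : ∀ c : ℝ → Plane, deriv (fun s => c (s + τ)) = fun s => deriv c (s + τ) := fun c =>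
    funext fun s => deriv_comp_add_const c τ s
  have e1 := e (fun s => chartAt Plane (γ (t + τ)) (γ s))
  simp only at h ⊢
  rw [e1, e (deriv fun s => chartAt Plane (γ (t + τ)) (γ s))]
  exact h

theorem velocity_comp_add {γ : ℝ → X} (hγ : IsGeodesic g γ) (τ t : ℝ) :
    velocity (fun t => γ (t + τ)) t = velocity γ (t + τ) := by
  have h := mem_chart_source Plane (γ (t + τ))
  refine coord_injOn (γ (t + τ)) h h ?_
  rw [(coord_velocity_and_contDiffAt_chart _ (hγ.comp_add τ).1 h).1,
    (coord_velocity_and_contDiffAt_chart _ hγ.1 h).1]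
  rw [deriv_comp_add_const (fun s => chartAt Plane (γ (t + τ)) (γ s))]

/-! ### Nearby geodesics stay close -/

/-- Local dependence of geodesics on their initial velocities: in a chart, near a given time `t₀`,
the distance from a given geodesic grows at most by a fixed factor. -/
theorem IsGeodesic.exists_local_bound [T2Space X] {γ : ℝ → X} (hγ : IsGeodesic g γ) {x₀ : X}
    {t₀ : ℝ} (ht₀ : γ t₀ ∈ (chartAt Plane x₀).source) :
    ∃ η > 0, ∃ r > 0, ∃ C : ℝ, (∀ u ∈ Ioo (t₀ - η) (t₀ + η), γ u ∈ (chartAt Plane x₀).source) ∧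
      ∀ σ : ℝ → X, IsGeodesic g σ →
      ∀ s ∈ Ioo (t₀ - η) (t₀ + η), σ s ∈ (chartAt Plane x₀).source →
        ‖coord x₀ (velocity σ s) - coord x₀ (velocity γ s)‖ < r →
        ∀ u ∈ Ioo (t₀ - η) (t₀ + η), s ≤ u → σ u ∈ (chartAt Plane x₀).source ∧
          ‖coord x₀ (velocity σ u) - coord x₀ (velocity γ u)‖
            ≤ C * ‖coord x₀ (velocity σ s) - coord x₀ (velocity γ s)‖ := by
  set z : ℝ → Plane × Plane := fun s => coord x₀ (velocity γ s) with hz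
  have hz₀ : (z t₀).1 ∈ (chartAt Plane x₀).target := (chartAt Plane x₀).map_source ht₀
  -- a ball on which the spray is bounded and Lipschitz
  obtain ⟨K, U, hU, hK⟩ := ((contDiffAt_spray g x₀ hz₀).of_le
    (by simp : (1 : WithTop ℕ∞) ≤ ∞)).exists_lipschitzOnWith
  have hcont : ContinuousAt (spray g x₀) (z t₀) := (contDiffAt_spray g x₀ hz₀).continuousAt
  obtain ⟨B, hB0, hB⟩ : ∃ B > 0, ∀ᶠ w in 𝓝 (z t₀), ‖spray g x₀ w‖ ≤ B := by
    refine ⟨‖spray g x₀ (z t₀)‖ + 1, by positivity, ?_⟩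
    have := hcont.norm.eventually (gt_mem_nhds (lt_add_one ‖spray g x₀ (z t₀)‖))
    exact this.mono fun _ h => h.le
  have htar : ∀ᶠ w in 𝓝 (z t₀), w.1 ∈ (chartAt Plane x₀).target :=
    continuousAt_fst.preimage_mem_nhds ((chartAt Plane x₀).open_target.mem_nhds hz₀)
  obtain ⟨R, hR, hball⟩ := Metric.nhds_basis_closedBall.mem_iff.1 (inter_mem hU (inter_mem hB htar))
  have hdz := hγ.hasDerivAt_coord ht₀
  obtain ⟨η₁, hη₁, hγη⟩ := Metric.eventually_nhds_iff.1 ((hγ.eventually_mem_source ht₀).and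
    (hdz.continuousAt.eventually (Metric.ball_mem_nhds _ (show 0 < R / 4 by positivity))))
  set η := min η₁ (R / (16 * B)) with hη
  have hη0 : 0 < η := lt_min hη₁ (by positivity)
  have hηB : B * (2 * η) ≤ R / 8 := by
    have : η ≤ R / (16 * B) := min_le_right _ _
    rw [le_div_iff₀ (by positivity)] at this
    linarith
  have hγ' : ∀ u ∈ Ioo (t₀ - η) (t₀ + η), γ u ∈ (chartAt Plane x₀).source ∧
      ‖z u - z t₀‖ < R / 4 := by
    intro u hu
    have : dist u t₀ < η₁ := by
      rw [Real.dist_eq, abs_lt]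
      have : η ≤ η₁ := min_le_left _ _
      constructor <;> linarith [hu.1, hu.2]
    have h := hγη this
    refine ⟨h.1, ?_⟩
    rw [← dist_eq_norm]
    exact h.2
  refine ⟨η, hη0, R / 4, by positivity, Real.exp (K * (2 * η)), fun u hu => (hγ' u hu).1, ?_⟩
  intro σ hσ s hs hσs hclose u hu hsu
  set y : ℝ → Plane × Plane := fun s => coord x₀ (velocity σ s) with hy
  -- the set of points with coordinates in a closed ball is closed
  set Kc : Set X := (chartAt Plane x₀).symm '' Metric.closedBall (z t₀).1 R with hKc
  have hsub : Metric.closedBall (z t₀).1 R ⊆ (chartAt Plane x₀).target := by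
    intro w hw
    have : (w, (z t₀).2) ∈ Metric.closedBall (z t₀) R := by
      rw [Metric.mem_closedBall, Prod.dist_eq]
      exact max_le hw (by simpa using hR.le)
    exact (hball this).2.2
  have hKclosed : IsClosed Kc :=
    ((isCompact_closedBall _ _).image_of_continuousOn
      ((chartAt Plane x₀).continuousOn_symm.mono hsub)).isClosed
  have hKmem : ∀ x, x ∈ Kc ↔ x ∈ (chartAt Plane x₀).source ∧
      chartAt Plane x₀ x ∈ Metric.closedBall (z t₀).1 R := by
    intro x
    constructor
    · rintro ⟨w, hw, rfl⟩
      exact ⟨(chartAt Plane x₀).map_target (hsub hw),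
        by rwa [(chartAt Plane x₀).right_inv (hsub hw)]⟩
    · rintro ⟨h1, h2⟩
      exact ⟨_, h2, (chartAt Plane x₀).left_inv h1⟩
  have hys : ‖y s - z t₀‖ < R / 2 := by
    have := (hγ' s hs).2
    calc ‖y s - z t₀‖ = ‖(y s - z s) + (z s - z t₀)‖ := by abel_nf
      _ ≤ ‖y s - z s‖ + ‖z s - z t₀‖ := norm_add_le _ _
      _ < R / 4 + R / 4 := add_lt_add hclose this
      _ = R / 2 := by ring
  -- the set of times up to which the geodesic has stayed in the ball
  set A : Set ℝ := {v | ∀ w ∈ Icc s v, σ w ∈ (chartAt Plane x₀).source ∧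
    y w ∈ Metric.closedBall (z t₀) R} with hA
  have hder : ∀ w, σ w ∈ (chartAt Plane x₀).source → HasDerivAt y (spray g x₀ (y w)) w :=
    fun w hw => hσ.hasDerivAt_coord hw
  have hAclosed : IsClosed (A ∩ Icc s u) := by
    rw [← isSeqClosed_iff_isClosed]
    intro v v₀ hv hlim
    have hv₀ : v₀ ∈ Icc s u := isClosed_Icc.mem_of_tendsto hlim
      (Eventually.of_forall fun n => (hv n).2)
    refine ⟨fun w hw => ?_, hv₀⟩
    by_cases hex : ∃ n, w ≤ v n
    · obtain ⟨n, hn⟩ := hex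
      exact (hv n).1 w ⟨hw.1, hn⟩
    · push Not at hex
      have hwv : w = v₀ := le_antisymm hw.2 (le_of_tendsto hlim (Eventually.of_forall fun n =>
        (hex n).le))
      subst hwv
      have hmem : ∀ n, σ (v n) ∈ Kc ∧ y (v n) ∈ Metric.closedBall (z t₀) R := fun n => by
        have h := (hv n).1 (v n) ⟨(hv n).2.1, le_rfl⟩
        refine ⟨(hKmem _).2 ⟨h.1, ?_⟩, h.2⟩
        have h2 := h.2
        rw [Metric.mem_closedBall, Prod.dist_eq] at h2
        exact (le_max_left _ _).trans h2
      have h1 : σ w ∈ Kc := hKclosed.mem_of_tendsto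
        ((hσ.1.continuous.tendsto w).comp hlim) (Eventually.of_forall fun n => (hmem n).1)
      have h1' := ((hKmem _).1 h1).1
      exact ⟨h1', Metric.isClosed_closedBall.mem_of_tendsto
        ((hder w h1').continuousAt.tendsto.comp hlim) (Eventually.of_forall fun n => (hmem n).2)⟩
  have hAs : s ∈ A := by
    intro w hw
    obtain rfl : w = s := le_antisymm hw.2 hw.1
    refine ⟨hσs, ?_⟩
    rw [Metric.mem_closedBall, dist_eq_norm]
    linarith
  have hstay : Icc s u ⊆ A := by
    refine hAclosed.Icc_subset_of_forall_exists_gt hAs ?_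
    rintro v ⟨hvA, hv⟩ b hb
    -- up to time `v` the coordinates have moved by at most `B * (v - s)`
    have hmv : ‖y v - y s‖ ≤ B * ‖v - s‖ := by
      refine (convex_Icc s v).norm_image_sub_le_of_norm_hasDerivWithin_le
        (f' := fun w => spray g x₀ (y w)) (fun w hw => (hder w (hvA w hw).1).hasDerivWithinAt)
        (fun w hw => (hball (hvA w hw).2).2.1) ⟨le_rfl, hv.1⟩ ⟨hv.1, le_rfl⟩
    have hvs : ‖v - s‖ ≤ 2 * η := by
      rw [Real.norm_eq_abs, abs_le]
      constructor <;> linarith [hv.1, hv.2, hu.2, hs.1]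
    have hyv : ‖y v - z t₀‖ < R := by
      calc ‖y v - z t₀‖ = ‖(y v - y s) + (y s - z t₀)‖ := by abel_nf
        _ ≤ ‖y v - y s‖ + ‖y s - z t₀‖ := norm_add_le _ _
        _ < R := by nlinarith
    have hσv := (hvA v ⟨hv.1, le_rfl⟩).1
    have hev : ∀ᶠ w in 𝓝 v, σ w ∈ (chartAt Plane x₀).source ∧
        y w ∈ Metric.closedBall (z t₀) R :=
      (hσ.eventually_mem_source hσv).and ((hder v hσv).continuousAt.eventually
        (Metric.closedBall_mem_nhds_of_mem (by rwa [Metric.mem_ball, dist_eq_norm])))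
    obtain ⟨δ, hδ, hδ'⟩ := Metric.eventually_nhds_iff.1 hev
    refine ⟨min (v + δ / 2) b, fun w hw => ?_, lt_min (by linarith) hb, min_le_right _ _⟩
    by_cases hwv : w ≤ v
    · exact hvA w ⟨hw.1, hwv⟩
    · push Not at hwv
      refine hδ' ?_
      rw [Real.dist_eq, abs_lt]
      have := hw.2.trans (min_le_left _ _)
      constructor <;> linarith
  refine ⟨(hstay ⟨hsu, le_rfl⟩ u ⟨hsu, le_rfl⟩).1, ?_⟩
  have hsub' : ∀ w ∈ Icc s u, w ∈ Ioo (t₀ - η) (t₀ + η) := fun w hw =>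
    ⟨hs.1.trans_le hw.1, hw.2.trans_lt hu.2⟩
  have hG := dist_le_of_trajectories_ODE_of_mem (v := fun _ => spray g x₀) (s := fun _ => U)
    (K := K) (f := y) (g := z) (a := s) (b := u) (δ := dist (y s) (z s)) (fun _ _ => hK)
    (fun w hw => (hder w (hstay hw w ⟨hw.1, le_rfl⟩).1).continuousAt.continuousWithinAt)
    (fun w hw => (hder w (hstay (Ico_subset_Icc_self hw) w ⟨hw.1, le_rfl⟩).1).hasDerivWithinAt)
    (fun w hw => (hball (hstay (Ico_subset_Icc_self hw) w ⟨hw.1, le_rfl⟩).2).1)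
    (fun w hw => (hγ.hasDerivAt_coord (hγ' w (hsub' w hw)).1).continuousAt.continuousWithinAt)
    (fun w hw => (hγ.hasDerivAt_coord
      (hγ' w (hsub' w (Ico_subset_Icc_self hw))).1).hasDerivWithinAt)
    (fun w hw => (hball (by
      rw [Metric.mem_closedBall, dist_eq_norm]
      exact ((hγ' w (hsub' w (Ico_subset_Icc_self hw))).2.trans (by linarith)).le)).1)
    le_rfl u ⟨hsu, le_rfl⟩
  rw [dist_eq_norm, dist_eq_norm] at hG
  refine hG.trans ?_
  rw [mul_comm]
  refine mul_le_mul_of_nonneg_right (Real.exp_le_exp.2 ?_) (norm_nonneg _)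
  exact mul_le_mul_of_nonneg_left (by linarith [hu.2, hs.1]) K.coe_nonneg

end Surface

/-- Induction along the half-line: a property of times that holds at `0` and locally propagates
forward in time holds at all times `t ≥ 0`. -/
theorem forall_nonneg_of_local {P : ℝ → Prop} (h0 : P 0)
    (hloc : ∀ t₀, 0 ≤ t₀ → ∃ η > 0, ∀ s ∈ Ioo (t₀ - η) (t₀ + η), 0 ≤ s →
      ∀ u ∈ Ioo (t₀ - η) (t₀ + η), s ≤ u → P s → P u) {t : ℝ} (ht : 0 ≤ t) : P t := by
  set A : Set ℝ := {v | ∀ w ∈ Icc 0 v, P w} with hA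
  have hclosed : IsClosed (A ∩ Icc 0 t) := by
    rw [← isSeqClosed_iff_isClosed]
    intro v v₀ hv hlim
    have hv₀ : v₀ ∈ Icc 0 t :=
      isClosed_Icc.mem_of_tendsto hlim (Eventually.of_forall fun n => (hv n).2)
    refine ⟨fun w hw => ?_, hv₀⟩
    obtain ⟨η, hη, hP⟩ := hloc v₀ hv₀.1
    by_cases hex : ∃ n, w ≤ v n
    · obtain ⟨n, hn⟩ := hex
      exact (hv n).1 w ⟨hw.1, hn⟩
    · push Not at hex
      obtain ⟨n, hn⟩ := (hlim.eventually (Ioo_mem_nhds (show v₀ - η < v₀ by linarith)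
        (show v₀ < v₀ + η by linarith))).exists
      have h0n := (hv n).2.1
      exact hP (v n) hn h0n w ⟨hn.1.trans (hex n), by linarith [hw.2]⟩ (hex n).le
        ((hv n).1 _ ⟨h0n, le_rfl⟩)
  refine hclosed.Icc_subset_of_forall_exists_gt (a := 0) (b := t) ?_ ?_ ⟨ht, le_rfl⟩ t ⟨ht, le_rfl⟩
  · intro w hw
    obtain rfl : w = 0 := le_antisymm hw.2 hw.1
    exact h0
  · rintro v ⟨hvA, hv⟩ b hb
    obtain ⟨η, hη, hP⟩ := hloc v hv.1
    refine ⟨min (v + η / 2) b, fun w hw => ?_, lt_min (by linarith) hb, min_le_right _ _⟩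
    by_cases hwv : w ≤ v
    · exact hvA w ⟨hw.1, hwv⟩
    · push Not at hwv
      have := hw.2.trans (min_le_left _ _)
      exact hP v ⟨by linarith, by linarith⟩ hv.1 w ⟨by linarith, by linarith⟩ hwv.le
        (hvA v ⟨hv.1, le_rfl⟩)

section Surface

variable {X : Type*} [TopologicalSpace X] [ChartedSpace Plane X] [IsManifold (𝓡 2) ∞ X]
variable {g : SurfaceMetric X}

/-- A geodesic is determined by its initial velocity. -/
theorem IsGeodesic.velocity_eq [T2Space X] {γ σ : ℝ → X} (hγ : IsGeodesic g γ)
    (hσ : IsGeodesic g σ) (h : velocity σ 0 = velocity γ 0) {t : ℝ} (ht : 0 ≤ t) :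
    velocity σ t = velocity γ t := by
  refine forall_nonneg_of_local (P := fun t => velocity σ t = velocity γ t) h ?_ ht
  intro t₀ _
  obtain ⟨η, hη, r, hr, C, hsrc, H⟩ :=
    hγ.exists_local_bound (mem_chart_source Plane (γ t₀))
  refine ⟨η, hη, fun s hs _ u hu hsu hsP => ?_⟩
  have hsP' : σ s = γ s := congrArg TotalSpace.proj hsP
  have h1 := H σ hσ s hs (by rw [hsP']; exact hsrc s hs)
    (by rw [hsP, sub_self, norm_zero]; exact hr)
    u hu hsu
  rw [hsP, sub_self, norm_zero, mul_zero] at h1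
  exact coord_injOn (γ t₀) (V := velocity σ u) (W := velocity γ u) h1.1 (hsrc u hu)
    (sub_eq_zero.1 (norm_le_zero_iff.1 h1.2))

/-! ### Infinitesimal displacements of tangent vectors -/

variable {ι : Type*}

/-- A family `V k` of tangent vectors has the infinitesimal displacement `ζ` from `V₀`, at the
scale `ε k` and in the coordinates of the chart at `x₀`. -/
structure IsJet (l : Filter ι) (ε : ι → ℝ) (x₀ : X) (V : ι → TangentBundle (𝓡 2) X)
    (V₀ : TangentBundle (𝓡 2) X) (ζ : Plane × Plane) : Prop where
  mem₀ : V₀.1 ∈ (chartAt Plane x₀).source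
  mem : ∀ᶠ k in l, (V k).1 ∈ (chartAt Plane x₀).source
  lim : Tendsto (fun k => (ε k)⁻¹ • (coord x₀ (V k) - coord x₀ V₀)) l (𝓝 ζ)

section Jet

variable {l : Filter ι} {ε : ι → ℝ} {x₀ x₁ : X} {V W : ι → TangentBundle (𝓡 2) X}
  {V₀ W₀ : TangentBundle (𝓡 2) X} {ζ : Plane × Plane}

omit [IsManifold (𝓡 2) ∞ X] in
theorem IsJet.exists_bound (h : IsJet l ε x₀ V V₀ ζ) (hε : Tendsto ε l (𝓝[>] 0)) :
    ∃ C > 0, ∀ᶠ k in l, ‖coord x₀ (V k) - coord x₀ V₀‖ ≤ C * ε k := by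
  refine ⟨‖ζ‖ + 1, by positivity, ?_⟩
  have hpos : ∀ᶠ k in l, 0 < ε k := hε.eventually self_mem_nhdsWithin
  filter_upwards [h.lim.norm.eventually (gt_mem_nhds (lt_add_one ‖ζ‖)), hpos] with k hk hk'
  rw [norm_smul, norm_inv, Real.norm_of_nonneg hk'.le, inv_mul_eq_div, div_lt_iff₀ hk'] at hk
  exact hk.le

omit [IsManifold (𝓡 2) ∞ X] in
theorem IsJet.tendsto_coord (h : IsJet l ε x₀ V V₀ ζ) (hε : Tendsto ε l (𝓝[>] 0)) :
    Tendsto (fun k => coord x₀ (V k)) l (𝓝 (coord x₀ V₀)) := by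
  obtain ⟨C, -, hC⟩ := h.exists_bound hε
  have h0 : Tendsto (fun k => C * ε k) l (𝓝 0) := by
    simpa using (tendsto_nhds_of_tendsto_nhdsWithin hε).const_mul C
  exact tendsto_iff_norm_sub_tendsto_zero.2
    (squeeze_zero' (Eventually.of_forall fun _ => norm_nonneg _) hC h0)

omit [IsManifold (𝓡 2) ∞ X] in
theorem tendsto_proj_of_tendsto_coord (h₀ : V₀.1 ∈ (chartAt Plane x₀).source)
    (h : ∀ᶠ k in l, (V k).1 ∈ (chartAt Plane x₀).source)
    (hlim : Tendsto (fun k => coord x₀ (V k)) l (𝓝 (coord x₀ V₀))) :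
    Tendsto (fun k => (V k).1) l (𝓝 V₀.1) := by
  have h1 : Tendsto (fun k => (chartAt Plane x₀).symm (coord x₀ (V k)).1) l
      (𝓝 ((chartAt Plane x₀).symm (coord x₀ V₀).1)) :=
    ((chartAt Plane x₀).continuousAt_symm ((chartAt Plane x₀).map_source h₀)).tendsto.comp
      ((continuous_fst.tendsto _).comp hlim)
  have h2 : (chartAt Plane x₀).symm (coord x₀ V₀).1 = V₀.1 := (chartAt Plane x₀).left_inv h₀
  rw [h2] at h1
  refine h1.congr' ?_
  filter_upwards [h] with k hk
  exact (chartAt Plane x₀).left_inv hk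

omit [IsManifold (𝓡 2) ∞ X] in
/-- The image of an infinitesimal displacement under a map differentiable in coordinates. -/
theorem IsJet.map (h : IsJet l ε x₀ V V₀ ζ) (hε : Tendsto ε l (𝓝[>] 0))
    {Φ : Plane × Plane → Plane × Plane} {L : Plane × Plane →L[ℝ] Plane × Plane}
    (hΦ : HasFDerivAt Φ L (coord x₀ V₀)) (hW₀ : W₀.1 ∈ (chartAt Plane x₁).source)
    (hW : ∀ᶠ k in l, (W k).1 ∈ (chartAt Plane x₁).source)
    (e₀ : coord x₁ W₀ = Φ (coord x₀ V₀)) (e : ∀ᶠ k in l, coord x₁ (W k) = Φ (coord x₀ (V k))) :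
    IsJet l ε x₁ W W₀ (L ζ) := by
  refine ⟨hW₀, hW, ?_⟩
  have h1 := HasFDerivWithinAt.lim hΦ.hasFDerivWithinAt (s := univ)
    (d := fun k => coord x₀ (V k) - coord x₀ V₀) (tendsto_sub_nhds_zero_iff.2 (h.tendsto_coord hε))
    (Eventually.of_forall fun _ => mem_univ _) h.lim
  refine h1.congr' ?_
  filter_upwards [e] with k hk
  rw [hk, e₀, add_sub_cancel]

variable (g) in
/-- The invariants of a displacement do not depend on the chart. -/
theorem IsJet.change_chart (h : IsJet l ε x₀ V V₀ ζ) (hε : Tendsto ε l (𝓝[>] 0))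
    (h₁ : V₀.1 ∈ (chartAt Plane x₁).source) :
    ∃ ζ', IsJet l ε x₁ V V₀ ζ' ∧ jacQ g x₁ (coord x₁ V₀) ζ' = jacQ g x₀ (coord x₀ V₀) ζ ∧
      jacP g x₁ (coord x₁ V₀) ζ' = jacP g x₀ (coord x₀ V₀) ζ ∧
      jacR g x₁ (coord x₁ V₀) ζ' = jacR g x₀ (coord x₀ V₀) ζ := by
  have hz : (coord x₀ V₀).1 ∈ overlap x₀ x₁ := chart_mem_overlap h.mem₀ h₁
  obtain ⟨L, hL, hL'⟩ := hasFDerivAt_coordChange hz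
  have hmem : ∀ᶠ k in l, (V k).1 ∈ (chartAt Plane x₁).source := by
    have h1 : Tendsto (fun k => (coord x₀ (V k)).1) l (𝓝 (coord x₀ V₀).1) :=
      (continuous_fst.tendsto _).comp (h.tendsto_coord hε)
    filter_upwards [h1.eventually ((isOpen_overlap x₀ x₁).mem_nhds hz), h.mem] with k hk hk'
    have := (mem_overlap.1 hk).2
    rwa [coord, (chartAt Plane x₀).left_inv hk'] at this
  refine ⟨L ζ, h.map hε hL h₁ hmem (coordChange_coord h.mem₀ h₁).symm ?_, ?_⟩
  · filter_upwards [h.mem, hmem] with k hk hk'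
    exact (coordChange_coord hk hk').symm
  · rw [← coordChange_coord h.mem₀ h₁, hL']
    simp only [jacQ, jacP, jacR, covPart_coordChange g hz]
    exact ⟨gram_coordChange g hz _ _ _, gram_coordChange g hz _ _ _, gram_coordChange g hz _ _ _⟩

omit [IsManifold (𝓡 2) ∞ X] in
theorem IsJet.unique [l.NeBot] {ζ' : Plane × Plane} (h : IsJet l ε x₀ V V₀ ζ)
    (h' : IsJet l ε x₀ V V₀ ζ') : ζ = ζ' := tendsto_nhds_unique h.lim h'.lim

omit [IsManifold (𝓡 2) ∞ X] in
/-- Bounded difference quotients converge along an ultrafilter. -/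
theorem exists_isJet_of_bound {𝒰 : Ultrafilter ι} (hε : Tendsto ε 𝒰 (𝓝[>] 0)) {C : ℝ}
    (h₀ : V₀.1 ∈ (chartAt Plane x₀).source)
    (h : ∀ᶠ k in (𝒰 : Filter ι), (V k).1 ∈ (chartAt Plane x₀).source ∧
      ‖coord x₀ (V k) - coord x₀ V₀‖ ≤ C * ε k) :
    ∃ ζ, IsJet 𝒰 ε x₀ V V₀ ζ := by
  have hpos : ∀ᶠ k in (𝒰 : Filter ι), 0 < ε k := hε.eventually self_mem_nhdsWithin
  have hb : ∀ᶠ k in (𝒰 : Filter ι), (ε k)⁻¹ • (coord x₀ (V k) - coord x₀ V₀)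
      ∈ Metric.closedBall (0 : Plane × Plane) C := by
    filter_upwards [h, hpos] with k hk hk'
    rw [mem_closedBall_zero_iff, norm_smul, norm_inv, Real.norm_of_nonneg hk'.le, inv_mul_eq_div,
      div_le_iff₀ hk']
    exact hk.2
  obtain ⟨ζ, -, hζ⟩ := (isCompact_closedBall (0 : Plane × Plane) C).ultrafilter_le_nhds
    (𝒰.map fun k => (ε k)⁻¹ • (coord x₀ (V k) - coord x₀ V₀)) (le_principal_iff.2 hb)
  exact ⟨ζ, h₀, h.mono fun _ hk => hk.1, hζ⟩

end Jet

/-- Geodesics whose initial velocities are `O(ε)`-close stay `O(ε)`-close, locally uniformly in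
time. -/
theorem eventually_bound [T2Space X] {𝒰 : Ultrafilter ι} {ε : ι → ℝ} (hε : Tendsto ε 𝒰 (𝓝[>] 0))
    {γ : ℝ → X} {σ : ι → ℝ → X} (hγ : IsGeodesic g γ) (hσ : ∀ k, IsGeodesic g (σ k))
    {y : X} {ζ : Plane × Plane}
    (h0 : IsJet 𝒰 ε y (fun k => velocity (σ k) 0) (velocity γ 0) ζ)
    {x₀ : X} {t₀ : ℝ} (ht₀ : 0 ≤ t₀) (hx₀ : γ t₀ ∈ (chartAt Plane x₀).source) :
    ∃ η > 0, ∃ C > 0, (∀ u ∈ Ioo (t₀ - η) (t₀ + η), γ u ∈ (chartAt Plane x₀).source) ∧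
      ∀ᶠ k in (𝒰 : Filter ι), ∀ u ∈ Ioo (t₀ - η) (t₀ + η), 0 ≤ u →
        σ k u ∈ (chartAt Plane x₀).source ∧
        ‖coord x₀ (velocity (σ k) u) - coord x₀ (velocity γ u)‖ ≤ C * ε k := by
  -- the local statement, given a displacement at one time
  have hstep : ∀ (x₀ : X) (t₀ : ℝ), γ t₀ ∈ (chartAt Plane x₀).source →
      ∃ η > 0, (∀ u ∈ Ioo (t₀ - η) (t₀ + η), γ u ∈ (chartAt Plane x₀).source) ∧
        ∀ s ∈ Ioo (t₀ - η) (t₀ + η),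
        (∃ x ζ, IsJet 𝒰 ε x (fun k => velocity (σ k) s) (velocity γ s) ζ) →
        ∃ C > 0, ∀ᶠ k in (𝒰 : Filter ι), ∀ u ∈ Ioo (t₀ - η) (t₀ + η), s ≤ u →
          σ k u ∈ (chartAt Plane x₀).source ∧
          ‖coord x₀ (velocity (σ k) u) - coord x₀ (velocity γ u)‖ ≤ C * ε k := by
    intro x₀ t₀ hx₀
    obtain ⟨η, hη, r, hr, C, hsrc, H⟩ := hγ.exists_local_bound hx₀
    refine ⟨η, hη, hsrc, fun s hs hjet => ?_⟩
    obtain ⟨x, ζ, hζ⟩ := hjet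
    obtain ⟨ζ', hζ', -⟩ := hζ.change_chart g hε (x₁ := x₀) (hsrc s hs)
    obtain ⟨C', hC', hb⟩ := hζ'.exists_bound hε
    refine ⟨(|C| + 1) * C', by positivity, ?_⟩
    have hlt : ∀ᶠ k in (𝒰 : Filter ι),
        ‖coord x₀ (velocity (σ k) s) - coord x₀ (velocity γ s)‖ < r :=
      (tendsto_iff_norm_sub_tendsto_zero.1 (hζ'.tendsto_coord hε)).eventually (gt_mem_nhds hr)
    have hpos : ∀ᶠ k in (𝒰 : Filter ι), 0 < ε k := hε.eventually self_mem_nhdsWithin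
    filter_upwards [hb, hlt, hζ'.mem, hpos] with k hk hk' hks hkε u hu hsu
    obtain ⟨h1, h2⟩ := H (σ k) (hσ k) s hs hks hk' u hu hsu
    refine ⟨h1, h2.trans ?_⟩
    calc C * ‖coord x₀ (velocity (σ k) s) - coord x₀ (velocity γ s)‖
        ≤ (|C| + 1) * (C' * ε k) := by
          refine mul_le_mul ?_ hk (norm_nonneg _) (by positivity)
          linarith [le_abs_self C]
      _ = (|C| + 1) * C' * ε k := by ring
  have hall : ∀ t, 0 ≤ t →
      ∃ x ζ, IsJet 𝒰 ε x (fun k => velocity (σ k) t) (velocity γ t) ζ := by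
    intro t ht
    refine forall_nonneg_of_local
      (P := fun t => ∃ x ζ, IsJet 𝒰 ε x (fun k => velocity (σ k) t) (velocity γ t) ζ)
      ⟨y, ζ, h0⟩ ?_ ht
    intro t₀ _
    obtain ⟨η, hη, hsrc, H⟩ := hstep (γ t₀) t₀ (mem_chart_source Plane (γ t₀))
    refine ⟨η, hη, fun s hs _ u hu hsu hjet => ?_⟩
    obtain ⟨C, -, hC⟩ := H s hs hjet
    obtain ⟨ζ, hζ⟩ := exists_isJet_of_bound (V := fun k => velocity (σ k) u) (V₀ := velocity γ u)
      hε (hsrc u hu) (hC.mono fun k hk => hk u hu hsu)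
    exact ⟨γ t₀, ζ, hζ⟩
  obtain ⟨η, hη, hsrc, H⟩ := hstep x₀ t₀ hx₀
  obtain ⟨C, hC, hb⟩ := H (max 0 (t₀ - η / 2))
    ⟨lt_max_of_lt_right (by linarith), max_lt (by linarith) (by linarith)⟩
    (hall _ (le_max_left _ _))
  have hsub : ∀ u ∈ Ioo (t₀ - η / 2) (t₀ + η / 2), u ∈ Ioo (t₀ - η) (t₀ + η) := fun u hu =>
    ⟨by linarith [hu.1], by linarith [hu.2]⟩
  refine ⟨η / 2, by positivity, C, hC, fun u hu => hsrc u (hsub u hu), ?_⟩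
  filter_upwards [hb] with k hk u hu hu0
  exact hk u (hsub u hu) (max_le hu0 hu.1.le)

end Surface

/-! ### Limits of difference quotients of solutions of a differential equation -/

/-- Differentiation of the flow along a family of solutions: if the solutions `z k` of `z' = F(z)`
are uniformly `O(ε k)`-close to the solution `z` and `(z k - z) / ε k` converges pointwise to `ζ`,
then `ζ` solves the linearized equation. No uniformity of the convergence is needed, since the
quotients are equi-Lipschitz. -/
theorem hasDerivWithinAt_of_tendsto_quotient {E ι : Type*} [NormedAddCommGroup E]
    [NormedSpace ℝ E] {l : Filter ι} [l.NeBot] {ε : ι → ℝ} (hε : Tendsto ε l (𝓝[>] 0))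
    {F : E → E} {A : E →L[ℝ] E} {z : ℝ → E} {y : ι → ℝ → E} {ζ : ℝ → E} {S : Set ℝ} {t C : ℝ}
    (hS : Convex ℝ S) (htS : t ∈ S) (hF : HasStrictFDerivAt F A (z t)) (hC : 0 < C)
    (hz : ∀ u ∈ S, HasDerivAt z (F (z u)) u)
    (hy : ∀ᶠ k in l, ∀ u ∈ S, HasDerivAt (y k) (F (y k u)) u)
    (hyz : ∀ᶠ k in l, ∀ u ∈ S, ‖y k u - z u‖ ≤ C * ε k)
    (hζ : ∀ u ∈ S, Tendsto (fun k => (ε k)⁻¹ • (y k u - z u)) l (𝓝 (ζ u))) :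
    HasDerivWithinAt ζ (A (ζ t)) S t := by
  have hpos : ∀ᶠ k in l, 0 < ε k := hε.eventually self_mem_nhdsWithin
  rw [hasDerivWithinAt_iff_isLittleO, Asymptotics.isLittleO_iff]
  intro δ hδ
  obtain ⟨δ₁, hδ₁, hδC⟩ : ∃ δ₁ > 0, δ₁ * (C + 1) ≤ δ :=
    ⟨δ / (C + 1), by positivity, (div_mul_cancel₀ _ (by positivity)).le⟩
  set M := ‖A‖ * ((‖A‖ + δ₁) * C) + 1 with hM
  have hM0 : 0 < M := by positivity
  -- a neighbourhood on which `F` is close to its linearization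
  have h1 := (Asymptotics.isLittleO_iff.1 hF.isLittleO) hδ₁
  obtain ⟨ρ, hρ, hρF⟩ := Metric.eventually_nhds_iff.1 h1
  have hzc := (hz t htS).continuousAt
  obtain ⟨δ₂, hδ₂, hδz⟩ := Metric.eventually_nhds_iff.1
    (hzc.eventually (Metric.ball_mem_nhds (z t) (half_pos hρ)))
  have hδ₃ : 0 < min δ₂ (δ₁ / M) := lt_min hδ₂ (by positivity)
  have hnear : ∀ᶠ u in 𝓝[S] t, u ∈ S ∧ dist u t < min δ₂ (δ₁ / M) :=
    eventually_mem_nhdsWithin.and (mem_nhdsWithin_of_mem_nhds (Metric.ball_mem_nhds t hδ₃))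
  filter_upwards [hnear] with u hu
  set S' := S ∩ Metric.ball t (min δ₂ (δ₁ / M)) with hS'
  have hS'c : Convex ℝ S' := hS.inter (convex_ball _ _)
  have htS' : t ∈ S' := ⟨htS, Metric.mem_ball_self hδ₃⟩
  have huS' : u ∈ S' := hu
  have hsmall : ∀ᶠ k in l, C * ε k < ρ / 2 := by
    have : Tendsto (fun k => C * ε k) l (𝓝 0) := by
      simpa using (tendsto_nhds_of_tendsto_nhdsWithin hε).const_mul C
    exact this.eventually (gt_mem_nhds (half_pos hρ))
  have key : ∀ᶠ k in l, ‖(ε k)⁻¹ • (y k u - z u) - (ε k)⁻¹ • (y k t - z t)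
      - (u - t) • A ((ε k)⁻¹ • (y k t - z t))‖ ≤ δ * ‖u - t‖ := by
    filter_upwards [hpos, hy, hyz, hsmall] with k hk hyk hyzk hsk
    set Z : ℝ → E := fun w => (ε k)⁻¹ • (y k w - z w) with hZ
    have hZd : ∀ w ∈ S', HasDerivAt Z ((ε k)⁻¹ • (F (y k w) - F (z w))) w := fun w hw =>
      ((hyk w hw.1).sub (hz w hw.1)).const_smul _
    have hZC : ∀ w ∈ S', ‖Z w‖ ≤ C := fun w hw => by
      rw [hZ, norm_smul, norm_inv, Real.norm_of_nonneg hk.le, inv_mul_eq_div, div_le_iff₀ hk]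
      exact hyzk w hw.1
    have hlin : ∀ w ∈ S', ‖(ε k)⁻¹ • (F (y k w) - F (z w)) - A (Z w)‖ ≤ δ₁ * C := by
      intro w hw
      have hwd : dist w t < δ₂ := (Metric.mem_ball.1 hw.2).trans_le (min_le_left _ _)
      have hzw : dist (z w) (z t) < ρ / 2 := hδz hwd
      have hyw : dist (y k w) (z t) < ρ := by
        calc dist (y k w) (z t) ≤ dist (y k w) (z w) + dist (z w) (z t) := dist_triangle _ _ _
          _ < ρ / 2 + ρ / 2 := by
            rw [dist_eq_norm (y k w)]
            exact add_lt_add ((hyzk w hw.1).trans_lt hsk) hzw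
          _ = ρ := by ring
      have h := @hρF (y k w, z w) (by
        rw [Prod.dist_eq]
        exact max_lt hyw (hzw.trans (by linarith)))
      have e : (ε k)⁻¹ • (F (y k w) - F (z w)) - A (Z w)
          = (ε k)⁻¹ • (F (y k w) - F (z w) - A (y k w - z w)) := by
        rw [hZ, map_smul, ← smul_sub]
      rw [e, norm_smul, norm_inv, Real.norm_of_nonneg hk.le, inv_mul_eq_div, div_le_iff₀ hk]
      calc _ ≤ δ₁ * ‖y k w - z w‖ := h
        _ ≤ δ₁ * (C * ε k) := mul_le_mul_of_nonneg_left (hyzk w hw.1) hδ₁.le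
        _ = δ₁ * C * ε k := by ring
    have hZ' : ∀ w ∈ S', ‖(ε k)⁻¹ • (F (y k w) - F (z w))‖ ≤ (‖A‖ + δ₁) * C := by
      intro w hw
      have h2 := norm_le_norm_add_norm_sub' ((ε k)⁻¹ • (F (y k w) - F (z w))) (A (Z w))
      have h3 := (A.le_opNorm (Z w)).trans
        (mul_le_mul_of_nonneg_left (hZC w hw) (norm_nonneg A))
      have h4 := hlin w hw
      linarith
    have hZLip : ∀ w ∈ S', ‖Z w - Z t‖ ≤ (‖A‖ + δ₁) * C * ‖w - t‖ := fun w hw =>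
      hS'c.norm_image_sub_le_of_norm_hasDerivWithin_le
        (fun v hv => (hZd v hv).hasDerivWithinAt) hZ' htS' hw
    have hG : ∀ w ∈ S', HasDerivWithinAt (fun w => Z w - w • A (Z t))
        ((ε k)⁻¹ • (F (y k w) - F (z w)) - A (Z t)) S' w := fun w hw => by
      have := (hZd w hw).sub ((hasDerivAt_id w).smul_const (A (Z t)))
      rw [one_smul] at this
      exact this.hasDerivWithinAt
    have hGb : ∀ w ∈ S', ‖(ε k)⁻¹ • (F (y k w) - F (z w)) - A (Z t)‖ ≤ δ := by
      intro w hw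
      have hwd : ‖w - t‖ < δ₁ / M := by
        rw [← dist_eq_norm]
        exact (Metric.mem_ball.1 hw.2).trans_le (min_le_right _ _)
      rw [lt_div_iff₀ hM0] at hwd
      have h2 : ‖A (Z w) - A (Z t)‖ ≤ ‖A‖ * ((‖A‖ + δ₁) * C * ‖w - t‖) := by
        rw [← map_sub]
        exact (A.le_opNorm _).trans (mul_le_mul_of_nonneg_left (hZLip w hw) (norm_nonneg A))
      have h3 := norm_add_le ((ε k)⁻¹ • (F (y k w) - F (z w)) - A (Z w)) (A (Z w) - A (Z t))
      rw [sub_add_sub_cancel] at h3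
      have h4 := hlin w hw
      have h5 : ‖A‖ * ((‖A‖ + δ₁) * C * ‖w - t‖) ≤ δ₁ := by
        have : 0 ≤ ‖w - t‖ := norm_nonneg _
        calc _ = (M - 1) * ‖w - t‖ := by rw [hM]; ring
          _ ≤ ‖w - t‖ * M := by linarith [mul_comm M ‖w - t‖]
          _ ≤ δ₁ := hwd.le
      linarith
    have h6 := hS'c.norm_image_sub_le_of_norm_hasDerivWithin_le hG hGb htS' huS'
    refine le_trans (le_of_eq ?_) h6
    congr 1
    simp only [hZ, sub_smul]
    abel
  have hlim : Tendsto (fun k => (ε k)⁻¹ • (y k u - z u) - (ε k)⁻¹ • (y k t - z t)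
      - (u - t) • A ((ε k)⁻¹ • (y k t - z t))) l (𝓝 (ζ u - ζ t - (u - t) • A (ζ t))) :=
    ((hζ u hu.1).sub (hζ t htS)).sub
      (((A.continuous.tendsto _).comp (hζ t htS)).const_smul _)
  exact le_of_tendsto hlim.norm key

section Surface

variable {X : Type*} [TopologicalSpace X] [ChartedSpace Plane X] [IsManifold (𝓡 2) ∞ X]
variable (g : SurfaceMetric X)

/-! ### The Jacobi equation -/

theorem hasDerivWithinAt_gram (x₀ : X) {z : ℝ → Plane × Plane} {a b : ℝ → Plane} {a' b' : Plane}
    {S : Set ℝ} {t : ℝ} (hu : (z t).1 ∈ (chartAt Plane x₀).target)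
    (hz : HasDerivWithinAt z (spray g x₀ (z t)) S t)
    (ha : HasDerivWithinAt a a' S t) (hb : HasDerivWithinAt b b' S t) :
    HasDerivWithinAt (fun s => gram g x₀ (z s).1 (z s).2 (a s) (b s))
      (gram g x₀ (z t).1 (z t).2 (a' + chrVec g x₀ (z t).1 (z t).2 (a t)) (b t)
        + gram g x₀ (z t).1 (z t).2 (a t) (b' + chrVec g x₀ (z t).1 (z t).2 (b t))) S t := by
  have hc : HasDerivWithinAt (fun s => (z s).1) (z t).2 S t :=
    (hasFDerivAt_fst (𝕜 := ℝ) (E := Plane) (F := Plane)).comp_hasDerivWithinAt t hz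
  have hv : HasDerivWithinAt (fun s => (z s).2) (- chrVec g x₀ (z t).1 (z t).2 (z t).2) S t :=
    (hasFDerivAt_snd (𝕜 := ℝ) (E := Plane) (F := Plane)).comp_hasDerivWithinAt t hz
  have h0 : ∀ c, gForm g x₀ (z t).1 0 c = 0 := fun c => by simp [gForm]
  have h0' : ∀ c, gForm g x₀ (z t).1 c 0 = 0 := fun c => by simp [gForm]
  have hvv := hasDerivWithinAt_gForm g x₀ hu hc hv hv
  have hva := hasDerivWithinAt_gForm g x₀ hu hc hv ha
  have hvb := hasDerivWithinAt_gForm g x₀ hu hc hv hb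
  have hab := hasDerivWithinAt_gForm g x₀ hu hc ha hb
  refine ((hvv.mul hab).sub (hva.mul hvb)).congr_deriv ?_
  simp only [neg_add_cancel, h0, h0', gram]
  ring

/-- The second covariant derivative of a Jacobi field `ξ` along a geodesic with velocity `v` is
`R(v, ξ) v = (v × ξ) R(∂_0, ∂_1) v`. -/
theorem jacobi_equation (x₀ : X) (u v ξ η : Plane) :
    (- (dChrVec g x₀ u ξ v v + chrVec g x₀ u η v + chrVec g x₀ u v η)
      + (dChrVec g x₀ u v ξ v + chrVec g x₀ u η v
        + chrVec g x₀ u ξ (- chrVec g x₀ u v v)))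
      + chrVec g x₀ u v (η + chrVec g x₀ u ξ v)
    = cross v ξ • WithLp.toLp 2 fun l =>
        riemannTensor g x₀ l 0 1 0 u * v 0 + riemannTensor g x₀ l 0 1 1 u * v 1 := by
  have e : ∀ k, christoffel g x₀ k 1 0 = christoffel g x₀ k 0 1 := fun k =>
    funext fun u => christoffel_symm g x₀ k 1 0 u
  ext k
  simp only [PiLp.add_apply, PiLp.neg_apply, PiLp.smul_apply, dChrVec, chrVec_apply, smul_eq_mul,
    Fin.sum_univ_two, riemannTensor, cross, e]
  ring

/-- Along a geodesic `Q' = 2 P`, and `P' ≥ R` in nonpositive curvature. The point of the geodesic is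
the centre `x₀` of the chart, since the Gaussian curvature is defined by the preferred chart. -/
theorem hasDerivWithinAt_jacQ_jacP {x₀ : X} (hK : gaussCurvature g x₀ ≤ 0)
    {z ζ : ℝ → Plane × Plane} {S : Set ℝ} {t : ℝ} (hu : (z t).1 = chartAt Plane x₀ x₀)
    (hz : HasDerivWithinAt z (spray g x₀ (z t)) S t)
    (hζ : HasDerivWithinAt ζ (fderiv ℝ (spray g x₀) (z t) (ζ t)) S t) :
    HasDerivWithinAt (fun s => jacQ g x₀ (z s) (ζ s)) (2 * jacP g x₀ (z t) (ζ t)) S t ∧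
      ∃ p, jacR g x₀ (z t) (ζ t) ≤ p ∧
        HasDerivWithinAt (fun s => jacP g x₀ (z s) (ζ s)) p S t := by
  have hmem : (z t).1 ∈ (chartAt Plane x₀).target := by
    rw [hu]; exact mem_chart_target Plane x₀
  rw [fderiv_spray g x₀ hmem] at hζ
  have hc : HasDerivWithinAt (fun s => (z s).1) (z t).2 S t :=
    (hasFDerivAt_fst (𝕜 := ℝ) (E := Plane) (F := Plane)).comp_hasDerivWithinAt t hz
  have hv : HasDerivWithinAt (fun s => (z s).2) (- chrVec g x₀ (z t).1 (z t).2 (z t).2) S t :=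
    (hasFDerivAt_snd (𝕜 := ℝ) (E := Plane) (F := Plane)).comp_hasDerivWithinAt t hz
  have hξ : HasDerivWithinAt (fun s => (ζ s).1) (ζ t).2 S t :=
    (hasFDerivAt_fst (𝕜 := ℝ) (E := Plane) (F := Plane)).comp_hasDerivWithinAt t hζ
  have hη : HasDerivWithinAt (fun s => (ζ s).2) _ S t :=
    (hasFDerivAt_snd (𝕜 := ℝ) (E := Plane) (F := Plane)).comp_hasDerivWithinAt t hζ
  have hD := hη.add (hasDerivWithinAt_chrVec g x₀ hmem hc hξ hv)
  have hcov : (ζ t).2 + chrVec g x₀ (z t).1 (z t).2 (ζ t).1 = covPart g x₀ (z t) (ζ t) := by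
    rw [covPart, chrVec_comm]
  have hQ := hasDerivWithinAt_gram g x₀ hmem hz hξ hξ
  have hP := hasDerivWithinAt_gram g x₀ hmem hz hξ hD
  refine ⟨hQ.congr_deriv ?_, _, ?_, hP⟩
  · rw [hcov]
    simp only [jacP, gram]
    rw [gForm_comm g x₀ _ (covPart g x₀ (z t) (ζ t)) (ζ t).1]
    ring
  · rw [hcov]
    have hJ := jacobi_equation g x₀ (z t).1 (z t).2 (ζ t).1 (ζ t).2
    have hcurv := cross_riemannTensor_nonneg g hK (z t).2
    rw [← hu] at hcurv
    refine le_add_of_nonneg_right ?_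
    refine le_of_le_of_eq ?_ (congrArg (gram g x₀ (z t).1 (z t).2 (ζ t).1) hJ).symm
    rw [gram_eq_cross]
    have e : ∀ (s : ℝ) (w : Plane), cross (z t).2 (s • w) = s * cross (z t).2 w := fun s w => by
      simp [cross]; ring
    rw [e, ← mul_assoc (cross _ _)]
    exact mul_nonneg (gDet_pos g x₀ hmem).le (mul_nonneg (mul_self_nonneg _) hcurv)

variable {g} {ι : Type*}

/-- In nonpositive curvature, a family of nearby geodesics which is initially not converging keeps
diverging: the normal displacement does not vanish at positive times, and its product with its
derivative stays nonnegative. -/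
theorem isJet_propagate [T2Space X] (hK : ∀ x : X, gaussCurvature g x ≤ 0) {𝒰 : Ultrafilter ι}
    {ε : ι → ℝ} (hε : Tendsto ε 𝒰 (𝓝[>] 0))
    {γ : ℝ → X} {σ : ι → ℝ → X} (hγ : IsGeodesic g γ) (hσ : ∀ k, IsGeodesic g (σ k))
    {y : X} {ζ₀ : Plane × Plane}
    (h0 : IsJet 𝒰 ε y (fun k => velocity (σ k) 0) (velocity γ 0) ζ₀)
    (hP0 : 0 ≤ jacP g y (coord y (velocity γ 0)) ζ₀)
    (hQR0 : 0 < jacQ g y (coord y (velocity γ 0)) ζ₀ + jacR g y (coord y (velocity γ 0)) ζ₀)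
    {T : ℝ} (hT : 0 < T) {x₁ : X} (hx₁ : γ T ∈ (chartAt Plane x₁).source) :
    ∃ ζ, IsJet 𝒰 ε x₁ (fun k => velocity (σ k) T) (velocity γ T) ζ ∧
      0 ≤ jacP g x₁ (coord x₁ (velocity γ T)) ζ ∧
      0 < jacQ g x₁ (coord x₁ (velocity γ T)) ζ := by
  have hjets : ∀ x₀ : X, ∀ t, ∃ ζ, 0 ≤ t → γ t ∈ (chartAt Plane x₀).source →
      IsJet 𝒰 ε x₀ (fun k => velocity (σ k) t) (velocity γ t) ζ := by
    intro x₀ t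
    by_cases h : 0 ≤ t ∧ γ t ∈ (chartAt Plane x₀).source
    · obtain ⟨η, hη, C, -, hsrc, hb⟩ := eventually_bound hε hγ hσ h0 h.1 h.2
      have htη : t ∈ Ioo (t - η) (t + η) := ⟨by linarith, by linarith⟩
      obtain ⟨ζ, hζ⟩ := exists_isJet_of_bound (V := fun k => velocity (σ k) t)
        (V₀ := velocity γ t) hε h.2 (hb.mono fun k hk => hk t htη h.1)
      exact ⟨ζ, fun _ _ => hζ⟩
    · exact ⟨0, fun h1 h2 => absurd ⟨h1, h2⟩ h⟩
  choose ζ hζ using hjets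
  set Q : ℝ → ℝ := fun t => jacQ g (γ t) (coord (γ t) (velocity γ t)) (ζ (γ t) t) with hQ
  set P : ℝ → ℝ := fun t => jacP g (γ t) (coord (γ t) (velocity γ t)) (ζ (γ t) t) with hP
  set R : ℝ → ℝ := fun t => jacR g (γ t) (coord (γ t) (velocity γ t)) (ζ (γ t) t) with hR
  -- the invariants can be computed in every chart
  have hinv : ∀ x₀ t, 0 ≤ t → γ t ∈ (chartAt Plane x₀).source → ∀ ξ,
      IsJet 𝒰 ε x₀ (fun k => velocity (σ k) t) (velocity γ t) ξ →
      jacQ g x₀ (coord x₀ (velocity γ t)) ξ = Q t ∧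
      jacP g x₀ (coord x₀ (velocity γ t)) ξ = P t ∧
      jacR g x₀ (coord x₀ (velocity γ t)) ξ = R t := by
    intro x₀ t ht hx ξ hξ
    obtain ⟨ζ', h1, h2, h3, h4⟩ := (hζ (γ t) t ht (mem_chart_source Plane (γ t))).change_chart g hε
      (x₁ := x₀) hx
    rw [hξ.unique h1]
    exact ⟨h2, h3, h4⟩
  have hnonneg : ∀ t, 0 ≤ Q t ∧ 0 ≤ R t := fun t =>
    ⟨gram_self_nonneg g _ (mem_chart_target Plane (γ t)) _ _,
      gram_self_nonneg g _ (mem_chart_target Plane (γ t)) _ _⟩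
  have hderiv : ∀ t, 0 ≤ t → HasDerivWithinAt Q (2 * P t) (Ici 0) t ∧
      ∃ p, R t ≤ p ∧ HasDerivWithinAt P p (Ici 0) t := by
    intro t ht
    have hxt : γ t ∈ (chartAt Plane (γ t)).source := mem_chart_source Plane (γ t)
    obtain ⟨η, hη, C, hC, hsrc, hb⟩ := eventually_bound hε hγ hσ h0 ht hxt
    set S : Set ℝ := Ici 0 ∩ Ioo (t - η) (t + η) with hS
    have hI : Ioo (t - η) (t + η) ∈ 𝓝 t := Ioo_mem_nhds (by linarith) (by linarith)
    have htS : t ∈ S := ⟨ht, mem_of_mem_nhds hI⟩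
    have hzd : ∀ u ∈ S, HasDerivAt (fun s => coord (γ t) (velocity γ s))
        (spray g (γ t) (coord (γ t) (velocity γ u))) u := fun u hu =>
      hγ.hasDerivAt_coord (hsrc u hu.2)
    have hζd : HasDerivWithinAt (ζ (γ t)) _ S t :=
      hasDerivWithinAt_of_tendsto_quotient hε
        (F := spray g (γ t)) (z := fun s => coord (γ t) (velocity γ s))
        (y := fun k s => coord (γ t) (velocity (σ k) s)) ((convex_Ici 0).inter (convex_Ioo _ _)) htS
        ((contDiffAt_spray g (γ t) (mem_chart_target Plane (γ t))).hasStrictFDerivAt (by simp)) hC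
        hzd (hb.mono fun k hk u hu => (hσ k).hasDerivAt_coord (hk u hu.2 hu.1).1)
        (hb.mono fun k hk u hu => (hk u hu.2 hu.1).2)
        (fun u hu => (hζ (γ t) u hu.1 (hsrc u hu.2)).lim)
    obtain ⟨h1, p, hp, h2⟩ := hasDerivWithinAt_jacQ_jacP g (hK (γ t)) rfl
      (hzd t htS).hasDerivWithinAt hζd
    refine ⟨(hasDerivWithinAt_inter hI).1 (h1.congr (fun u hu => ?_) rfl), p, hp,
      (hasDerivWithinAt_inter hI).1 (h2.congr (fun u hu => ?_) rfl)⟩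
    · exact (hinv (γ t) u hu.1 (hsrc u hu.2) _ (hζ (γ t) u hu.1 (hsrc u hu.2))).1.symm
    · exact (hinv (γ t) u hu.1 (hsrc u hu.2) _ (hζ (γ t) u hu.1 (hsrc u hu.2))).2.1.symm
  obtain ⟨e1, e2, e3⟩ := hinv y 0 le_rfl h0.mem₀ ζ₀ h0
  rw [e2] at hP0
  rw [e1, e3] at hQR0
  have hmono : ∀ (f f' : ℝ → ℝ), (∀ t, 0 ≤ t → HasDerivWithinAt f (f' t) (Ici 0) t) →
      (∀ t, 0 ≤ t → 0 ≤ f' t) → MonotoneOn f (Ici 0) := by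
    intro f f' hf hf'
    refine monotoneOn_of_hasDerivWithinAt_nonneg (f' := f') (convex_Ici 0)
      (fun t ht => (hf t ht).continuousWithinAt) (fun t ht => ?_) (fun t ht => ?_)
    · rw [interior_Ici] at ht ⊢
      exact (hf t (le_of_lt ht)).mono Ioi_subset_Ici_self
    · rw [interior_Ici] at ht
      exact hf' t (le_of_lt ht)
  have hp : ∀ t, ∃ p, 0 ≤ t → R t ≤ p ∧ HasDerivWithinAt P p (Ici 0) t := fun t => by
    by_cases ht : 0 ≤ t
    · obtain ⟨p, h1, h2⟩ := (hderiv t ht).2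
      exact ⟨p, fun _ => ⟨h1, h2⟩⟩
    · exact ⟨0, fun h => absurd h ht⟩
  choose P' hP' using hp
  have hPmono : MonotoneOn P (Ici 0) := hmono P P' (fun t ht => (hP' t ht).2)
    fun t ht => (hnonneg t).2.trans (hP' t ht).1
  have hPnn : ∀ t, 0 ≤ t → 0 ≤ P t := fun t ht =>
    hP0.trans (hPmono self_mem_Ici ht ht)
  have hQmono : MonotoneOn Q (Ici 0) := hmono Q (fun t => 2 * P t) (fun t ht => (hderiv t ht).1)
    fun t ht => mul_nonneg two_pos.le (hPnn t ht)
  have hζT := hζ x₁ T hT.le hx₁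
  obtain ⟨f1, f2, -⟩ := hinv x₁ T hT.le hx₁ _ hζT
  refine ⟨ζ x₁ T, hζT, f2 ▸ hPnn T hT.le, f1 ▸ lt_of_le_of_ne (hnonneg T).1 fun hQT => ?_⟩
  -- otherwise `Q`, and with it `P`, vanishes on `[0, T)`, and so does `R` at the time `0`
  have hQ0 : ∀ t ∈ Icc 0 T, Q t = 0 := fun t ht =>
    le_antisymm (hQT ▸ hQmono (mem_Ici.2 ht.1) (mem_Ici.2 hT.le) ht.2) (hnonneg t).1
  have hzero : ∀ (f : ℝ → ℝ) (f' : ℝ), (∀ t ∈ Ico 0 T, f t = 0) → ∀ t ∈ Ico 0 T,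
      HasDerivWithinAt f f' (Ici 0) t → f' = 0 := by
    intro f f' hf t ht hf'
    have h1 : HasDerivWithinAt f f' (Ici 0 ∩ Iio T) t := hf'.mono inter_subset_left
    have h2 : HasDerivWithinAt f 0 (Ici 0 ∩ Iio T) t :=
      (hasDerivWithinAt_const t _ (0 : ℝ)).congr (fun u hu => hf u hu) (hf t ht)
    exact (uniqueDiffOn_Ico 0 T t ht).eq_deriv _ h1 h2
  have hPz : ∀ t ∈ Ico 0 T, P t = 0 := fun t ht => by
    have := hzero Q _ (fun s hs => hQ0 s (Ico_subset_Icc_self hs)) t ht (hderiv t ht.1).1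
    linarith
  have h0T : (0 : ℝ) ∈ Ico 0 T := ⟨le_rfl, hT⟩
  have hp0 := hzero P _ hPz 0 h0T (hP' 0 le_rfl).2
  have := (hP' 0 le_rfl).1
  have := hQ0 0 ⟨le_rfl, hT.le⟩
  linarith

end Surface

/-! ### Displacements at varying times -/

/-- The displacement between a family of solutions at the times `τ k` and a fixed solution at the
time `t = lim τ k`, at the scale `|τ k - t| + ε k`. -/
theorem exists_tendsto_shift {E ι : Type*} [NormedAddCommGroup E]
    [NormedSpace ℝ E] {𝒰 : Ultrafilter ι} {ε : ι → ℝ} (hε : Tendsto ε 𝒰 (𝓝[>] 0))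
    {F : E → E} {z : ℝ → E} {y : ι → ℝ → E} {ζ : E} {S : Set ℝ} {t C : ℝ} {τ : ι → ℝ}
    (htS : S ∈ 𝓝 t) (hF : ContinuousAt F (z t)) (hz : ContinuousAt z t)
    (hy : ∀ᶠ k in (𝒰 : Filter ι), ∀ u ∈ S, HasDerivAt (y k) (F (y k u)) u)
    (hyz : ∀ᶠ k in (𝒰 : Filter ι), ∀ u ∈ S, ‖y k u - z u‖ ≤ C * ε k)
    (hζ : Tendsto (fun k => (ε k)⁻¹ • (y k t - z t)) 𝒰 (𝓝 ζ)) (hτ : Tendsto τ 𝒰 (𝓝 t)) :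
    ∃ α β : ℝ, |α| + β = 1 ∧ 0 ≤ β ∧
      Tendsto (fun k => (|τ k - t| + ε k)⁻¹ * ε k) 𝒰 (𝓝 β) ∧
      Tendsto (fun k => (|τ k - t| + ε k)⁻¹ • (y k (τ k) - z t)) 𝒰 (𝓝 (α • F (z t) + β • ζ)) := by
  have hpos : ∀ᶠ k in (𝒰 : Filter ι), 0 < ε k := hε.eventually self_mem_nhdsWithin
  set m : ι → ℝ := fun k => |τ k - t| + ε k with hm
  have hmpos : ∀ᶠ k in (𝒰 : Filter ι), 0 < m k := hpos.mono fun k hk => by positivity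
  have hbα : ∀ᶠ k in (𝒰 : Filter ι), (m k)⁻¹ * (τ k - t) ∈ Icc (-1 : ℝ) 1 := by
    filter_upwards [hpos, hmpos] with k hk hk'
    rw [mem_Icc, ← abs_le, abs_mul, abs_inv, abs_of_pos hk', inv_mul_eq_div, div_le_one hk']
    simp only [hm]
    linarith
  have hbβ : ∀ᶠ k in (𝒰 : Filter ι), (m k)⁻¹ * ε k ∈ Icc (0 : ℝ) 1 := by
    filter_upwards [hpos, hmpos] with k hk hk'
    refine ⟨by positivity, ?_⟩
    rw [inv_mul_eq_div, div_le_one hk']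
    simp only [hm]
    linarith [abs_nonneg (τ k - t)]
  obtain ⟨α, -, hα⟩ := isCompact_Icc.ultrafilter_le_nhds (𝒰.map fun k => (m k)⁻¹ * (τ k - t))
    (le_principal_iff.2 hbα)
  obtain ⟨β, hβ0, hβ⟩ := isCompact_Icc.ultrafilter_le_nhds (𝒰.map fun k => (m k)⁻¹ * ε k)
    (le_principal_iff.2 hbβ)
  change Tendsto (fun k => (m k)⁻¹ * (τ k - t)) 𝒰 (𝓝 α) at hα
  change Tendsto (fun k => (m k)⁻¹ * ε k) 𝒰 (𝓝 β) at hβ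
  refine ⟨α, β, ?_, hβ0.1, hβ, ?_⟩
  · refine tendsto_nhds_unique (hα.abs.add hβ) (tendsto_const_nhds.congr' ?_)
    filter_upwards [hmpos] with k hk
    rw [abs_mul, abs_inv, abs_of_pos hk, ← mul_add]
    exact (inv_mul_cancel₀ hk.ne').symm
  · -- the remainder of the first order expansion in time is negligible
    have hrem : Tendsto (fun k => (m k)⁻¹ • (y k (τ k) - y k t - (τ k - t) • F (z t))) 𝒰 (𝓝 0) := by
      rw [Metric.tendsto_nhds]
      intro δ hδ
      obtain ⟨ρ, hρ, hρF⟩ := Metric.eventually_nhds_iff.1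
        (hF.eventually (Metric.ball_mem_nhds _ (half_pos hδ)))
      obtain ⟨r, hr, hrS⟩ := Metric.eventually_nhds_iff.1
        ((hz.eventually (Metric.ball_mem_nhds _ (half_pos hρ))).and htS)
      have hsmall : ∀ᶠ k in (𝒰 : Filter ι), C * ε k < ρ / 2 := by
        have : Tendsto (fun k => C * ε k) 𝒰 (𝓝 0) := by
          simpa using (tendsto_nhds_of_tendsto_nhdsWithin hε).const_mul C
        exact this.eventually (gt_mem_nhds (half_pos hρ))
      filter_upwards [hpos, hmpos, hy, hyz, hsmall, hτ.eventually (Metric.ball_mem_nhds t hr)]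
        with k hk hmk hyk hyzk hsk hτk
      have hder : ∀ w ∈ Metric.ball t r, HasDerivWithinAt (fun w => y k w - w • F (z t))
          (F (y k w) - F (z t)) (Metric.ball t r) w := fun w hw => by
        have := (hyk w (hrS hw).2).sub ((hasDerivAt_id w).smul_const (F (z t)))
        rw [one_smul] at this
        exact this.hasDerivWithinAt
      have hbd : ∀ w ∈ Metric.ball t r, ‖F (y k w) - F (z t)‖ ≤ δ / 2 := by
        intro w hw
        obtain ⟨h1, h2⟩ := hrS hw
        have h3 : dist (y k w) (z t) < ρ := by
          calc dist (y k w) (z t) ≤ dist (y k w) (z w) + dist (z w) (z t) := dist_triangle _ _ _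
            _ < ρ / 2 + ρ / 2 := by
              rw [dist_eq_norm (y k w)]
              exact add_lt_add ((hyzk w h2).trans_lt hsk) h1
            _ = ρ := by ring
        rw [← dist_eq_norm]
        exact le_of_lt (hρF h3)
      have h4 := (convex_ball t r).norm_image_sub_le_of_norm_hasDerivWithin_le hder hbd
        (Metric.mem_ball_self hr) hτk
      rw [dist_zero_right, norm_smul, norm_inv, Real.norm_of_nonneg hmk.le, inv_mul_eq_div,
        div_lt_iff₀ hmk]
      have e : y k (τ k) - y k t - (τ k - t) • F (z t)
          = y k (τ k) - τ k • F (z t) - (y k t - t • F (z t)) := by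
        rw [sub_smul]; abel
      rw [e]
      refine h4.trans_lt ?_
      have h5 : ‖τ k - t‖ ≤ m k := by
        rw [Real.norm_eq_abs]
        simp only [hm]
        linarith
      nlinarith [norm_nonneg (τ k - t)]
    have h1 := (hrem.add (hα.smul_const (F (z t)))).add (hβ.smul hζ)
    rw [zero_add] at h1
    refine h1.congr' ?_
    filter_upwards [hpos] with k hk
    rw [smul_smul, mul_assoc, mul_inv_cancel₀ hk.ne', mul_one, mul_smul, ← smul_add, ← smul_add]
    congr 1
    abel

section Surface

variable {X : Type*} [TopologicalSpace X] [ChartedSpace Plane X] [IsManifold (𝓡 2) ∞ X]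
variable {g : SurfaceMetric X} {ι : Type*}

/-- The displacement of a family of geodesics at varying times `τ k → t`. -/
theorem IsJet.exists_tendsto_shift [T2Space X] {𝒰 : Ultrafilter ι} {ε : ι → ℝ}
    (hε : Tendsto ε 𝒰 (𝓝[>] 0)) {γ : ℝ → X} {σ : ι → ℝ → X} (hγ : IsGeodesic g γ)
    (hσ : ∀ k, IsGeodesic g (σ k)) {y x₀ : X} {ζ₀ ζ : Plane × Plane}
    (h0 : IsJet 𝒰 ε y (fun k => velocity (σ k) 0) (velocity γ 0) ζ₀) {t : ℝ} (ht : 0 < t)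
    (hζ : IsJet 𝒰 ε x₀ (fun k => velocity (σ k) t) (velocity γ t) ζ) {τ : ι → ℝ}
    (hτ : Tendsto τ 𝒰 (𝓝 t)) :
    (∀ᶠ k in (𝒰 : Filter ι), σ k (τ k) ∈ (chartAt Plane x₀).source) ∧
    Tendsto (fun k => coord x₀ (velocity (σ k) (τ k))) 𝒰 (𝓝 (coord x₀ (velocity γ t))) ∧
    ∃ α β : ℝ, |α| + β = 1 ∧ 0 ≤ β ∧
      Tendsto (fun k => (|τ k - t| + ε k)⁻¹ * ε k) 𝒰 (𝓝 β) ∧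
      Tendsto (fun k => (|τ k - t| + ε k)⁻¹ •
        (coord x₀ (velocity (σ k) (τ k)) - coord x₀ (velocity γ t))) 𝒰
        (𝓝 (α • spray g x₀ (coord x₀ (velocity γ t)) + β • ζ)) := by
  obtain ⟨η, hη, C, hC, hsrc, hb⟩ := eventually_bound hε hγ hσ h0 ht.le (x₀ := x₀) hζ.mem₀
  have hS : Ici 0 ∩ Ioo (t - η) (t + η) ∈ 𝓝 t :=
    inter_mem (Ici_mem_nhds ht) (Ioo_mem_nhds (by linarith) (by linarith))
  obtain ⟨α, β, h1, h2, h3, h4⟩ := Billiard.exists_tendsto_shift hε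
      (z := fun s => coord x₀ (velocity γ s))
      (y := fun k s => coord x₀ (velocity (σ k) s)) hS
      (contDiffAt_spray g x₀ ((chartAt Plane x₀).map_source hζ.mem₀)).continuousAt
      (hγ.hasDerivAt_coord hζ.mem₀).continuousAt
      (hb.mono fun k hk u hu => (hσ k).hasDerivAt_coord (hk u hu.2 hu.1).1)
      (hb.mono fun k hk u hu => (hk u hu.2 hu.1).2) hζ.lim hτ
  refine ⟨?_, ?_, α, β, h1, h2, h3, h4⟩
  · filter_upwards [hb, hτ.eventually hS] with k hk hk'
    exact (hk _ hk'.2 hk'.1).1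
  · have hm0 : Tendsto (fun k => |τ k - t| + ε k) 𝒰 (𝓝 0) := by
      have h5 : Tendsto (fun k => |τ k - t|) 𝒰 (𝓝 0) := by
        simpa using (hτ.sub_const t).abs
      simpa using h5.add (tendsto_nhds_of_tendsto_nhdsWithin hε)
    have h6 := hm0.smul h4
    rw [zero_smul] at h6
    refine tendsto_sub_nhds_zero_iff.1 (h6.congr' ?_)
    filter_upwards [hε.eventually self_mem_nhdsWithin] with k hk
    have hk' : 0 < ε k := hk
    have : |τ k - t| + ε k ≠ 0 := by positivity
    rw [smul_smul, mul_inv_cancel₀ this, one_smul]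

theorem cross_self (a : Plane) : cross a a = 0 := by simp [cross]; ring

theorem cross_add_right (a b c : Plane) : cross a (b + c) = cross a b + cross a c := by
  simp [cross]; ring

theorem cross_smul_right (a b : Plane) (s : ℝ) : cross a (s • b) = s * cross a b := by
  simp [cross]; ring

/-- Moving along the geodesic does not change the normal components of a displacement. -/
theorem jacQ_jacP_add_smul_spray (x₀ : X) (z ζ : Plane × Plane) (s : ℝ) :
    jacQ g x₀ z (ζ + s • spray g x₀ z) = jacQ g x₀ z ζ ∧
      jacP g x₀ z (ζ + s • spray g x₀ z) = jacP g x₀ z ζ := by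
  have hc : covPart g x₀ z (ζ + s • spray g x₀ z) = covPart g x₀ z ζ := by
    simp only [covPart, spray, Prod.fst_add, Prod.snd_add, Prod.smul_fst, Prod.smul_snd,
      chrVec_add_left, chrVec_smul_left, smul_neg]
    abel
  have hξ : cross z.2 (ζ + s • spray g x₀ z).1 = cross z.2 ζ.1 := by
    simp only [spray, Prod.fst_add, Prod.smul_fst, cross_add_right, cross_smul_right, cross_self,
      mul_zero, add_zero]
  simp only [jacQ, jacP, gram_eq_cross, hc, hξ, and_self]

/-- The geodesics of a family with nonzero normal displacement cannot all pass through the same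
point as the limit geodesic, at times close to each other. -/
theorem not_eventually_eq_of_jacQ_pos [T2Space X] {𝒰 : Ultrafilter ι} {ε : ι → ℝ}
    (hε : Tendsto ε 𝒰 (𝓝[>] 0)) {γ : ℝ → X} {σ : ι → ℝ → X} (hγ : IsGeodesic g γ)
    (hσ : ∀ k, IsGeodesic g (σ k)) {y x₀ : X} {ζ₀ ζ : Plane × Plane}
    (h0 : IsJet 𝒰 ε y (fun k => velocity (σ k) 0) (velocity γ 0) ζ₀) {t : ℝ} (ht : 0 < t)
    (hζ : IsJet 𝒰 ε x₀ (fun k => velocity (σ k) t) (velocity γ t) ζ)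
    (hQ : 0 < jacQ g x₀ (coord x₀ (velocity γ t)) ζ) {τ : ι → ℝ}
    (hτ : Tendsto τ 𝒰 (𝓝 t)) : ¬ ∀ᶠ k in (𝒰 : Filter ι), σ k (τ k) = γ t := by
  intro heq
  obtain ⟨-, -, α, β, hαβ, -, -, hlim⟩ := IsJet.exists_tendsto_shift hε hγ hσ h0 ht hζ hτ
  have hfst : α • (coord x₀ (velocity γ t)).2 + β • ζ.1 = 0 := by
    refine tendsto_nhds_unique ((continuous_fst.tendsto _).comp hlim)
      (tendsto_const_nhds.congr' ?_)
    filter_upwards [heq] with k hk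
    have : (coord x₀ (velocity (σ k) (τ k))).1 = (coord x₀ (velocity γ t)).1 :=
      congrArg (chartAt Plane x₀) hk
    simp only [Function.comp, Prod.smul_fst, Prod.fst_sub, this, sub_self, smul_zero]
  have hcross : cross (coord x₀ (velocity γ t)).2 ζ.1 = 0 := by
    by_cases hβ : β = 0
    · rw [hβ] at hαβ hfst
      have hα : α ≠ 0 := by rintro rfl; simp at hαβ
      rw [zero_smul, add_zero, smul_eq_zero] at hfst
      rw [hfst.resolve_left hα]
      simp [cross]
    · have h := congrArg (cross (coord x₀ (velocity γ t)).2) hfst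
      rw [cross_add_right, cross_smul_right, cross_smul_right, cross_self, mul_zero, zero_add] at h
      rw [show cross (coord x₀ (velocity γ t)).2 (0 : Plane) = 0 by simp [cross]] at h
      exact (mul_eq_zero.1 h).resolve_left hβ
  rw [jacQ, gram_eq_cross, hcross] at hQ
  simp at hQ

/-- If the geodesics of a family reach the level set of a function `f` (in coordinates) at the times
`τ k`, and the limit geodesic crosses this level set transversally, then the family has a
displacement at these times, which is tangent to the level set. -/
theorem IsJet.exists_at_hitting_times [T2Space X] {𝒰 : Ultrafilter ι} {ε : ι → ℝ}
    (hε : Tendsto ε 𝒰 (𝓝[>] 0)) {γ : ℝ → X} {σ : ι → ℝ → X} (hγ : IsGeodesic g γ)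
    (hσ : ∀ k, IsGeodesic g (σ k)) {y x₀ : X} {ζ₀ ζ : Plane × Plane}
    (h0 : IsJet 𝒰 ε y (fun k => velocity (σ k) 0) (velocity γ 0) ζ₀) {t : ℝ} (ht : 0 < t)
    (hζ : IsJet 𝒰 ε x₀ (fun k => velocity (σ k) t) (velocity γ t) ζ) {τ : ι → ℝ}
    (hτ : Tendsto τ 𝒰 (𝓝 t)) {f : Plane → ℝ}
    (hf : DifferentiableAt ℝ f (coord x₀ (velocity γ t)).1)
    (htrans : fderiv ℝ f (coord x₀ (velocity γ t)).1 (coord x₀ (velocity γ t)).2 ≠ 0)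
    (hlevel : ∀ᶠ k in (𝒰 : Filter ι),
      f (coord x₀ (velocity (σ k) (τ k))).1 = f (coord x₀ (velocity γ t)).1) :
    ∃ ζ', IsJet 𝒰 ε x₀ (fun k => velocity (σ k) (τ k)) (velocity γ t) ζ' ∧
      fderiv ℝ f (coord x₀ (velocity γ t)).1 ζ'.1 = 0 ∧
      jacQ g x₀ (coord x₀ (velocity γ t)) ζ' = jacQ g x₀ (coord x₀ (velocity γ t)) ζ ∧
      jacP g x₀ (coord x₀ (velocity γ t)) ζ' = jacP g x₀ (coord x₀ (velocity γ t)) ζ := by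
  obtain ⟨hsrc, hconv, α, β, hαβ, -, hβlim, hlim⟩ := IsJet.exists_tendsto_shift hε hγ hσ h0 ht hζ hτ
  set z := coord x₀ (velocity γ t) with hz
  set m : ι → ℝ := fun k => |τ k - t| + ε k with hm
  have hpos : ∀ᶠ k in (𝒰 : Filter ι), 0 < ε k := hε.eventually self_mem_nhdsWithin
  have hlim1 : Tendsto (fun k => (m k)⁻¹ • ((coord x₀ (velocity (σ k) (τ k))).1 - z.1)) 𝒰
      (𝓝 (α • z.2 + β • ζ.1)) := (continuous_fst.tendsto _).comp hlim
  have hdiff : Tendsto (fun k => (coord x₀ (velocity (σ k) (τ k))).1 - z.1) 𝒰 (𝓝 0) :=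
    tendsto_sub_nhds_zero_iff.2 ((continuous_fst.tendsto _).comp hconv)
  have hdf : fderiv ℝ f z.1 (α • z.2 + β • ζ.1) = 0 := by
    have h1 := HasFDerivWithinAt.lim hf.hasFDerivAt.hasFDerivWithinAt (s := univ) hdiff
      (Eventually.of_forall fun _ => mem_univ _) hlim1
    refine tendsto_nhds_unique h1 (tendsto_const_nhds.congr' ?_)
    filter_upwards [hlevel] with k hk
    rw [add_sub_cancel, hk, sub_self, smul_zero]
  rw [map_add, map_smul, map_smul, smul_eq_mul, smul_eq_mul] at hdf
  have hβ : β ≠ 0 := by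
    rintro rfl
    have hα : α ≠ 0 := by rintro rfl; simp at hαβ
    rw [zero_mul, add_zero] at hdf
    exact htrans ((mul_eq_zero.1 hdf).resolve_left hα)
  obtain ⟨hQ, hP⟩ := jacQ_jacP_add_smul_spray (g := g) x₀ z ζ (β⁻¹ * α)
  refine ⟨ζ + (β⁻¹ * α) • spray g x₀ z, ⟨hζ.mem₀, hsrc, ?_⟩, ?_, hQ, hP⟩
  · have h1 := (hβlim.inv₀ hβ).smul hlim
    have e : β⁻¹ • (α • spray g x₀ z + β • ζ) = ζ + (β⁻¹ * α) • spray g x₀ z := by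
      rw [smul_add, smul_smul, smul_smul, inv_mul_cancel₀ hβ, one_smul, add_comm]
    rw [e] at h1
    refine h1.congr' ?_
    filter_upwards [hpos] with k hk
    have hmk : |τ k - t| + ε k ≠ 0 := by positivity
    rw [smul_smul]
    congr 1
    field_simp
  · simp only [spray, Prod.fst_add, Prod.smul_fst, map_add, map_smul, smul_eq_mul]
    field_simp
    linarith

end Surface

section Surface

variable {X : Type*} [TopologicalSpace X] [ChartedSpace Plane X] [IsManifold (𝓡 2) ∞ X]
variable (g : SurfaceMetric X)

/-! ### Reflection in a level set, in a chart -/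

/-- A function on the surface in the coordinates of the chart at `x₀`. -/
def inChart (x₀ : X) (ρ : X → ℝ) (u : Plane) : ℝ := ρ ((chartAt Plane x₀).symm u)

theorem contDiffOn_inChart (x₀ : X) {ρ : X → ℝ} (hρ : ContMDiff (𝓡 2) 𝓘(ℝ, ℝ) ∞ ρ) :
    ContDiffOn ℝ ∞ (inChart x₀ ρ) (chartAt Plane x₀).target := by
  rw [← contMDiffOn_iff_contDiffOn]
  exact hρ.comp_contMDiffOn (contMDiffOn_chart_symm_plane x₀)

theorem fderiv_inChart (x₀ : X) {ρ : X → ℝ} (hρ : ContMDiff (𝓡 2) 𝓘(ℝ, ℝ) ∞ ρ) {x : X}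
    (hx : x ∈ (chartAt Plane x₀).source) (v : TangentSpace (𝓡 2) x) :
    fderiv ℝ (inChart x₀ ρ) (chartAt Plane x₀ x) (chartD x₀ x v)
      = mfderiv (𝓡 2) 𝓘(ℝ, ℝ) ρ x v := by
  have hu := (chartAt Plane x₀).map_source hx
  have h := mfderiv_comp (chartAt Plane x₀ x)
    (hρ.mdifferentiableAt (x := (chartAt Plane x₀).symm (chartAt Plane x₀ x)) (by simp))
    (mdifferentiableAt_chart_symm x₀ hu)
  have key : ∀ (y : X) (v' : TangentSpace (𝓡 2) y), y = x → (v' : Plane) = (v : Plane) →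
      (mfderiv (𝓡 2) 𝓘(ℝ, ℝ) ρ y v' : ℝ) = mfderiv (𝓡 2) 𝓘(ℝ, ℝ) ρ x v := by
    rintro y v' rfl hv
    rw [show v' = v from hv]
  rw [← mfderiv_eq_fderiv]
  refine Eq.trans (DFunLike.congr_fun h (chartD x₀ x v)) ?_
  exact key _ _ ((chartAt Plane x₀).left_inv hx) (chartSymmD_chartD x₀ hx v)

/-- The covariant Hessian `∂²f(a, b) - df(Γ(a, b))` of a function `f` of the coordinates. -/
def hessForm (x₀ : X) (f : Plane → ℝ) (u a b : Plane) : ℝ :=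
  fderiv ℝ (fderiv ℝ f) u a b - fderiv ℝ f u (chrVec g x₀ u a b)

theorem hessian_eq_hessForm {ρ : X → ℝ} (hρ : ContMDiff (𝓡 2) 𝓘(ℝ, ℝ) ∞ ρ) (x : X)
    (v : TangentSpace (𝓡 2) x) :
    hessian g ρ x v = hessForm g x (inChart x ρ) (chartAt Plane x x) (chartD x x v)
      (chartD x x v) := by
  have hsm := (contDiffOn_inChart x hρ).contDiffAt
    ((chartAt Plane x).open_target.mem_nhds (mem_chart_target Plane x))
  have h2 : ∀ a b : Plane, fderiv ℝ (fderiv ℝ (inChart x ρ)) (chartAt Plane x x) a b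
      = ∑ i, ∑ j,
          partialDeriv i (partialDeriv j (inChart x ρ)) (chartAt Plane x x) * a i * b j := by
    intro a b
    conv_lhs => rw [plane_eq b]
    rw [map_add, map_smul, map_smul, ← fderiv_partialDeriv hsm, ← fderiv_partialDeriv hsm,
      fderiv_eq_partialDeriv, fderiv_eq_partialDeriv]
    simp only [Fin.sum_univ_two, smul_eq_mul]
    ring
  rw [hessForm, h2, fderiv_eq_partialDeriv]
  simp only [chrVec_apply, Fin.sum_univ_two]
  change (∑ i : Fin 2, ∑ j : Fin 2,
    (partialDeriv i (partialDeriv j (inChart x ρ)) (chartAt Plane x x)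
      - ∑ k : Fin 2, christoffel g x k i j (chartAt Plane x x)
          * partialDeriv k (inChart x ρ) (chartAt Plane x x))
      * chartD x x v i * chartD x x v j) = _
  simp only [Fin.sum_univ_two]
  ring

/-- The vector `det(g) ∇f`, normal to the level sets of `f`. -/
def normalVec (x₀ : X) (f : Plane → ℝ) (u : Plane) : Plane :=
  WithLp.toLp 2 ![metricMatrix g x₀ u 1 1 * partialDeriv 0 f u
      - metricMatrix g x₀ u 0 1 * partialDeriv 1 f u,
    metricMatrix g x₀ u 0 0 * partialDeriv 1 f u - metricMatrix g x₀ u 0 1 * partialDeriv 0 f u]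

/-- The vector `(-∂_1 f, ∂_0 f)`, tangent to the level sets of `f`. -/
def tangentVec (f : Plane → ℝ) (u : Plane) : Plane :=
  WithLp.toLp 2 ![- partialDeriv 1 f u, partialDeriv 0 f u]

/-- `det(g) |∇f|²`. -/
def normalSq (x₀ : X) (f : Plane → ℝ) (u : Plane) : ℝ := fderiv ℝ f u (normalVec g x₀ f u)

theorem gForm_normalVec (x₀ : X) (f : Plane → ℝ) (u a : Plane) :
    gForm g x₀ u (normalVec g x₀ f u) a = gDet g x₀ u * fderiv ℝ f u a := by
  simp only [gForm, normalVec, Fin.sum_univ_two, fderiv_eq_partialDeriv, gDet_eq,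
    metricMatrix_symm g x₀ u 1 0, PiLp.toLp_apply, Matrix.cons_val_zero, Matrix.cons_val_one]
  ring

theorem fderiv_tangentVec (f : Plane → ℝ) (u : Plane) : fderiv ℝ f u (tangentVec f u) = 0 := by
  simp [fderiv_eq_partialDeriv, tangentVec]; ring

theorem gForm_tangentVec_self (x₀ : X) (f : Plane → ℝ) (u : Plane) :
    gForm g x₀ u (tangentVec f u) (tangentVec f u) = normalSq g x₀ f u := by
  simp only [gForm, normalSq, normalVec, tangentVec, Fin.sum_univ_two, fderiv_eq_partialDeriv,
    metricMatrix_symm g x₀ u 1 0, PiLp.toLp_apply, Matrix.cons_val_zero, Matrix.cons_val_one]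
  ring

theorem normalSq_pos (x₀ : X) {f : Plane → ℝ} {u : Plane} (hu : u ∈ (chartAt Plane x₀).target)
    (hf : fderiv ℝ f u ≠ 0) : 0 < normalSq g x₀ f u := by
  rw [← gForm_tangentVec_self]
  refine gForm_self_pos g x₀ hu fun h => hf ?_
  have h0 := congrArg (fun a : Plane => a 0) h
  have h1 := congrArg (fun a : Plane => a 1) h
  simp [tangentVec] at h0 h1
  ext a
  simp [fderiv_eq_partialDeriv, h0, h1]

/-- Decomposition of a vector into its components tangent and normal to the level set of `f`. -/
theorem normalSq_smul_eq (x₀ : X) (f : Plane → ℝ) (u a : Plane) :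
    normalSq g x₀ f u • a = gForm g x₀ u a (tangentVec f u) • tangentVec f u
      + fderiv ℝ f u a • normalVec g x₀ f u := by
  ext i
  simp only [gForm, normalSq, normalVec, tangentVec, Fin.sum_univ_two, fderiv_eq_partialDeriv,
    metricMatrix_symm g x₀ u 1 0, PiLp.toLp_apply, Matrix.cons_val_zero, Matrix.cons_val_one,
    PiLp.add_apply, PiLp.smul_apply, smul_eq_mul]
  fin_cases i <;> simp <;> ring

theorem eq_tangent_add_normal (x₀ : X) {f : Plane → ℝ} {u : Plane}
    (hN : normalSq g x₀ f u ≠ 0) (a : Plane) :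
    a = (gForm g x₀ u a (tangentVec f u) / normalSq g x₀ f u) • tangentVec f u
      + (fderiv ℝ f u a / normalSq g x₀ f u) • normalVec g x₀ f u := by
  have h := congrArg (fun b => (normalSq g x₀ f u)⁻¹ • b) (normalSq_smul_eq g x₀ f u a)
  simp only [smul_smul, smul_add, inv_mul_cancel₀ hN, one_smul] at h
  rw [div_eq_inv_mul, div_eq_inv_mul]
  exact h

/-- The elastic reflection of the velocities in the level sets of `f`, in coordinates. -/
def reflCoord (x₀ : X) (f : Plane → ℝ) (z : Plane × Plane) : Plane × Plane :=
  (z.1, z.2 - (2 * fderiv ℝ f z.1 z.2 / normalSq g x₀ f z.1) • normalVec g x₀ f z.1)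

theorem differentiableAt_reflCoord (x₀ : X) {f : Plane → ℝ}
    (hf : ContDiffOn ℝ ∞ f (chartAt Plane x₀).target) {z : Plane × Plane}
    (hz : z.1 ∈ (chartAt Plane x₀).target) (hN : normalSq g x₀ f z.1 ≠ 0) :
    DifferentiableAt ℝ (reflCoord g x₀ f) z := by
  have hp : ∀ i, DifferentiableAt ℝ (partialDeriv i f) z.1 := fun i =>
    ((contDiffOn_partialDeriv (chartAt Plane x₀).open_target hf i).contDiffAt
      ((chartAt Plane x₀).open_target.mem_nhds hz)).differentiableAt (by simp)
  have hm := differentiableAt_metricMatrix g x₀ hz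
  have hn : DifferentiableAt ℝ (normalVec g x₀ f) z.1 := by
    rw [differentiableAt_euclidean]
    intro i
    fin_cases i
    · exact ((hm 1 1).mul (hp 0)).sub ((hm 0 1).mul (hp 1))
    · exact ((hm 0 0).mul (hp 1)).sub ((hm 0 1).mul (hp 0))
  have hdf : DifferentiableAt ℝ (fderiv ℝ f) z.1 :=
    ((hf.contDiffAt ((chartAt Plane x₀).open_target.mem_nhds hz)).fderiv_right (m := 1)
      (by norm_cast)).differentiableAt (by simp)
  have hNd : DifferentiableAt ℝ (normalSq g x₀ f) z.1 := hdf.clm_apply hn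
  have hfst : DifferentiableAt ℝ (fun z : Plane × Plane => z.1) z := differentiableAt_fst
  have h1 : DifferentiableAt ℝ (fun z : Plane × Plane => fderiv ℝ f z.1) z :=
    DifferentiableAt.comp z hdf hfst
  have h2 : DifferentiableAt ℝ (fun z : Plane × Plane => normalSq g x₀ f z.1) z :=
    DifferentiableAt.comp z hNd hfst
  have h3 : DifferentiableAt ℝ (fun z : Plane × Plane => normalVec g x₀ f z.1) z :=
    DifferentiableAt.comp (g := normalVec g x₀ f) z hn hfst
  have h4 : DifferentiableAt ℝ (fun z : Plane × Plane => fderiv ℝ f z.1 z.2) z :=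
    h1.clm_apply differentiableAt_snd
  have h5 := ((h4.const_mul 2).mul (h2.inv hN)).smul h3
  refine hfst.prodMk (differentiableAt_snd.sub (h5.congr_of_eventuallyEq ?_))
  exact Eventually.of_forall fun w => by simp [div_eq_mul_inv]

/-- The product rule for a differential applied to a vector field along a curve. -/
theorem hasDerivWithinAt_fderiv_apply (x₀ : X) {f : Plane → ℝ} {c a : ℝ → Plane} {c' a' : Plane}
    {S : Set ℝ} {t : ℝ} (hf : ContDiffAt ℝ ∞ f (c t)) (hc : HasDerivWithinAt c c' S t)
    (ha : HasDerivWithinAt a a' S t) :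
    HasDerivWithinAt (fun s => fderiv ℝ f (c s) (a s))
      (hessForm g x₀ f (c t) c' (a t)
        + fderiv ℝ f (c t) (a' + chrVec g x₀ (c t) c' (a t))) S t := by
  have h1 : DifferentiableAt ℝ (fderiv ℝ f) (c t) :=
    (hf.fderiv_right (m := 1) (by norm_cast)).differentiableAt (by simp)
  refine ((h1.hasFDerivAt.comp_hasDerivWithinAt t hc).clm_apply ha).congr_deriv ?_
  rw [hessForm, map_add]
  simp only [Function.comp]
  ring

theorem fderiv_reflCoord_snd (x₀ : X) {f : Plane → ℝ} {z : Plane × Plane}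
    (hN : normalSq g x₀ f z.1 ≠ 0) :
    fderiv ℝ f z.1 (reflCoord g x₀ f z).2 = - fderiv ℝ f z.1 z.2 := by
  simp only [reflCoord, map_sub, map_smul, smul_eq_mul]
  rw [show fderiv ℝ f z.1 (normalVec g x₀ f z.1) = normalSq g x₀ f z.1 from rfl]
  field_simp
  ring

theorem gForm_reflCoord_snd_tangentVec (x₀ : X) (f : Plane → ℝ) (z : Plane × Plane) :
    gForm g x₀ z.1 (reflCoord g x₀ f z).2 (tangentVec f z.1)
      = gForm g x₀ z.1 z.2 (tangentVec f z.1) := by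
  simp only [reflCoord, gForm_sub_left, gForm_smul_left, gForm_normalVec, fderiv_tangentVec]
  ring

theorem gForm_smul_right (x₀ : X) (u a b : Plane) (s : ℝ) :
    gForm g x₀ u a (s • b) = s * gForm g x₀ u a b := by
  rw [gForm_comm, gForm_smul_left, gForm_comm]

/-- The effect of a reflection on the invariants of an infinitesimal displacement along the mirror:
the normal component is preserved up to sign, and if the mirror is convex, seen from the incoming
side, then the reflection adds to the divergence. -/
theorem jacQ_jacP_reflCoord (x₀ : X) {f : Plane → ℝ}
    (hf : ContDiffOn ℝ ∞ f (chartAt Plane x₀).target) {z ζ : Plane × Plane}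
    (hz : z.1 ∈ (chartAt Plane x₀).target) (hf0 : fderiv ℝ f z.1 ≠ 0)
    (hhess : 0 ≤ hessForm g x₀ f z.1 (tangentVec f z.1) (tangentVec f z.1))
    (hin : fderiv ℝ f z.1 z.2 ≤ 0) (hζ : fderiv ℝ f z.1 ζ.1 = 0) :
    jacQ g x₀ (reflCoord g x₀ f z) (fderiv ℝ (reflCoord g x₀ f) z ζ) = jacQ g x₀ z ζ ∧
      jacP g x₀ z ζ ≤ jacP g x₀ (reflCoord g x₀ f z) (fderiv ℝ (reflCoord g x₀ f) z ζ) := by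
  set N := normalSq g x₀ f z.1 with hNdef
  have hN : 0 < N := normalSq_pos g x₀ hz hf0
  set τ := tangentVec f z.1 with hτ
  set n := normalVec g x₀ f z.1 with hn
  set w := (reflCoord g x₀ f z).2 with hw
  set D := fderiv ℝ (reflCoord g x₀ f) z ζ with hD
  have hfz := hf.contDiffAt ((chartAt Plane x₀).open_target.mem_nhds hz)
  -- the line `z + s ζ` and its reflection
  have hline : ∀ a b : Plane, HasDerivWithinAt (fun s : ℝ => a + s • b) b univ 0 := fun a b => by
    simpa using (((hasDerivAt_id (0 : ℝ)).smul_const b).const_add a).hasDerivWithinAt (s := univ)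
  have e0 : ∀ a b : Plane, a + (0 : ℝ) • b = a := fun a b => by simp
  set c : ℝ → Plane × Plane := fun s => (z.1 + s • ζ.1, z.2 + s • ζ.2) with hc
  have hc0 : c 0 = z := by simp [hc]
  have hcd : HasDerivWithinAt c ζ univ 0 := (hline z.1 ζ.1).prodMk (hline z.2 ζ.2)
  have hc1 : HasDerivWithinAt (fun s => (c s).1) ζ.1 univ 0 := hline z.1 ζ.1
  have hc2 : HasDerivWithinAt (fun s => (c s).2) ζ.2 univ 0 := hline z.2 ζ.2
  have hR : HasDerivWithinAt (fun s => reflCoord g x₀ f (c s)) D univ 0 := by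
    have h := (differentiableAt_reflCoord g x₀ hf hz hN.ne').hasFDerivAt
    rw [← hc0] at h
    have := h.comp_hasDerivWithinAt 0 hcd
    rw [hc0] at this
    exact this
  have hD1 : D.1 = ζ.1 := by
    have h : HasDerivWithinAt (fun s => (c s).1) D.1 univ 0 :=
      HasFDerivAt.comp_hasDerivWithinAt (f := fun s => reflCoord g x₀ f (c s)) (0 : ℝ)
        (hasFDerivAt_fst (𝕜 := ℝ) (E := Plane) (F := Plane)) hR
    exact uniqueDiffWithinAt_univ.eq_deriv _ h hc1
  have hw' : HasDerivWithinAt (fun s => (reflCoord g x₀ f (c s)).2) D.2 univ 0 :=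
    HasFDerivAt.comp_hasDerivWithinAt (f := fun s => reflCoord g x₀ f (c s)) (0 : ℝ)
      (hasFDerivAt_snd (𝕜 := ℝ) (E := Plane) (F := Plane)) hR
  have hcont : ContinuousWithinAt (fun s => (c s).1) univ 0 := hc1.continuousWithinAt
  rw [continuousWithinAt_univ] at hcont
  have hc01 : (c 0).1 = z.1 := by rw [hc0]
  have hNev : ∀ᶠ s in 𝓝 (0 : ℝ), normalSq g x₀ f (c s).1 ≠ 0 := by
    have h1 : ContinuousAt (fderiv ℝ f) (c 0).1 := by
      rw [hc01]
      exact ((hfz.fderiv_right (m := 1) (by norm_cast)).differentiableAt (by simp)).continuousAt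
    have h2 : ∀ᶠ s in 𝓝 (0 : ℝ), fderiv ℝ f (c s).1 ≠ 0 :=
      (ContinuousAt.comp (f := fun s => (c s).1) h1 hcont).eventually_ne (by simpa [hc01] using hf0)
    have h3 : ∀ᶠ s in 𝓝 (0 : ℝ), (c s).1 ∈ (chartAt Plane x₀).target :=
      hcont.preimage_mem_nhds ((chartAt Plane x₀).open_target.mem_nhds (by rwa [hc01]))
    filter_upwards [h2, h3] with s hs hs'
    exact (normalSq_pos g x₀ hs' hs).ne'
  -- covariant parts of the displacements before and after the reflection
  set Dv := covPart g x₀ z ζ with hDv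
  set Dw := covPart g x₀ (reflCoord g x₀ f z) D with hDw
  have hDw' : Dw = D.2 + chrVec g x₀ z.1 ζ.1 w := by
    rw [hDw, covPart, hD1]
    rfl
  have hDv' : Dv = ζ.2 + chrVec g x₀ z.1 ζ.1 z.2 := rfl
  have hfz0 : ContDiffAt ℝ ∞ f (c 0).1 := by rwa [hc01]
  -- differentiate `df(w) = - df(v)`
  have hrel1 : hessForm g x₀ f z.1 ζ.1 w + fderiv ℝ f z.1 Dw
      = - (hessForm g x₀ f z.1 ζ.1 z.2 + fderiv ℝ f z.1 Dv) := by
    have h1 := hasDerivWithinAt_fderiv_apply g x₀ hfz0 hc1 hw'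
    have h2 := (hasDerivWithinAt_fderiv_apply g x₀ hfz0 hc1 hc2).neg
    have h3 := h2.congr_of_eventuallyEq (f₁ := fun s => fderiv ℝ f (c s).1
      (reflCoord g x₀ f (c s)).2) (by
        rw [nhdsWithin_univ]
        filter_upwards [hNev] with s hs
        exact fderiv_reflCoord_snd g x₀ hs) (fderiv_reflCoord_snd g x₀ hNev.self_of_nhds)
    have h4 := uniqueDiffWithinAt_univ.eq_deriv _ h1 h3
    rw [hc0] at h4
    rw [hDw', hDv']
    exact h4
  -- differentiate `⟨w, τ⟩ = ⟨v, τ⟩` and `df(τ) = 0`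
  have hτd : ∃ τ', HasDerivWithinAt (fun s => tangentVec f (c s).1) τ' univ 0 := by
    have hp : ∀ i, DifferentiableAt ℝ (partialDeriv i f) (c 0).1 := fun i => by
      rw [hc01]
      exact ((contDiffOn_partialDeriv (chartAt Plane x₀).open_target hf i).contDiffAt
        ((chartAt Plane x₀).open_target.mem_nhds hz)).differentiableAt (by simp)
    have h1 : DifferentiableAt ℝ (tangentVec f) (c 0).1 := by
      rw [differentiableAt_euclidean]
      intro i
      fin_cases i
      · exact (hp 1).neg
      · exact hp 0
    exact ⟨_, HasFDerivAt.comp_hasDerivWithinAt (l := tangentVec f) (f := fun s => (c s).1)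
      (0 : ℝ) h1.hasFDerivAt hc1⟩
  obtain ⟨τ', hτd⟩ := hτd
  set Dτ := τ' + chrVec g x₀ z.1 ζ.1 τ with hDτ
  have hrel2 : gForm g x₀ z.1 Dw τ + gForm g x₀ z.1 w Dτ
      = gForm g x₀ z.1 Dv τ + gForm g x₀ z.1 z.2 Dτ := by
    have hz0 : (c 0).1 ∈ (chartAt Plane x₀).target := by rwa [hc01]
    have h1 := hasDerivWithinAt_gForm g x₀ hz0 hc1 hw' hτd
    have h2 := hasDerivWithinAt_gForm g x₀ hz0 hc1 hc2 hτd
    have h3 := h2.congr_of_eventuallyEq (f₁ := fun s => gForm g x₀ (c s).1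
      (reflCoord g x₀ f (c s)).2 (tangentVec f (c s).1)) (Eventually.of_forall fun s =>
        gForm_reflCoord_snd_tangentVec g x₀ f (c s)) (gForm_reflCoord_snd_tangentVec g x₀ f (c 0))
    have h4 := uniqueDiffWithinAt_univ.eq_deriv _ h1 h3
    rw [hc0] at h4
    rw [hDw', hDv']
    exact h4
  have hrel3 : hessForm g x₀ f z.1 ζ.1 τ + fderiv ℝ f z.1 Dτ = 0 := by
    have h1 := hasDerivWithinAt_fderiv_apply g x₀ hfz0 hc1 hτd
    have h2 : HasDerivWithinAt (fun s => fderiv ℝ f (c s).1 (tangentVec f (c s).1)) 0 univ 0 := by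
      simp only [fderiv_tangentVec]
      exact hasDerivWithinAt_const _ _ _
    have h4 := uniqueDiffWithinAt_univ.eq_deriv _ h1 h2
    rw [hc0] at h4
    exact h4
  -- components with respect to the tangent and the normal vector
  obtain ⟨l, hl⟩ : ∃ l : ℝ, ζ.1 = l • τ := by
    have h := eq_tangent_add_normal g x₀ hN.ne' ζ.1
    rw [hζ, zero_div, zero_smul, add_zero] at h
    exact ⟨_, h⟩
  obtain ⟨p, q, hpq, hq⟩ : ∃ p q : ℝ, z.2 = p • τ + q • n ∧ fderiv ℝ f z.1 z.2 = q * N :=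
    ⟨_, _, eq_tangent_add_normal g x₀ hN.ne' z.2, (div_mul_cancel₀ _ hN.ne').symm⟩
  have hw2 : w = p • τ - q • n := by
    rw [hw, reflCoord, ← hNdef, ← hn]
    simp only
    rw [hq, show 2 * (q * N) / N = 2 * q by field_simp]
    conv_lhs => rw [hpq]
    rw [two_mul, add_smul]
    abel
  obtain ⟨a, b, hab⟩ : ∃ a b : ℝ, Dv = a • τ + b • n :=
    ⟨_, _, eq_tangent_add_normal g x₀ hN.ne' Dv⟩
  obtain ⟨a', b', hab'⟩ : ∃ a b : ℝ, Dw = a • τ + b • n :=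
    ⟨_, _, eq_tangent_add_normal g x₀ hN.ne' Dw⟩
  have hττ : gForm g x₀ z.1 τ τ = N := gForm_tangentVec_self g x₀ f z.1
  have hnτ : gForm g x₀ z.1 n τ = 0 := by
    rw [hn, gForm_normalVec, hτ, fderiv_tangentVec, mul_zero]
  have hτn : gForm g x₀ z.1 τ n = 0 := by rw [gForm_comm, hnτ]
  have hnn : gForm g x₀ z.1 n n = gDet g x₀ z.1 * N := by
    rw [hn, gForm_normalVec]
    rfl
  have hfτ : fderiv ℝ f z.1 τ = 0 := fderiv_tangentVec f z.1
  have hfn : fderiv ℝ f z.1 n = N := rfl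
  set H := hessForm g x₀ f z.1 τ τ with hH
  have hHadd : ∀ s t : Plane, hessForm g x₀ f z.1 ζ.1 s + hessForm g x₀ f z.1 ζ.1 t
      = hessForm g x₀ f z.1 ζ.1 (s + t) := by
    intro s t
    simp only [hessForm, chrVec_comm g x₀ z.1 ζ.1, chrVec_add_left, map_add]
    ring
  have hHsmul : ∀ s t : ℝ, hessForm g x₀ f z.1 (s • τ) (t • τ) = s * t * H := by
    intro s t
    rw [hH]
    simp only [hessForm, chrVec_smul_left, map_smul, smul_apply, smul_eq_mul]
    rw [chrVec_comm g x₀ z.1 τ (t • τ), chrVec_smul_left, map_smul, smul_eq_mul]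
    ring
  -- the change of the normal part of the covariant derivative
  have r1 : N * (b + b') = - (2 * p * l * H) := by
    have h1 : hessForm g x₀ f z.1 ζ.1 w + hessForm g x₀ f z.1 ζ.1 z.2 = l * (2 * p) * H := by
      rw [hHadd, hw2, hpq, show p • τ - q • n + (p • τ + q • n) = (2 * p) • τ by
        rw [two_mul, add_smul]; abel, hl, hHsmul]
    rw [hab, hab'] at hrel1
    simp only [map_add, map_smul, smul_eq_mul, hfτ, hfn] at hrel1
    linarith
  -- the change of its tangential part
  have r2 : N * (a' - a) = - (2 * q * gDet g x₀ z.1 * l * H) := by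
    have h1 : hessForm g x₀ f z.1 ζ.1 τ = l * H := by
      have := hHsmul l 1
      rw [one_smul, mul_one] at this
      rw [hl, this]
    have h2 : gForm g x₀ z.1 n Dτ = - (gDet g x₀ z.1 * (l * H)) := by
      rw [hn, gForm_normalVec, show fderiv ℝ f z.1 Dτ = - (l * H) by linarith]
      ring
    rw [hab, hab', hw2, hpq] at hrel2
    simp only [gForm_add_left, gForm_sub_left, gForm_smul_left, hττ, hnτ, h2] at hrel2
    linarith
  have hdet := gDet_pos g x₀ hz
  refine ⟨?_, ?_⟩
  · change gram g x₀ z.1 w D.1 D.1 = gram g x₀ z.1 z.2 ζ.1 ζ.1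
    rw [hD1, hl, hw2, hpq]
    simp only [gram, gForm_add_left, gForm_add_right, gForm_smul_left,
      gForm_smul_right, hττ, hnτ, hτn, hnn, sub_eq_add_neg, ← neg_smul]
    ring
  · change gram g x₀ z.1 z.2 ζ.1 Dv ≤ gram g x₀ z.1 w D.1 Dw
    rw [hD1, hl, hw2, hpq, hab, hab']
    simp only [gram, gForm_add_left, gForm_add_right, gForm_smul_left, gForm_smul_right,
      hττ, hnτ, hτn, hnn, sub_eq_add_neg, ← neg_smul]
    have hq0 : q ≤ 0 := by
      rw [hq] at hin
      exact nonpos_of_mul_nonpos_left hin hN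
    have hkey : 0 ≤ 2 * l ^ 2 * N * gDet g x₀ z.1 * (- q) * H
        * (q ^ 2 * gDet g x₀ z.1 + p ^ 2) := by
      have : 0 ≤ - q := by linarith
      positivity
    linear_combination hkey - l * N * gDet g x₀ z.1 * q * (q * r2 + p * r1)

end Surface

/-! ### Normals and reflections on the surface -/

theorem eventually_neg_of_hasDerivAt {h : ℝ → ℝ} {a : ℝ} (hd : HasDerivAt h a 0) (h0 : h 0 = 0)
    (ha : a < 0) : ∀ᶠ s in 𝓝[>] (0 : ℝ), h s < 0 := by
  have h1 := (hasDerivAt_iff_tendsto_slope.1 hd).mono_left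
    (nhdsWithin_mono 0 (fun s (hs : 0 < s) => hs.ne'))
  filter_upwards [h1.eventually (gt_mem_nhds ha), self_mem_nhdsWithin] with s hs hs0
  rw [slope_def_field, h0, sub_zero, sub_zero] at hs
  have hs0' : 0 < s := hs0
  rw [div_lt_iff₀ hs0', zero_mul] at hs
  exact hs

/-- Two nonzero linear forms are proportional if one is nonpositive where the other is negative. -/
theorem exists_eq_mul_of_neg_imp {E : Type*} [AddCommGroup E] [Module ℝ E] {A B : E →ₗ[ℝ] ℝ}
    (hA : A ≠ 0) (hB : B ≠ 0) (h : ∀ w, A w < 0 → B w ≤ 0) :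
    ∃ c : ℝ, c ≠ 0 ∧ ∀ w, A w = c * B w := by
  obtain ⟨w₁, hw₁⟩ : ∃ w, A w ≠ 0 := by
    by_contra! hall
    exact hA (LinearMap.ext hall)
  obtain ⟨w₀, hAw₀⟩ : ∃ w₀, A w₀ = -1 := ⟨(-(A w₁)⁻¹) • w₁, by
    rw [map_smul, smul_eq_mul, neg_mul, inv_mul_cancel₀ hw₁]⟩
  have hker : ∀ k, A k = 0 → B k = 0 := by
    intro k hk
    by_contra hne
    have h1 := h (w₀ + ((1 - B w₀) / B k) • k) (by
      rw [map_add, map_smul, hk, smul_zero, add_zero, hAw₀]; norm_num)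
    rw [map_add, map_smul, smul_eq_mul, div_mul_cancel₀ _ hne] at h1
    linarith
  have hB' : ∀ w, B w = - (A w * B w₀) := by
    intro w
    have h1 := hker (w + A w • w₀) (by
      rw [map_add, map_smul, hAw₀, smul_eq_mul]; ring)
    rw [map_add, map_smul, smul_eq_mul] at h1
    linarith
  have hBw₀ : B w₀ ≠ 0 := fun h0 => hB (LinearMap.ext fun w => by rw [hB', h0]; simp)
  refine ⟨- (B w₀)⁻¹, by simpa using hBw₀, fun w => ?_⟩
  rw [hB' w]
  field_simp

section Surface

variable {X : Type*} [TopologicalSpace X] [ChartedSpace Plane X] [IsManifold (𝓡 2) ∞ X]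
variable {g : SurfaceMetric X} {M : Set X} {p : X} {ρ : X → ℝ}

theorem IsDefiningFunctionAt.fderiv_inChart_ne_zero (hρ : IsDefiningFunctionAt ρ Mᶜ p) :
    fderiv ℝ (inChart p ρ) (chartAt Plane p p) ≠ 0 := by
  intro h
  refine hρ.mfderiv_ne_zero (ContinuousLinearMap.ext fun v => ?_)
  have h1 := fderiv_inChart p hρ.smooth (mem_chart_source Plane p) v
  rw [h] at h1
  exact h1.symm

omit [IsManifold (𝓡 2) ∞ X] in
theorem inChart_chart (x₀ : X) {x : X} (hx : x ∈ (chartAt Plane x₀).source) (ρ : X → ℝ) :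
    inChart x₀ ρ (chartAt Plane x₀ x) = ρ x := by
  rw [inChart, (chartAt Plane x₀).left_inv hx]

omit [IsManifold (𝓡 2) ∞ X] in
theorem IsDefiningFunctionAt.eventually_eq_zero (hM : IsClosed M)
    (hρ : IsDefiningFunctionAt ρ Mᶜ p) : ∀ᶠ x in 𝓝 p, x ∈ frontier M → ρ x = 0 := by
  filter_upwards [hρ.mem_iff.eventually_nhds] with x hx hxM
  have hcont : Continuous ρ := hρ.smooth.continuous
  refine le_antisymm ?_ ?_
  · have h1 : x ∈ closure Mᶜ := by
      rw [← frontier_compl] at hxM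
      exact frontier_subset_closure hxM
    by_contra! hpos
    obtain ⟨y, hy, hyM⟩ := mem_closure_iff_nhds.1 h1 _
      (hx.and (hcont.continuousAt.eventually (lt_mem_nhds hpos)))
    have := hy.1.1 hyM
    linarith [hy.2]
  · by_contra! hneg
    exact hx.self_of_nhds.2 hneg (hM.frontier_subset hxM)

/-- A geodesic in `M` that hits the boundary has an outward or tangential velocity there. -/
theorem IsDefiningFunctionAt.velocity_nonpos (hρ : IsDefiningFunctionAt ρ Mᶜ p) {γ : ℝ → X}
    (hγ : IsGeodesic g γ) {t : ℝ} (ht : 0 < t)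
    (hγM : ∀ s ∈ Icc 0 t, γ s ∈ M) (hγp : γ t = p) :
    fderiv ℝ (inChart p ρ) (coord p (velocity γ t)).1 (coord p (velocity γ t)).2 ≤ 0 := by
  have hsrc : γ t ∈ (chartAt Plane p).source := by rw [hγp]; exact mem_chart_source Plane p
  have hf := (contDiffOn_inChart p hρ.smooth).contDiffAt
    ((chartAt Plane p).open_target.mem_nhds ((chartAt Plane p).map_source hsrc))
  have hd : HasDerivAt (fun s => (coord p (velocity γ s)).1) (coord p (velocity γ t)).2 t :=
    (hasFDerivAt_fst (𝕜 := ℝ) (E := Plane) (F := Plane)).comp_hasDerivAt t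
      (hγ.hasDerivAt_coord hsrc)
  have hd1 : HasDerivAt (fun s => inChart p ρ (coord p (velocity γ s)).1)
      (fderiv ℝ (inChart p ρ) (coord p (velocity γ t)).1 (coord p (velocity γ t)).2) t :=
    HasFDerivAt.comp_hasDerivAt (l := inChart p ρ) t
      (hf.differentiableAt (by simp)).hasFDerivAt hd
  by_contra! hpos
  -- going backwards in time, the geodesic would leave `M`
  have hd2 : HasDerivAt (fun s => inChart p ρ (coord p (velocity γ (t - s))).1)
      (- fderiv ℝ (inChart p ρ) (coord p (velocity γ t)).1 (coord p (velocity γ t)).2) 0 := by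
    have h := HasDerivAt.comp_const_sub (f := fun s => inChart p ρ (coord p (velocity γ s)).1)
      t 0 (by rwa [sub_zero])
    exact h
  have hz : inChart p ρ (coord p (velocity γ (t - 0))).1 = 0 := by
    rw [sub_zero]
    refine (inChart_chart p hsrc ρ).trans ?_
    rw [hγp, hρ.eq_zero]
  have hneg := eventually_neg_of_hasDerivAt hd2 hz (by linarith)
  have htend : Tendsto (fun s => γ (t - s)) (𝓝[>] 0) (𝓝 p) := by
    have h1 : ContinuousAt (fun s => γ (t - s)) 0 :=
      (hγ.1.continuous.comp (continuous_const.sub continuous_id)).continuousAt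
    have h2 := h1.tendsto.mono_left (nhdsWithin_le_nhds (s := Ioi 0))
    simpa [hγp] using h2
  obtain ⟨s, h1, h2, h3, h5', h4⟩ := (hneg.and ((htend.eventually hρ.mem_iff).and
    ((htend.eventually ((chartAt Plane p).open_source.mem_nhds (mem_chart_source Plane p))).and
      (Ioo_mem_nhdsGT ht)))).exists
  have h6 : inChart p ρ (coord p (velocity γ (t - s))).1 = ρ (γ (t - s)) := inChart_chart p h3 ρ
  rw [h6] at h1
  exact h2.2 h1 (hγM _ ⟨by linarith, by linarith⟩)

/-- At the boundary points near `p`, the unit normals are the normals of the defining function at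
`p`, although they are given by other defining functions. -/
theorem IsDefiningFunctionAt.eventually_normal (hM : IsClosed M)
    (hρ : IsDefiningFunctionAt ρ Mᶜ p) :
    ∀ᶠ x in 𝓝 p, x ∈ (chartAt Plane p).source ∧ (x ∈ frontier M → ρ x = 0) ∧
      fderiv ℝ (inChart p ρ) (chartAt Plane p x) ≠ 0 ∧
      (x ∈ frontier M → ∀ ν, IsInwardUnitNormal g M x ν → ∃ c : ℝ, c ≠ 0 ∧
        ∀ a : Plane, fderiv ℝ (inChart p ρ) (chartAt Plane p x) a
          = c * gForm g p (chartAt Plane p x) (chartD p x ν) a) := by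
  have hne : ∀ᶠ x in 𝓝 p, fderiv ℝ (inChart p ρ) (chartAt Plane p x) ≠ 0 := by
    have hf := (contDiffOn_inChart p hρ.smooth).contDiffAt
      ((chartAt Plane p).open_target.mem_nhds (mem_chart_target Plane p))
    have h1 : ContinuousAt (fderiv ℝ (inChart p ρ)) (chartAt Plane p p) :=
      ((hf.fderiv_right (m := 1) (by norm_cast)).differentiableAt (by simp)).continuousAt
    exact (ContinuousAt.comp (f := chartAt Plane p) h1
      ((chartAt Plane p).continuousAt (mem_chart_source Plane p))).eventually_ne
      hρ.fderiv_inChart_ne_zero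
  filter_upwards [(chartAt Plane p).open_source.mem_nhds (mem_chart_source Plane p),
    hρ.eventually_eq_zero hM, hne, hρ.mem_iff.eventually_nhds] with x hx hx0 hxne hxM
  refine ⟨hx, hx0, hxne, fun hxf ν hν => ?_⟩
  obtain ⟨hν1, ρ', hρ', c', hc', hν'⟩ := hν
  set u := chartAt Plane p x with hu
  have hut : u ∈ (chartAt Plane p).target := (chartAt Plane p).map_source hx
  have hB : ∀ a : Plane, fderiv ℝ (inChart p ρ') u a = c' * gForm g p u (chartD p x ν) a := by
    intro a
    obtain ⟨v, rfl⟩ := chartD_surjective p hx a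
    rw [fderiv_inChart p hρ'.smooth hx v, hν', inner_eq_gForm g p hx]
  have hB0 : fderiv ℝ (inChart p ρ') u ≠ 0 := by
    intro h
    have h1 := hB (chartD p x ν)
    rw [h, ← inner_eq_gForm g p hx, hν1, mul_one] at h1
    exact hc'.ne h1
  have hneg : ∀ w : Plane, fderiv ℝ (inChart p ρ) u w < 0 → fderiv ℝ (inChart p ρ') u w ≤ 0 := by
    intro w hw
    by_contra! hpos
    have hline : ∀ {f : X → ℝ}, ContMDiff (𝓡 2) 𝓘(ℝ, ℝ) ∞ f →
        HasDerivAt (fun s : ℝ => inChart p f (u + s • w)) (fderiv ℝ (inChart p f) u w) 0 := by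
      intro f hf
      exact (((contDiffOn_inChart p hf).contDiffAt
        ((chartAt Plane p).open_target.mem_nhds hut)).differentiableAt
          (by simp)).hasFDerivAt.hasLineDerivAt w
    have h1 := eventually_neg_of_hasDerivAt (hline hρ.smooth) (by
      rw [zero_smul, add_zero, hu, inChart_chart p hx, hx0 hxf]) hw
    have h2 := eventually_neg_of_hasDerivAt (hline hρ'.smooth).neg (by
      rw [Pi.neg_apply, zero_smul, add_zero, hu, inChart_chart p hx, hρ'.eq_zero, neg_zero])
      (by linarith)
    have htend : Tendsto (fun s : ℝ => (chartAt Plane p).symm (u + s • w)) (𝓝[>] 0) (𝓝 x) := by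
      have h3 : ContinuousAt (fun s : ℝ => u + s • w) 0 := by fun_prop
      have h4 : ContinuousAt (chartAt Plane p).symm (u + (0 : ℝ) • w) := by
        rw [zero_smul, add_zero]
        exact (chartAt Plane p).continuousAt_symm hut
      have h5 := (ContinuousAt.comp (f := fun s : ℝ => u + s • w) h4 h3).tendsto.mono_left
        (nhdsWithin_le_nhds (s := Ioi 0))
      simpa only [Function.comp_def, zero_smul, add_zero, hu,
        (chartAt Plane p).left_inv hx] using h5
    obtain ⟨s, h3, h4, h5, h6⟩ := (h1.and (h2.and ((htend.eventually hxM).and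
      (htend.eventually hρ'.mem_iff)))).exists
    have h7 := h6.1 (h5.2 h3)
    have h8 : - inChart p ρ' (u + s • w) < 0 := h4
    rw [inChart] at h8
    linarith
  obtain ⟨c, hc, hcAB⟩ := exists_eq_mul_of_neg_imp
    (A := (fderiv ℝ (inChart p ρ) u : Plane →ₗ[ℝ] ℝ))
    (B := (fderiv ℝ (inChart p ρ') u : Plane →ₗ[ℝ] ℝ))
    (fun h => hxne (ContinuousLinearMap.coe_injective h))
    (fun h => hB0 (ContinuousLinearMap.coe_injective h)) hneg
  refine ⟨c * c', mul_ne_zero hc hc'.ne', fun a => ?_⟩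
  have h1 : fderiv ℝ (inChart p ρ) u a = c * fderiv ℝ (inChart p ρ') u a := hcAB a
  rw [h1, hB, mul_assoc]

/-- In coordinates, the reflection in the line orthogonal to a unit normal is the reflection in
the level set of a function. -/
theorem coord_reflect {x₀ x : X} (hx : x ∈ (chartAt Plane x₀).source) {f : Plane → ℝ}
    {ν : TangentSpace (𝓡 2) x} (hν : g.inner x ν ν = 1) {c : ℝ} (hc : c ≠ 0)
    (hf : ∀ a : Plane, fderiv ℝ f (chartAt Plane x₀ x) a
      = c * gForm g x₀ (chartAt Plane x₀ x) (chartD x₀ x ν) a) (v : TangentSpace (𝓡 2) x) :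
    coord x₀ (⟨x, reflect g x ν v⟩ : TangentBundle (𝓡 2) X)
      = reflCoord g x₀ f (coord x₀ (⟨x, v⟩ : TangentBundle (𝓡 2) X)) := by
  set u := chartAt Plane x₀ x with hu
  have hut : u ∈ (chartAt Plane x₀).target := (chartAt Plane x₀).map_source hx
  have hdet := gDet_pos g x₀ hut
  set n := chartD x₀ x ν with hn
  have hnn : gForm g x₀ u n n = 1 := by rw [← hν, inner_eq_gForm g x₀ hx]
  have hnormal : normalVec g x₀ f u = (gDet g x₀ u * c) • n := by
    by_contra hne
    have h1 := gForm_self_pos g x₀ hut (sub_ne_zero.2 hne)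
    rw [gForm_sub_left, gForm_normalVec, gForm_smul_left, hf] at h1
    linarith
  have hN : normalSq g x₀ f u = gDet g x₀ u * c * c := by
    rw [normalSq, hnormal, map_smul, hf, hnn, smul_eq_mul]
    ring
  refine Prod.ext rfl ?_
  change chartD x₀ x (v - (2 * g.inner x v ν) • ν) = chartD x₀ x v
    - (2 * fderiv ℝ f u (chartD x₀ x v) / normalSq g x₀ f u) • normalVec g x₀ f u
  rw [map_sub, map_smul, hN, hnormal, hf, smul_smul, inner_eq_gForm g x₀ hx,
    gForm_comm g x₀ _ (chartD x₀ x v)]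
  congr 2
  field_simp
  rfl

/-- Reflection of a displacement at a concave boundary. -/
theorem IsJet.reflect {ι : Type*} {l : Filter ι} {ε : ι → ℝ} (hε : Tendsto ε l (𝓝[>] 0))
    (hM : IsClosed M) {V : ι → TangentBundle (𝓡 2) X} {V₀ : TangentBundle (𝓡 2) X}
    {ζ : Plane × Plane} (hζ : IsJet l ε V₀.1 V V₀ ζ) (hρ : IsDefiningFunctionAt ρ Mᶜ V₀.1)
    (hhess : ∀ v : TangentSpace (𝓡 2) V₀.1,
      mfderiv (𝓡 2) 𝓘(ℝ, ℝ) ρ V₀.1 v = 0 → 0 ≤ hessian g ρ V₀.1 v)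
    (hV₀ : V₀.1 ∈ frontier M) (hV : ∀ k, (V k).1 ∈ frontier M)
    {ν₀ : TangentSpace (𝓡 2) V₀.1} (hν₀ : IsInwardUnitNormal g M V₀.1 ν₀)
    {ν : ∀ k, TangentSpace (𝓡 2) (V k).1} (hν : ∀ k, IsInwardUnitNormal g M (V k).1 (ν k))
    (hin : fderiv ℝ (inChart V₀.1 ρ) (coord V₀.1 V₀).1 (coord V₀.1 V₀).2 ≤ 0)
    (htan : fderiv ℝ (inChart V₀.1 ρ) (coord V₀.1 V₀).1 ζ.1 = 0) :
    ∃ ζ', IsJet l ε V₀.1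
        (fun k => (⟨(V k).1, Billiard.reflect g (V k).1 (ν k) (V k).2⟩ : TangentBundle (𝓡 2) X))
        ⟨V₀.1, Billiard.reflect g V₀.1 ν₀ V₀.2⟩ ζ' ∧
      jacQ g V₀.1 (coord V₀.1 ⟨V₀.1, Billiard.reflect g V₀.1 ν₀ V₀.2⟩) ζ'
        = jacQ g V₀.1 (coord V₀.1 V₀) ζ ∧
      jacP g V₀.1 (coord V₀.1 V₀) ζ
        ≤ jacP g V₀.1 (coord V₀.1 ⟨V₀.1, Billiard.reflect g V₀.1 ν₀ V₀.2⟩) ζ' := by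
  have hsrc : V₀.1 ∈ (chartAt Plane V₀.1).source := mem_chart_source Plane V₀.1
  have htar : (coord V₀.1 V₀).1 ∈ (chartAt Plane V₀.1).target := mem_chart_target Plane V₀.1
  have hev := hρ.eventually_normal (g := g) hM
  obtain ⟨-, -, hne, hn₀⟩ := hev.self_of_nhds
  obtain ⟨c, hc, hfc⟩ := hn₀ hV₀ ν₀ hν₀
  have e₀ : coord V₀.1 ⟨V₀.1, Billiard.reflect g V₀.1 ν₀ V₀.2⟩
      = reflCoord g V₀.1 (inChart V₀.1 ρ) (coord V₀.1 V₀) := coord_reflect hsrc hν₀.1 hc hfc V₀.2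
  have hxk : Tendsto (fun k => (V k).1) l (𝓝 V₀.1) :=
    tendsto_proj_of_tendsto_coord hsrc hζ.mem (hζ.tendsto_coord hε)
  have hN := normalSq_pos g V₀.1 htar hne
  have hd := differentiableAt_reflCoord g V₀.1 (contDiffOn_inChart V₀.1 hρ.smooth)
    (z := coord V₀.1 V₀) htar
    hN.ne'
  refine ⟨_, hζ.map hε hd.hasFDerivAt (W₀ := ⟨V₀.1, Billiard.reflect g V₀.1 ν₀ V₀.2⟩)
    hsrc hζ.mem e₀ ?_, ?_⟩
  · filter_upwards [hxk.eventually hev] with k hk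
    obtain ⟨h1, -, -, h4⟩ := hk
    obtain ⟨c, hc, hfc⟩ := h4 (hV k) (ν k) (hν k)
    exact coord_reflect h1 (hν k).1 hc hfc (V k).2
  · rw [e₀]
    refine jacQ_jacP_reflCoord g V₀.1 (contDiffOn_inChart V₀.1 hρ.smooth) htar hne ?_ hin htan
    obtain ⟨v, hv⟩ := chartD_surjective V₀.1 hsrc (tangentVec (inChart V₀.1 ρ) (coord V₀.1 V₀).1)
    have h1 := hhess v (by
      rw [← fderiv_inChart V₀.1 hρ.smooth hsrc v, hv]
      exact fderiv_tangentVec _ _)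
    rw [hessian_eq_hessForm g hρ.smooth, hv] at h1
    exact h1

end Surface

/-! ### A criterion for countability -/

/-- A type is countable if it maps to a second countable space in such a way that no point is a
limit of other points. -/
theorem countable_of_forall_not_neBot {ι Y : Type*} [TopologicalSpace Y]
    [SecondCountableTopology Y] (Φ : ι → Y)
    (h : ∀ x, ¬ (comap Φ (𝓝 (Φ x)) ⊓ 𝓟 {x}ᶜ).NeBot) : Countable ι := by
  let _ : TopologicalSpace ι := TopologicalSpace.induced Φ inferInstance
  have _ : SecondCountableTopology ι := TopologicalSpace.secondCountableTopology_induced ι Y Φ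
  have _ : DiscreteTopology ι := by
    rw [discreteTopology_iff_nhds_ne]
    intro x
    have h1 := h x
    rw [← nhds_induced, neBot_iff, not_not] at h1
    exact h1
  exact TopologicalSpace.separableSpace_iff_countable.1 inferInstance

section Surface

variable {X : Type*} [TopologicalSpace X] [ChartedSpace Plane X] [IsManifold (𝓡 2) ∞ X]
variable {g : SurfaceMetric X} {M : Set X}

/-! ### Billiard trajectories with transversal reflections -/

variable (g M) in
/-- A geodesic segment in `M` of duration `t`, from the velocity `a` to the velocity `b`. -/
def IsSegment (t : ℝ) (a b : TangentBundle (𝓡 2) X) : Prop :=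
  ∃ γ : ℝ → X, IsGeodesic g γ ∧ 0 < t ∧ (∀ s ∈ Icc 0 t, γ s ∈ M) ∧
    velocity γ 0 = a ∧ velocity γ t = b

variable (g M) in
/-- A billiard trajectory with exactly `n` reflections, all of them transversal. The durations of
its segments are `τ 0, …, τ n`; the values `τ i` for `i > n` are irrelevant. -/
def BrokenGeodesic : ℕ → (ℕ → ℝ) → TangentBundle (𝓡 2) X → TangentBundle (𝓡 2) X → Prop
  | 0, τ, a, c => IsSegment g M (τ 0) a c
  | n + 1, τ, a, c => ∃ b : TangentBundle (𝓡 2) X, IsSegment g M (τ 0) a b ∧ b.1 ∈ frontier M ∧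
      ∃ ν : TangentSpace (𝓡 2) b.1, IsInwardUnitNormal g M b.1 ν ∧ g.inner b.1 b.2 ν ≠ 0 ∧
        BrokenGeodesic n (fun i => τ (i + 1)) ⟨b.1, reflect g b.1 ν b.2⟩ c

theorem IsSegment.trans [T2Space X] {t s : ℝ} {a b c : TangentBundle (𝓡 2) X}
    (h₁ : IsSegment g M t a b) (h₂ : IsSegment g M s b c) : IsSegment g M (t + s) a c := by
  obtain ⟨γ, hγ, ht, hγM, rfl, rfl⟩ := h₁
  obtain ⟨σ, hσ, hs, hσM, h0, rfl⟩ := h₂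
  have key : ∀ u, 0 ≤ u → velocity σ u = velocity γ (u + t) := by
    intro u hu
    rw [← velocity_comp_add hγ]
    refine (hγ.comp_add t).velocity_eq hσ ?_ hu
    rw [velocity_comp_add hγ, zero_add, h0]
  refine ⟨γ, hγ, add_pos ht hs, fun u hu => ?_, rfl, ?_⟩
  · by_cases hut : u ≤ t
    · exact hγM u ⟨hu.1, hut⟩
    · push Not at hut
      have h1 : σ (u - t) = γ (u - t + t) := congrArg TotalSpace.proj (key (u - t) (by linarith))
      rw [sub_add_cancel] at h1
      rw [← h1]
      exact hσM _ ⟨by linarith, by linarith [hu.2]⟩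
  · rw [key s hs.le, add_comm]

/-- A segment can be joined to the first segment of a trajectory that continues it. -/
theorem IsSegment.trans_brokenGeodesic [T2Space X] {t : ℝ} {a b c : TangentBundle (𝓡 2) X}
    (h₁ : IsSegment g M t a b) {n : ℕ} {τ : ℕ → ℝ} (h₂ : BrokenGeodesic g M n τ b c) :
    ∃ τ', BrokenGeodesic g M n τ' a c := by
  refine ⟨fun i => Nat.casesOn i (t + τ 0) fun j => τ (j + 1), ?_⟩
  cases n with
  | zero => exact h₁.trans h₂
  | succ n =>
    obtain ⟨d, hd, h⟩ := h₂
    exact ⟨d, h₁.trans hd, h⟩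

theorem reflect_eq_self {p : X} {ν v : TangentSpace (𝓡 2) p} (h : g.inner p v ν = 0) :
    reflect g p ν v = v := by
  rw [reflect, h, mul_zero, zero_smul, sub_zero]

/-- A segment followed by a reflection, possibly a tangential one. -/
theorem IsSegment.bounce [T2Space X] {t : ℝ} {a b c : TangentBundle (𝓡 2) X}
    (h₁ : IsSegment g M t a b) (hb : b.1 ∈ frontier M) {ν : TangentSpace (𝓡 2) b.1}
    (hν : IsInwardUnitNormal g M b.1 ν) {n : ℕ} {τ : ℕ → ℝ}
    (h₂ : BrokenGeodesic g M n τ ⟨b.1, reflect g b.1 ν b.2⟩ c) :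
    ∃ m τ', BrokenGeodesic g M m τ' a c := by
  by_cases h : g.inner b.1 b.2 ν = 0
  · rw [reflect_eq_self h] at h₂
    exact ⟨n, h₁.trans_brokenGeodesic h₂⟩
  · exact ⟨n + 1, fun i => Nat.casesOn i t τ, b, h₁, hb, ν, hν, h, h₂⟩

theorem BrokenGeodesic.bounce [T2Space X] {b c : TangentBundle (𝓡 2) X}
    (hb : b.1 ∈ frontier M) {ν : TangentSpace (𝓡 2) b.1}
    (hν : IsInwardUnitNormal g M b.1 ν) {n : ℕ} {τ : ℕ → ℝ}
    (h₂ : BrokenGeodesic g M n τ ⟨b.1, reflect g b.1 ν b.2⟩ c) (m : ℕ) :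
    ∀ (τ' : ℕ → ℝ) (a : TangentBundle (𝓡 2) X), BrokenGeodesic g M m τ' a b →
      ∃ k σ, BrokenGeodesic g M k σ a c := by
  induction m with
  | zero => exact fun τ' a h₁ => IsSegment.bounce h₁ hb hν h₂
  | succ m ih =>
    rintro τ' a ⟨d, hd, hdM, μ, hμ, hne, h⟩
    obtain ⟨k, σ, hk⟩ := ih _ _ h
    exact ⟨k + 1, fun i => Nat.casesOn i (τ' 0) σ, d, hd, hdM, μ, hμ, hne, hk⟩

/-- Tangential reflections do not change the velocity, so that the segments before and after them
are parts of the same geodesic and every trajectory has only transversal reflections. -/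
theorem BilliardFlow.exists_brokenGeodesic [T2Space X] {a c : TangentBundle (𝓡 2) X} {t : ℝ}
    (h : BilliardFlow g M a t c) : ∃ n τ, BrokenGeodesic g M n τ a c := by
  induction h with
  | segment γ hγ t ht hM => exact ⟨0, fun _ => t, γ, hγ, ht, hM, rfl, rfl⟩
  | bounce a c s t p v ν _ hp hν _ ih₁ ih₂ =>
    obtain ⟨m, τ', h₁⟩ := ih₁
    obtain ⟨n, τ, h₂⟩ := ih₂
    exact BrokenGeodesic.bounce (b := ⟨p, v⟩) hp hν h₂ m τ' a h₁

/-! ### Families of trajectories do not refocus -/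

variable {ι : Type*}

variable (g) in
/-- The family `V` of tangent vectors, close to `V₀` at the scale `ε`, diverges from `V₀`: it has a
displacement for which the product of the normal component and its covariant derivative is
nonnegative, and not both of them are zero. -/
def IsDiverging (l : Filter ι) (ε : ι → ℝ) (V : ι → TangentBundle (𝓡 2) X)
    (V₀ : TangentBundle (𝓡 2) X) : Prop :=
  ∃ x₀ ζ, IsJet l ε x₀ V V₀ ζ ∧ 0 ≤ jacP g x₀ (coord x₀ V₀) ζ ∧
    0 < jacQ g x₀ (coord x₀ V₀) ζ + jacR g x₀ (coord x₀ V₀) ζ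

/-- The boundary of `M` is concave: near each of its points, `M` is the complement of a set which
is geodesically convex at that point. -/
def HasConcaveBoundary (g : SurfaceMetric X) (M : Set X) : Prop :=
  ∀ p ∈ frontier M, ∃ ρ : X → ℝ, IsDefiningFunctionAt ρ Mᶜ p ∧
    ∀ v : TangentSpace (𝓡 2) p, mfderiv (𝓡 2) 𝓘(ℝ, ℝ) ρ p v = 0 → 0 ≤ hessian g ρ p v

/-- A diverging family of trajectories with a fixed number of reflections does not refocus. -/
theorem IsDiverging.not_forall_eq [T2Space X] (hK : ∀ x : X, gaussCurvature g x ≤ 0)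
    (hM : IsClosed M) (hconc : HasConcaveBoundary g M) {𝒰 : Ultrafilter ι} {ε : ι → ℝ}
    (hε : Tendsto ε 𝒰 (𝓝[>] 0)) (n : ℕ) :
    ∀ (τ : ι → ℕ → ℝ) (τ₀ : ℕ → ℝ) (a c : ι → TangentBundle (𝓡 2) X)
      (a₀ c₀ : TangentBundle (𝓡 2) X), IsDiverging g 𝒰 ε a a₀ →
      (∀ k, BrokenGeodesic g M n (τ k) (a k) (c k)) → BrokenGeodesic g M n τ₀ a₀ c₀ →
      (∀ i, Tendsto (fun k => τ k i) 𝒰 (𝓝 (τ₀ i))) → ¬ ∀ k, (c k).1 = c₀.1 := by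
  induction n with
  | zero =>
    rintro τ τ₀ a c a₀ c₀ ⟨y, ζ₀, hζ₀, hP₀, hQR₀⟩ hk h₀ hτ heq
    choose σ hσ _ _ hσa hσc using hk
    obtain ⟨γ, hγ, ht, -, rfl, rfl⟩ := h₀
    obtain rfl : a = fun k => velocity (σ k) 0 := funext fun k => (hσa k).symm
    obtain ⟨ζ, hζ, -, hQ⟩ := isJet_propagate hK hε hγ hσ hζ₀ hP₀ hQR₀ ht
      (mem_chart_source Plane (γ (τ₀ 0)))
    refine not_eventually_eq_of_jacQ_pos hε hγ hσ hζ₀ ht hζ hQ (hτ 0)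
      (Eventually.of_forall fun k => ?_)
    have h1 := heq k
    rw [← hσc k] at h1
    exact h1
  | succ n ih =>
    rintro τ τ₀ a c a₀ c₀ ⟨y, ζ₀, hζ₀, hP₀, hQR₀⟩ hk h₀ hτ
    choose b hb hbM ν hν _ hnext using hk
    choose σ hσ _ _ hσa hσb using hb
    obtain ⟨b₀, ⟨γ, hγ, ht, hγM, rfl, rfl⟩, hb₀M, ν₀, hν₀, hne₀, hnext₀⟩ := h₀
    obtain rfl : a = fun k => velocity (σ k) 0 := funext fun k => (hσa k).symm
    obtain rfl : b = fun k => velocity (σ k) (τ k 0) := funext fun k => (hσb k).symm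
    have hsrc : γ (τ₀ 0) ∈ (chartAt Plane (γ (τ₀ 0))).source := mem_chart_source Plane _
    obtain ⟨ζ, hζ, hP, hQ⟩ := isJet_propagate hK hε hγ hσ hζ₀ hP₀ hQR₀ ht hsrc
    obtain ⟨ρ, hρ, hhess⟩ := hconc _ hb₀M
    have hev := hρ.eventually_normal (g := g) hM
    obtain ⟨-, hρ0, hne, hn₀⟩ := hev.self_of_nhds
    obtain ⟨e, he, hfe⟩ := hn₀ hb₀M ν₀ hν₀
    -- the impact of the limit trajectory is transversal
    have htrans : fderiv ℝ (inChart (γ (τ₀ 0)) ρ) (coord (γ (τ₀ 0)) (velocity γ (τ₀ 0))).1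
        (coord (γ (τ₀ 0)) (velocity γ (τ₀ 0))).2 ≠ 0 := by
      have h1 := hfe (coord (γ (τ₀ 0)) (velocity γ (τ₀ 0))).2
      refine fun h0 => mul_ne_zero he hne₀ ?_
      rw [inner_eq_gForm g (γ (τ₀ 0)) (x := (velocity γ (τ₀ 0)).1) hsrc, gForm_comm]
      exact h1.symm.trans h0
    obtain ⟨hmem, hconv, -⟩ := IsJet.exists_tendsto_shift hε hγ hσ hζ₀ ht hζ (hτ 0)
    have hbk : Tendsto (fun k => σ k (τ k 0)) 𝒰 (𝓝 (γ (τ₀ 0))) :=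
      tendsto_proj_of_tendsto_coord (V := fun k => velocity (σ k) (τ k 0))
        (V₀ := velocity γ (τ₀ 0)) hsrc hmem hconv
    obtain ⟨ζ', hζ', htan, hQ', hP'⟩ := IsJet.exists_at_hitting_times hε hγ hσ hζ₀ ht hζ (hτ 0)
      (f := inChart (γ (τ₀ 0)) ρ)
      (((contDiffOn_inChart _ hρ.smooth).contDiffAt ((chartAt Plane (γ (τ₀ 0))).open_target.mem_nhds
        (mem_chart_target Plane (γ (τ₀ 0))))).differentiableAt (by simp)) htrans (by
        filter_upwards [hbk.eventually hev] with k hk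
        obtain ⟨h1, h2, -⟩ := hk
        exact ((inChart_chart _ h1 ρ).trans (h2 (hbM k))).trans
          ((inChart_chart _ hsrc ρ).trans (hρ0 hb₀M)).symm)
    have hin := hρ.velocity_nonpos hγ ht hγM rfl
    obtain ⟨ζ'', hζ'', hQ'', hP''⟩ := IsJet.reflect hε hM (V₀ := velocity γ (τ₀ 0)) hζ' hρ hhess
      hb₀M hbM hν₀ hν hin htan
    refine ih _ _ _ _ _ _ ⟨_, ζ'', hζ'', ?_, ?_⟩ hnext hnext₀ fun i => hτ (i + 1)
    · exact (hP.trans hP'.ge).trans hP''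
    · refine add_pos_of_pos_of_nonneg ?_ ?_
      · exact (hQ.trans_eq hQ'.symm).trans_eq hQ''.symm
      · exact gram_self_nonneg g _ (mem_chart_target Plane (γ (τ₀ 0))) _ _

/-- Distinct unit vectors at the same point diverge. -/
theorem isDiverging_of_unit {q : X} {𝒰 : Ultrafilter ι} {ξ : ι → TangentSpace (𝓡 2) q}
    {ξ₀ : TangentSpace (𝓡 2) q} (h : ∀ k, g.inner q (ξ k) (ξ k) = 1) (h₀ : g.inner q ξ₀ ξ₀ = 1)
    (hε : Tendsto (fun k => ‖chartD q q (ξ k) - chartD q q ξ₀‖) 𝒰 (𝓝[>] 0)) :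
    IsDiverging g 𝒰 (fun k => ‖chartD q q (ξ k) - chartD q q ξ₀‖)
      (fun k => (⟨q, ξ k⟩ : TangentBundle (𝓡 2) X)) ⟨q, ξ₀⟩ := by
  set ε : ι → ℝ := fun k => ‖chartD q q (ξ k) - chartD q q ξ₀‖ with hεdef
  have hsrc : q ∈ (chartAt Plane q).source := mem_chart_source Plane q
  have htar := mem_chart_target Plane q
  set u := chartAt Plane q q with hu
  have hdiff : ∀ k, coord q (⟨q, ξ k⟩ : TangentBundle (𝓡 2) X) - coord q ⟨q, ξ₀⟩
      = (0, chartD q q (ξ k) - chartD q q ξ₀) := fun k => Prod.ext (sub_self _) rfl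
  obtain ⟨ζ, hζ⟩ := exists_isJet_of_bound (x₀ := q) (C := 1)
    (V := fun k => (⟨q, ξ k⟩ : TangentBundle (𝓡 2) X)) (V₀ := ⟨q, ξ₀⟩) hε hsrc
    (Eventually.of_forall fun k => ⟨hsrc, by rw [hdiff, Prod.norm_mk, norm_zero, one_mul,
      max_eq_right (norm_nonneg _)]⟩)
  have hlim := hζ.lim
  simp only [hdiff, Prod.smul_mk, smul_zero] at hlim
  have hζ1 : ζ.1 = 0 :=
    tendsto_nhds_unique ((continuous_fst.tendsto _).comp hlim) tendsto_const_nhds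
  have hlim2 : Tendsto (fun k => (ε k)⁻¹ • (chartD q q (ξ k) - chartD q q ξ₀)) 𝒰 (𝓝 ζ.2) :=
    (continuous_snd.tendsto _).comp hlim
  have hpos : ∀ᶠ k in (𝒰 : Filter ι), 0 < ε k := hε.eventually self_mem_nhdsWithin
  have hnorm : ‖ζ.2‖ = 1 := by
    refine tendsto_nhds_unique hlim2.norm (tendsto_const_nhds.congr' ?_)
    filter_upwards [hpos] with k hk
    rw [norm_smul, norm_inv, Real.norm_of_nonneg hk.le]
    exact (inv_mul_cancel₀ hk.ne').symm
  have hconv : Tendsto (fun k => chartD q q (ξ k)) 𝒰 (𝓝 (chartD q q ξ₀)) :=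
    tendsto_iff_norm_sub_tendsto_zero.2 (tendsto_nhds_of_tendsto_nhdsWithin hε)
  have hcont : Continuous fun w : Plane × Plane => gForm g q u w.1 w.2 := by
    unfold gForm
    fun_prop
  have h1 : gForm g q u (chartD q q ξ₀) (chartD q q ξ₀) = 1 := by
    rw [← h₀, inner_eq_gForm g q hsrc]
  -- the displacement is orthogonal to `ξ₀`, since the lengths are constant
  have horth : gForm g q u (chartD q q ξ₀) ζ.2 = 0 := by
    have h2 := ((hcont.tendsto _).comp (hlim2.prodMk_nhds hconv)).add
      ((hcont.tendsto _).comp (tendsto_const_nhds (x := chartD q q ξ₀)|>.prodMk_nhds hlim2))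
    have h3 := tendsto_nhds_unique h2 (tendsto_const_nhds (x := (0 : ℝ)) |>.congr fun k => ?_)
    · simp only at h3
      rw [gForm_comm g q u ζ.2] at h3
      linarith
    · have h4 : gForm g q u (chartD q q (ξ k)) (chartD q q (ξ k)) = 1 := by
        rw [← h k, inner_eq_gForm g q hsrc]
      simp only [Function.comp]
      rw [gForm_smul_left, gForm_smul_right, gForm_sub_left, gForm_comm g q u _ (_ - _),
        gForm_sub_left, h4, h1, gForm_comm g q u (chartD q q ξ₀)]
      ring
  have hcov : covPart g q (coord q (⟨q, ξ₀⟩ : TangentBundle (𝓡 2) X)) ζ = ζ.2 := by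
    have h5 := chrVec_smul_left g q (coord q (⟨q, ξ₀⟩ : TangentBundle (𝓡 2) X)).1 0
      (coord q (⟨q, ξ₀⟩ : TangentBundle (𝓡 2) X)).2 0
    rw [zero_smul, zero_smul] at h5
    rw [covPart, hζ1, h5, add_zero]
  have hz : ∀ a, gForm g q u a 0 = 0 := fun a => by simp [gForm]
  have hP : jacP g q (coord q (⟨q, ξ₀⟩ : TangentBundle (𝓡 2) X)) ζ = 0 := by
    rw [jacP, hcov, hζ1]
    change gram g q u (chartD q q ξ₀) 0 ζ.2 = 0
    rw [gram, hz, gForm_comm g q u 0, hz]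
    ring
  have hR : 0 < jacR g q (coord q (⟨q, ξ₀⟩ : TangentBundle (𝓡 2) X)) ζ := by
    rw [jacR, hcov]
    change 0 < gram g q u (chartD q q ξ₀) ζ.2 ζ.2
    rw [gram, horth, h1, one_mul, mul_zero, sub_zero]
    exact gForm_self_pos g q htar (norm_ne_zero_iff.1 (by rw [hnorm]; exact one_ne_zero))
  exact ⟨q, ζ, hζ, hP.ge, add_pos_of_nonneg_of_pos (gram_self_nonneg g q htar _ _) hR⟩

/-- For every number `n` of reflections, the set of the directions of the loops at `q` with `n`
transversal reflections is countable, since together with the durations of the segments they form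
a discrete set. -/
theorem countable_brokenGeodesic_loops [T2Space X] (hK : ∀ x : X, gaussCurvature g x ≤ 0)
    (hM : IsClosed M) (hconc : HasConcaveBoundary g M) (q : X) (n : ℕ) :
    {ξ : TangentSpace (𝓡 2) q | g.inner q ξ ξ = 1 ∧ ∃ τ, ∃ η : TangentSpace (𝓡 2) q,
      BrokenGeodesic g M n τ ⟨q, ξ⟩ ⟨q, η⟩}.Countable := by
  set A := {ξ : TangentSpace (𝓡 2) q | g.inner q ξ ξ = 1 ∧ ∃ τ, ∃ η : TangentSpace (𝓡 2) q,
    BrokenGeodesic g M n τ ⟨q, ξ⟩ ⟨q, η⟩} with hA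
  have hex : ∀ ξ : A, ∃ τ, ∃ η : TangentSpace (𝓡 2) q,
      BrokenGeodesic g M n τ ⟨q, ξ.1⟩ ⟨q, η⟩ := fun ξ => ξ.2.2
  choose τ η hτη using hex
  refine countable_of_forall_not_neBot
    (fun ξ : A => ((chartD q q ξ.1, τ ξ) : Plane × (ℕ → ℝ))) fun ξ₀ hne => ?_
  set 𝒰 := @Ultrafilter.of _ _ hne with h𝒰
  have hle : (𝒰 : Filter A) ≤ comap (fun ξ : A => ((chartD q q ξ.1, τ ξ) : Plane × (ℕ → ℝ)))
      (𝓝 (chartD q q ξ₀.1, τ ξ₀)) ⊓ 𝓟 {ξ₀}ᶜ := @Ultrafilter.of_le _ _ hne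
  have hlim : Tendsto (fun ξ : A => ((chartD q q ξ.1, τ ξ) : Plane × (ℕ → ℝ))) 𝒰
      (𝓝 (chartD q q ξ₀.1, τ ξ₀)) := tendsto_iff_comap.2 (hle.trans inf_le_left)
  have hne' : ∀ᶠ ξ in (𝒰 : Filter A), ξ ≠ ξ₀ := (hle.trans inf_le_right) (mem_principal_self _)
  have hlim1 : Tendsto (fun ξ : A => chartD q q ξ.1) 𝒰 (𝓝 (chartD q q ξ₀.1)) :=
    (continuous_fst.tendsto _).comp hlim
  have hlim2 : Tendsto τ 𝒰 (𝓝 (τ ξ₀)) := (continuous_snd.tendsto _).comp hlim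
  have hε : Tendsto (fun ξ : A => ‖chartD q q ξ.1 - chartD q q ξ₀.1‖) 𝒰 (𝓝[>] 0) := by
    refine tendsto_nhdsWithin_iff.2 ⟨tendsto_iff_norm_sub_tendsto_zero.1 hlim1, ?_⟩
    filter_upwards [hne'] with ξ hξ
    refine norm_pos_iff.2 (sub_ne_zero.2 fun h => hξ (Subtype.ext ?_))
    exact chartD_injective q (mem_chart_source Plane q) h
  exact IsDiverging.not_forall_eq hK hM hconc hε n τ (τ ξ₀) _ (fun ξ => ⟨q, η ξ⟩) _ ⟨q, η ξ₀⟩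
    (isDiverging_of_unit (fun ξ : A => ξ.2.1) ξ₀.2.1 hε) hτη (hτη ξ₀)
    (fun i => (continuous_apply i).tendsto _ |>.comp hlim2) fun _ => rfl

theorem countable_loopDirections [T2Space X] (hK : ∀ x : X, gaussCurvature g x ≤ 0)
    (hM : IsClosed M) (hconc : HasConcaveBoundary g M) (q : X) :
    (loopDirections g M q).Countable := by
  refine (countable_iUnion fun n => countable_brokenGeodesic_loops hK hM hconc q n).mono ?_
  rintro ξ ⟨⟨h1, -⟩, T, -, η, h⟩
  obtain ⟨n, τ, hn⟩ := h.exists_brokenGeodesic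
  exact mem_iUnion.2 ⟨n, h1, τ, η, hn⟩

theorem arcLength_eq_zero_of_countable (g : SurfaceMetric X) (q : X)
    {S : Set (TangentSpace (𝓡 2) q)} (hS : S.Countable) : arcLength g q S = 0 := by
  let _ : RiemannianBundle (fun x : X => TangentSpace (𝓡 2) x) := ⟨g.toRiemannianMetric⟩
  let _ : MeasurableSpace (TangentSpace (𝓡 2) q) := borel (TangentSpace (𝓡 2) q)
  have _ : BorelSpace (TangentSpace (𝓡 2) q) := ⟨rfl⟩
  have _ := Measure.nullSingletonClass_hausdorff (TangentSpace (𝓡 2) q) (d := 1) one_pos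
  exact hS.measure_zero (Measure.hausdorffMeasure 1 : Measure (TangentSpace (𝓡 2) q))

/-! ### Tables bounded by disjoint convex obstacles -/

theorem isClosed_table {r : ℕ} {O : Fin r → Set X} (hO : ∀ j, IsConvexObstacle g (O j)) :
    IsClosed (table O) :=
  (isOpen_iUnion fun j => (hO j).isOpen).isClosed_compl

theorem hasConcaveBoundary_table {r : ℕ} {O : Fin r → Set X}
    (hO : ∀ j, IsConvexObstacle g (O j))
    (hdisj : ∀ i j, i ≠ j → Disjoint (closure (O i)) (closure (O j))) :
    HasConcaveBoundary g (table O) := by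
  intro p hp
  have hcl : p ∈ closure (⋃ j, O j) := by
    rw [table, frontier_compl] at hp
    exact frontier_subset_closure hp
  rw [closure_iUnion_of_finite] at hcl
  obtain ⟨j, hj⟩ := mem_iUnion.1 hcl
  have hpO : p ∉ O j := fun h =>
    (isClosed_table hO).frontier_subset hp (mem_iUnion.2 ⟨j, h⟩)
  have hpf : p ∈ frontier (O j) := ⟨hj, by rwa [(hO j).isOpen.interior_eq]⟩
  obtain ⟨ρ, hρ, hhess⟩ := (hO j).convex_boundary p hpf
  refine ⟨ρ, ⟨hρ.smooth, hρ.eq_zero, hρ.mfderiv_ne_zero, ?_⟩, hhess⟩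
  -- near `p` there is no other obstacle
  have hother : ∀ᶠ x in 𝓝 p, ∀ i, i ≠ j → x ∉ O i := by
    rw [eventually_all]
    intro i
    by_cases hij : i = j
    · exact Eventually.of_forall fun x h => absurd hij h
    · have : p ∉ closure (O i) := fun h => (hdisj i j hij).notMem_of_mem_left h hj
      filter_upwards [isClosed_closure.isOpen_compl.mem_nhds this] with x hx _ hxi
      exact hx (subset_closure hxi)
  filter_upwards [hρ.mem_iff, hother] with x hx hxo
  rw [← hx, table, compl_compl, mem_iUnion]
  refine ⟨?_, fun h => ⟨j, h⟩⟩
  rintro ⟨i, hi⟩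
  by_cases hij : i = j
  · rwa [← hij]
  · exact absurd hi (hxo i hij)

end Surface

end Billiard

end

theorem mainTheorem8 {X : Type*} [TopologicalSpace X] [T2Space X] [CompactSpace X]
    [ChartedSpace Billiard.Plane X] [IsManifold (𝓡 2) ∞ X]
    (g : Billiard.SurfaceMetric X)
    (hK : ∀ x : X, Billiard.gaussCurvature g x ≤ 0)
    {r : ℕ} (O : Fin r → Set X)
    (hO : ∀ j, Billiard.IsConvexObstacle g (O j))
    (hdisj : ∀ i j, i ≠ j → Disjoint (closure (O i)) (closure (O j))) :
    ∀ q ∈ frontier (Billiard.table O),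
      (Billiard.loopDirections g (Billiard.table O) q).Countable ∧
        ¬ Billiard.IsBoundarySelfFocal g (Billiard.table O) q := by
  intro q _
  have h := Billiard.countable_loopDirections hK (Billiard.isClosed_table hO)
    (Billiard.hasConcaveBoundary_table hO hdisj) q
  exact ⟨h, fun hpos => hpos.ne' (Billiard.arcLength_eq_zero_of_countable g q h)⟩
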